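/- **Setting.** Let $r_0>0$, $E>0$, an integer $n\ge 3$, and susceptibilities $\chi_\perp,\chi_\parallel\in\mathbb C$ be fixed, and let $\varepsilon_\omega,\varepsilon_{2\omega}\in\mathbb C\setminus\{-1\}$. For small $\epsilon>0$ let $\Omega_\epsilon\subset\mathbb R^2$ be the domain bounded by the curve $r=r_0(1+\epsilon\cos(n\theta))$, with outward unit normal $\nu$ and unit tangent $T$, and let $H(x)=-Ex_1$. Consider the coupled problem for the fundamental field $u$ and the second-harmonic field $U$, both harmonic inside and outside $\Omega_\epsilon$: $$u|_+=u|_-,\quad \partial_\nu u|_+=\varepsilon_\omega\,\partial_\nu u|_-,\quad U|_+-U|_-=4\pi P_\perp,\quad \partial_\nu U|_+-\varepsilon_{2\omega}\,\partial_\nu U|_-=-4\pi\sigma\quad\text{on }\partial\Omega_\epsilon,$$ $u=H+O(|x|^{-1})$ and $U=o(1)$ as $|x|\to\infty$, where $P_\perp=\chi_\perp(\varepsilon_\omega\partial_\nu u|_-)^2$, $P_\parallel=2\chi_\parallel(\varepsilon_\omega\partial_\nu u|_-)(\partial_Tu|_-)$ and $\sigma=-\nabla_\parallel\cdot(P_\parallel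 T)=-\partial_TP_\parallel$. Its first-order field expansion consists of $u^{(0)}+\epsilon u^{(1)}$ and $U^{(0)}+\epsilon U^{(1)}$, where all inner (outer) terms are independent of $\epsilon$ and harmonic in a neighbourhood of $\{|x|\le r_0\}$ (of $\{|x|\ge r_0\}$), $u^{(0)}=H+O(|x|^{-1})$, $u^{(1)}=O(|x|^{-1})$, $U^{(0)},U^{(1)}=o(1)$ at infinity, and the four transmission conditions on $\partial\Omega_\epsilon$ hold up to an error $O(\epsilon^2)$, uniformly on the curve, as $\epsilon\to0^+$. **Theorem.** (a) For $\varepsilon_\omega,\varepsilon_{2\omega}\ne-1$ such an expansion exists, and its second-harmonic part is given by $$U^{(0)}=\begin{cases}-\dfrac{8\pi E^2\chi_\perp\varepsilon_\omega^2}{(1+\varepsilon_\omega)^2}-A\,(\chi_\perp\varepsilon_\omega^2-2\chi_\parallel\varepsilon_\omega)\dfrac{r^2}{r_0^2}\cos2\theta,& r<r_0,\\[2mm] A\,(\chi_\perp\varepsilon_\omega^2\varepsilon_{2\omega}+2\chi_\parallel\varepsilon_\omega)\dfrac{r_0^2}{r^2}\cos2\theta,& r>r_0,\end{cases}\qquad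 A=\frac{8\pi E^2}{(1+\varepsilon_{2\omega})(1+\varepsilon_\omega)^2},$$ and, for $r>r_0$, $U^{(1)}=M_{n-2}r^{-(n-2)}\cos((n-2)\theta)+M_nr^{-n}\cos(n\theta)+M_{n+2}r^{-(n+2)}\cos((n+2)\theta)$ with $$M_{n-2}=A\Big(\tfrac{\varepsilon_{2\omega}-3}{1+\varepsilon_{2\omega}}\chi_\perp\varepsilon_\omega^2\varepsilon_{2\omega}+\tfrac{(n-2)\varepsilon_\omega-(3n-2)}{1+\varepsilon_\omega}\chi_\perp\varepsilon_\omega^2\varepsilon_{2\omega}+2\tfrac{(n-1)+(n+3)\varepsilon_{2\omega}}{1+\varepsilon_{2\omega}}\chi_\parallel\varepsilon_\omega\Big)r_0^{n-2},$$ $$M_n=2A\,\tfrac{\varepsilon_\omega-1}{1+\varepsilon_\omega}(n-1)(\chi_\perp\varepsilon_\omega^2\varepsilon_{2\omega}+2\chi_\parallel\varepsilon_\omega)r_0^n,\qquad M_{n+2}=A(n+1)(\chi_\perp\varepsilon_\omega^2\varepsilon_{2\omega}+2\chi_\parallel\varepsilon_\omega)r_0^{n+2}.$$ (b) Fix $\epsilon>0$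 and put $U=U^{(0)}+\epsilon U^{(1)}$ (inner expression for $|x|<r_0$, outer expression for $|x|\ge r_0$). Bounds below are uniform in $x\in\mathbb R^2$; "exact order $\rho$" means that $\sup_{|x|>r_0}|U(x)|$ lies between two positive constant multiples of $|\rho|$ near the limit. 1. Let $\varepsilon_{2\omega}\ne-1$ be fixed and $\varepsilon_\omega\to-1$. Then $U=O((1+\varepsilon_\omega)^{-3})$, and this is the exact order if and only if $\chi_\perp\varepsilon_{2\omega}\ne0$ or $\chi_\parallel\ne0$. 2. Let $\varepsilon_\omega\ne-1$ be fixed and $\varepsilon_{2\omega}\to-1$. Then $U=O((1+\varepsilon_{2\omega})^{-2})$, and this is the exact order if and only if $\varepsilon_\omega\ne0$ and $\chi_\perp\varepsilon_\omega\ne2\chi_\parallel$. 3. Let $\varepsilon_\omega\to-1$ and $\varepsilon_{2\omega}\to-1$ simultaneously, in any way (both staying different from $-1$). Then $U=O\big(|1+\varepsilon_\omega|^{-2}|1+\varepsilon_{2\omega}|^{-2}+|1+\varepsilon_\omega|^{-3}|1+\varepsilon_{2\omega}|^{-1}\big)$. If $1+\varepsilon_{2\omega}=o(1+\varepsilon_\omega)$,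 the exact order is $(1+\varepsilon_\omega)^{-2}(1+\varepsilon_{2\omega})^{-2}$ if and only if $\chi_\perp+2\chi_\parallel\ne0$. If $1+\varepsilon_\omega=O(1+\varepsilon_{2\omega})$, the exact order is $(1+\varepsilon_\omega)^{-3}(1+\varepsilon_{2\omega})^{-1}$ if and only if $\chi_\perp\ne0$ or $\chi_\parallel\ne0$. -/

import Mathlib

open Filter Topology Asymptotics Bornology InnerProductSpace

/-!
The plane `ℝ²` is identified with `ℂ` (`x₁ = z.re`, `x₂ = z.im`) and the fields are complex valued.
-/

noncomputable section

/-- The data of the model other than the permittivities: the radius `r₀` of the unperturbed disk,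
the amplitude `E` of the uniform field, the frequency `n` of the boundary perturbation, and the
surface susceptibilities `χ_⊥` and `χ_∥`. -/
structure NanowireModel where
  r₀ : ℝ
  E : ℝ
  n : ℕ
  χperp : ℂ
  χpar : ℂ

/-- A field with possibly different expressions inside and outside the particle. -/
structure TwoSidedField where
  inner : ℂ → ℂ
  outer : ℂ → ℂ

namespace TwoSidedField

/-- The first-order expansion `u₀ + ε u₁`. -/
def expand (u₀ u₁ : TwoSidedField) (ε : ℝ) : TwoSidedField where
  inner z := u₀.inner z + (ε : ℂ) * u₁.inner z
  outer z := u₀.outer z + (ε : ℂ) * u₁.outer z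

/-- The field as a function on the plane, glued along the circle of radius `r₀`. -/
def onPlane (u : TwoSidedField) (r₀ : ℝ) (z : ℂ) : ℂ :=
  if ‖z‖ < r₀ then u.inner z else u.outer z

/-- Both expressions are harmonic, up to and slightly across the circle of radius `r₀` (so that they
can be evaluated on the curves near this circle). -/
def Harmonic (u : TwoSidedField) (r₀ : ℝ) : Prop :=
  HarmonicOnNhd u.inner {z : ℂ | ‖z‖ ≤ r₀} ∧ HarmonicOnNhd u.outer {z : ℂ | r₀ ≤ ‖z‖}

end TwoSidedField

namespace NanowireModel

variable (M : NanowireModel)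

/-- The background potential `H(x) = -E x₁`. -/
def background (z : ℂ) : ℂ := ((-M.E * z.re : ℝ) : ℂ)

/-- The boundary `∂Ω_ε`: the curve `r = r₀ (1 + ε cos (n θ))`. -/
def curve (ε θ : ℝ) : ℂ :=
  ((M.r₀ * (1 + ε * Real.cos (M.n * θ)) : ℝ) : ℂ) * Complex.exp ((θ : ℂ) * Complex.I)

/-- The velocity of the parametrization of `∂Ω_ε`. -/
def velocity (ε θ : ℝ) : ℂ := deriv (fun t : ℝ => M.curve ε t) θ

/-- The Lamé coefficient (speed) of the parametrization of `∂Ω_ε`. -/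
def speed (ε θ : ℝ) : ℝ := ‖M.velocity ε θ‖

/-- The counterclockwise unit tangent of `∂Ω_ε`. -/
def tangent (ε θ : ℝ) : ℂ := M.velocity ε θ / (M.speed ε θ : ℂ)

/-- The outward unit normal of `∂Ω_ε`: the tangent turned by `-π/2`. -/
def normal (ε θ : ℝ) : ℂ := -Complex.I * M.tangent ε θ

/-- The normal derivative of `v` on `∂Ω_ε`. -/
def dNormal (v : ℂ → ℂ) (ε θ : ℝ) : ℂ := fderiv ℝ v (M.curve ε θ) (M.normal ε θ)

/-- The tangential derivative of `v` on `∂Ω_ε`. -/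
def dTangent (v : ℂ → ℂ) (ε θ : ℝ) : ℂ := fderiv ℝ v (M.curve ε θ) (M.tangent ε θ)

/-- Normal component `P_⊥ = χ_⊥ (ε_ω ∂u/∂ν|₋)²` of the nonlinear surface polarization on `∂Ω_ε`. -/
def Pperp (eω : ℂ) (u : TwoSidedField) (ε θ : ℝ) : ℂ :=
  M.χperp * (eω * M.dNormal u.inner ε θ) ^ 2

/-- Tangential component `P_∥ = 2 χ_∥ (ε_ω ∂u/∂ν|₋) (∂u/∂T|₋)` of the nonlinear surface polarization
on `∂Ω_ε`. -/
def Ppar (eω : ℂ) (u : TwoSidedField) (ε θ : ℝ) : ℂ :=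
  2 * M.χpar * (eω * M.dNormal u.inner ε θ) * M.dTangent u.inner ε θ

/-- The surface charge `σ = -∇_∥ · (P_∥ T)`, i.e. minus the arc-length derivative of `P_∥`. -/
def surfaceCharge (eω : ℂ) (u : TwoSidedField) (ε θ : ℝ) : ℂ :=
  -(deriv (fun t : ℝ => M.Ppar eω u ε t) θ / (M.speed ε θ : ℂ))

/-- `G ε θ = O(ε²)` as `ε → 0⁺`, uniformly in `θ`. -/
def IsSecondOrder (G : ℝ → ℝ → ℂ) : Prop :=
  ∃ C : ℝ, ∀ᶠ ε : ℝ in 𝓝[>] 0, ∀ θ : ℝ, ‖G ε θ‖ ≤ C * ε ^ 2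

/-- The fundamental field `u₀ + ε u₁` and the second-harmonic field `U₀ + ε U₁` form the first-order
field expansion of the coupled transmission problem on `Ω_ε`, for the permittivities `eω` (at the
fundamental frequency) and `e2ω` (at the double frequency): all terms are harmonic and satisfy
the conditions at infinity, and the four transmission conditions on `∂Ω_ε` hold up to `O(ε²)`. -/
structure IsFieldExpansion (eω e2ω : ℂ) (u₀ u₁ U₀ U₁ : TwoSidedField) : Prop where
  harmonic_u₀ : u₀.Harmonic M.r₀
  harmonic_u₁ : u₁.Harmonic M.r₀
  harmonic_U₀ : U₀.Harmonic M.r₀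
  harmonic_U₁ : U₁.Harmonic M.r₀
  infinity_u₀ : (fun z => u₀.outer z - M.background z) =O[cobounded ℂ] (fun z => ‖z‖⁻¹)
  infinity_u₁ : u₁.outer =O[cobounded ℂ] (fun z => ‖z‖⁻¹)
  infinity_U₀ : Tendsto U₀.outer (cobounded ℂ) (𝓝 0)
  infinity_U₁ : Tendsto U₁.outer (cobounded ℂ) (𝓝 0)
  /-- `u|₊ = u|₋`. -/
  jump_u : IsSecondOrder fun ε θ =>
    (u₀.expand u₁ ε).outer (M.curve ε θ) - (u₀.expand u₁ ε).inner (M.curve ε θ)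
  /-- `∂u/∂ν|₊ = ε_ω ∂u/∂ν|₋`. -/
  flux_u : IsSecondOrder fun ε θ =>
    M.dNormal (u₀.expand u₁ ε).outer ε θ - eω * M.dNormal (u₀.expand u₁ ε).inner ε θ
  /-- `U|₊ - U|₋ = 4π P_⊥`. -/
  jump_U : IsSecondOrder fun ε θ =>
    (U₀.expand U₁ ε).outer (M.curve ε θ) - (U₀.expand U₁ ε).inner (M.curve ε θ)
      - 4 * (Real.pi : ℂ) * M.Pperp eω (u₀.expand u₁ ε) ε θ
  /-- `∂U/∂ν|₊ - ε_{2ω} ∂U/∂ν|₋ = -4π σ`. -/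
  flux_U : IsSecondOrder fun ε θ =>
    M.dNormal (U₀.expand U₁ ε).outer ε θ - e2ω * M.dNormal (U₀.expand U₁ ε).inner ε θ
      + 4 * (Real.pi : ℂ) * M.surfaceCharge eω (u₀.expand u₁ ε) ε θ

/-- `(U₀, U₁)` are the leading and the first-order term of the second-harmonic field. -/
def IsSecondHarmonic (eω e2ω : ℂ) (U₀ U₁ : TwoSidedField) : Prop :=
  ∃ u₀ u₁ : TwoSidedField, M.IsFieldExpansion eω e2ω u₀ u₁ U₀ U₁

/-- The common factor `8πE² / ((1 + ε_{2ω}) (1 + ε_ω)²)`. -/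
def prefactor (eω e2ω : ℂ) : ℂ :=
  8 * (Real.pi : ℂ) * (M.E : ℂ) ^ 2 / ((1 + e2ω) * (1 + eω) ^ 2)

/-- The coefficient `M_{n-2}` of the first-order second-harmonic field. -/
def coeffMinus (eω e2ω : ℂ) : ℂ :=
  M.prefactor eω e2ω *
    ((e2ω - 3) / (1 + e2ω) * (M.χperp * eω ^ 2 * e2ω)
      + (((M.n : ℂ) - 2) * eω - (3 * (M.n : ℂ) - 2)) / (1 + eω) * (M.χperp * eω ^ 2 * e2ω)
      + 2 * (((M.n : ℂ) - 1) + ((M.n : ℂ) + 3) * e2ω) / (1 + e2ω) * (M.χpar * eω))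
    * (M.r₀ : ℂ) ^ (M.n - 2)

/-- The coefficient `M_n` of the first-order second-harmonic field. -/
def coeffMid (eω e2ω : ℂ) : ℂ :=
  2 * M.prefactor eω e2ω *
    ((eω - 1) / (1 + eω) * ((M.n : ℂ) - 1) * (M.χperp * eω ^ 2 * e2ω + 2 * M.χpar * eω))
    * (M.r₀ : ℂ) ^ M.n

/-- The coefficient `M_{n+2}` of the first-order second-harmonic field. -/
def coeffPlus (eω e2ω : ℂ) : ℂ :=
  M.prefactor eω e2ω * ((M.n : ℂ) + 1) * (M.χperp * eω ^ 2 * e2ω + 2 * M.χpar * eω)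
    * (M.r₀ : ℂ) ^ (M.n + 2)

end NanowireModel

/-- `cos (m θ)`, where `θ` is the polar angle of `z`. -/
def cosMode (m : ℕ) (z : ℂ) : ℂ := ((Real.cos (m * z.arg) : ℝ) : ℂ)

/-- The fields `v i` are `O(ρ i)` along the filter `l`, uniformly on `S`. -/
def IsResonanceBound {ι : Type*} (l : Filter ι) (ρ : ι → ℝ) (v : ι → ℂ → ℂ) (S : Set ℂ) : Prop :=
  ∃ C : ℝ, ∀ᶠ i in l, ∀ z ∈ S, ‖v i z‖ ≤ C * ρ i

/-- The supremum norm of `v i` on `S` is exactly of order `ρ i` along the filter `l`. -/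
def IsResonanceOrder {ι : Type*} (l : Filter ι) (ρ : ι → ℝ) (v : ι → ℂ → ℂ) (S : Set ℂ) : Prop :=
  IsResonanceBound l ρ v S ∧ ∃ c : ℝ, 0 < c ∧ ∀ᶠ i in l, ∃ z ∈ S, c * ρ i ≤ ‖v i z‖

end

/-!
Write `e` and `f` for the permittivities at the fundamental and the double frequency.

*Uniqueness.* If `v₀ + ε v₁` satisfies homogeneous transmission conditions on `∂Ω_ε` up to
`O(ε²)`, letting `ε → 0` shows that `v₀` solves the homogeneous problem on the disk, and if
`v₀ = 0`, dividing by `ε` shows the same of `v₁` (`NanowireModel.homogeneous_expansion_unique`). The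
homogeneous problem on the disk has only the zero solution when the permittivity is not `-1`
(`transmission_unique`). The permittivity is complex, so energy arguments are not available.
Instead, `z ∂v/∂z` on one side of the circle and the reflection of `z ∂(conj v)/∂z` from the other
side are holomorphic on the same side, the transmission conditions become linear relations on the
circle between the four functions so obtained, and suitable combinations glue to bounded
entire functions vanishing at infinity
(`eq_zero_of_eqOn_circle`). The decay of the derivatives comes from an interior gradient estimate.
Since the sources of the second-harmonic problem depend only on the fundamental field, both fields
are unique (`NanowireModel.IsFieldExpansion.secondHarmonic_unique`).

*Existence.* The candidate is a finite sum of the modes `Re ((z / r₀) ^ p)`. Their traces and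
their normal and tangential derivatives along `∂Ω_ε` are explicit, and `FirstOrder` is a calculus
of expansions `g₀ + ε g₁ + O(ε²)` uniform in the angle, which reduces the four transmission
conditions to a linear system for the coefficients
(`NanowireModel.isFieldExpansion_of_coefficients`). The coefficients in the statement solve it
(`NanowireModel.isFieldExpansion_secondHarmonic`).

*Resonances.* All coefficients are
`((1 + e) (1 + f) P + (1 + e) Q + (1 + f) R) / ((1 + e)³ (1 + f)²)` with polynomials `P`, `Q`, `R`
(`IsResonantCoeff`); this gives the upper bounds. For the
lower bounds, two combinations of the values at `2 r₀` and `4 r₀` isolate the coefficients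
`M_{n-2}` and `M_n`, up to those of the modes `2` and `n + 2`, which are always of lower order.
Hence the order is attained exactly when `M_{n-2}` or `M_n` has a nonzero leading coefficient
(`NanowireModel.isResonanceOrder_secondHarmonicField_iff`). The most delicate regime is
`1 + e = O(1 + f)`, where the leading part of `M_{n-2}` need not converge: unless
`χ_⊥ + 2 χ_∥ = 0`, the
coefficient `M_n` alone decides, and in this exceptional case the part of `M_{n-2}` that is
resonant at the double frequency degenerates.
-/

/-! ### Holomorphic derivatives of harmonic functions -/

/-- Twice the Wirtinger derivative, `2 ∂v/∂z = ∂v/∂x₁ - i ∂v/∂x₂`, of a function on the plane. -/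
noncomputable def wirtinger (v : ℂ → ℂ) (z : ℂ) : ℂ :=
  fderiv ℝ v z 1 - Complex.I * fderiv ℝ v z Complex.I

theorem fderiv_eq_wirtinger {v : ℂ → ℂ} {z : ℂ} (hv : DifferentiableAt ℝ v z) (h : ℂ) :
    fderiv ℝ v z h = (wirtinger v z * h
      + (starRingEnd ℂ) (wirtinger (fun w => (starRingEnd ℂ) (v w)) z * h)) / 2 := by
  have hc : fderiv ℝ (fun w => (starRingEnd ℂ) (v w)) z =
      (Complex.conjCLE : ℂ →L[ℝ] ℂ).comp (fderiv ℝ v z) :=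
    ((Complex.conjCLE : ℂ →L[ℝ] ℂ).hasFDerivAt.comp z hv.hasFDerivAt).fderiv
  have hh : fderiv ℝ v z h = h.re * fderiv ℝ v z 1 + h.im * fderiv ℝ v z Complex.I := by
    have : h = h.re • (1 : ℂ) + h.im • Complex.I := by simp
    conv_lhs => rw [this, map_add, map_smul, map_smul]
    simp
  rw [hh, wirtinger, wirtinger, hc]
  have h1 : h = h.re + h.im * Complex.I := by simp
  have h2 : (starRingEnd ℂ) h = h.re - h.im * Complex.I := by
    apply Complex.ext <;> simp
  simp only [map_mul, map_sub, ContinuousLinearMap.comp_apply, ContinuousLinearEquiv.coe_coe,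
    Complex.conjCLE_apply, Complex.conj_conj, Complex.conj_I, h2]
  conv_rhs => rw [h1]
  simp only [Complex.add_re, Complex.ofReal_re, Complex.mul_re, Complex.ofReal_im, Complex.I_re,
    Complex.I_im, Complex.add_im, Complex.mul_im]
  ring_nf
  simp only [Complex.I_sq]
  ring

theorem wirtinger_eq_re_im {v : ℂ → ℂ} {z : ℂ} (hv : DifferentiableAt ℝ v z) :
    wirtinger v z =
      (((fderiv ℝ (fun w => (v w).re) z 1 : ℝ) : ℂ)
          - Complex.I * ((fderiv ℝ (fun w => (v w).re) z Complex.I : ℝ) : ℂ))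
      + Complex.I * (((fderiv ℝ (fun w => (v w).im) z 1 : ℝ) : ℂ)
          - Complex.I * ((fderiv ℝ (fun w => (v w).im) z Complex.I : ℝ) : ℂ)) := by
  have h1 : fderiv ℝ (fun w => (v w).re) z = Complex.reCLM.comp (fderiv ℝ v z) :=
    (Complex.reCLM.hasFDerivAt.comp z hv.hasFDerivAt).fderiv
  have h2 : fderiv ℝ (fun w => (v w).im) z = Complex.imCLM.comp (fderiv ℝ v z) :=
    (Complex.imCLM.hasFDerivAt.comp z hv.hasFDerivAt).fderiv
  rw [h1, h2, wirtinger]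
  simp only [ContinuousLinearMap.comp_apply, Complex.reCLM_apply, Complex.imCLM_apply]
  apply Complex.ext <;> simp
  ring

theorem harmonicAt_re {v : ℂ → ℂ} {z : ℂ} (hv : HarmonicAt v z) :
    HarmonicAt (fun w => (v w).re) z := hv.comp_CLM Complex.reCLM

theorem harmonicAt_im {v : ℂ → ℂ} {z : ℂ} (hv : HarmonicAt v z) :
    HarmonicAt (fun w => (v w).im) z := hv.comp_CLM Complex.imCLM

theorem harmonicAt_conj {v : ℂ → ℂ} {z : ℂ} (hv : HarmonicAt v z) :
    HarmonicAt (fun w => (starRingEnd ℂ) (v w)) z :=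
  hv.comp_CLM (Complex.conjCLE : ℂ →L[ℝ] ℂ)

theorem differentiableAt_of_harmonicAt {v : ℂ → ℂ} {z : ℂ} (hv : HarmonicAt v z) :
    DifferentiableAt ℝ v z := hv.1.differentiableAt two_ne_zero

theorem analyticAt_wirtinger {v : ℂ → ℂ} {z : ℂ} (hv : HarmonicAt v z) :
    AnalyticAt ℂ (wirtinger v) z := by
  have h := (HarmonicAt.analyticAt_complex_partial (harmonicAt_re hv)).add
    (analyticAt_const (v := Complex.I) |>.mul
      (HarmonicAt.analyticAt_complex_partial (harmonicAt_im hv)))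
  refine h.congr ?_
  filter_upwards [hv.eventually] with w hw
  exact (wirtinger_eq_re_im (differentiableAt_of_harmonicAt hw)).symm

theorem analyticAt_real_of_harmonicAt {v : ℂ → ℂ} {z : ℂ} (hv : HarmonicAt v z) :
    AnalyticAt ℝ v z := by
  have h1 := (Complex.ofRealCLM.analyticAt _).comp (HarmonicAt.analyticAt (harmonicAt_re hv))
  have h2 := (Complex.ofRealCLM.analyticAt _).comp (HarmonicAt.analyticAt (harmonicAt_im hv))
  have h3 := h1.add (h2.mul (analyticAt_const (v := Complex.I)))
  refine h3.congr (Eventually.of_forall fun w => ?_)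
  simp

/-- Interior gradient estimate: a real harmonic function bounded by `B` on a disk of radius `R`
has a gradient of size at most `8B/R` at the centre. It follows from the Borel–Carathéodory
inequality for the holomorphic function of which it is the real part. -/
theorem abs_fderiv_le_of_harmonicOnNhd_ball {f : ℂ → ℝ} {z₀ : ℂ} {R B : ℝ} (hR : 0 < R)
    (hB : 0 < B) (hf : HarmonicOnNhd f (Metric.ball z₀ R))
    (hb : ∀ z ∈ Metric.ball z₀ R, |f z| ≤ B) (h : ℂ) :
    |fderiv ℝ f z₀ h| ≤ 8 * B / R * ‖h‖ := by
  obtain ⟨F, hF, hFf⟩ := hf.exists_analyticOnNhd_ball_re_eq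
  have hmem : ∀ w : ℂ, w ∈ Metric.ball (0 : ℂ) R → z₀ + w ∈ Metric.ball z₀ R := by
    intro w hw; simpa [Metric.mem_ball, dist_eq_norm] using hw
  have h0 : z₀ ∈ Metric.ball z₀ R := Metric.mem_ball_self hR
  set g : ℂ → ℂ := fun w => F (z₀ + w) - F z₀ with hg
  have hgd : DifferentiableOn ℂ g (Metric.ball 0 R) := by
    intro w hw
    have := (hF _ (hmem w hw)).differentiableAt
    exact ((this.comp w (by fun_prop : DifferentiableAt ℂ (fun w => z₀ + w) w)).sub_const
      _).differentiableWithinAt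
  have hre : Set.MapsTo g (Metric.ball 0 R) {z | z.re ≤ 2 * B} := by
    intro w hw
    have h1 := hFf (hmem w hw)
    have h2 := hFf h0
    have h3 := abs_le.1 (hb _ (hmem w hw))
    have h4 := abs_le.1 (hb _ h0)
    simp only [Set.mem_ofPred_eq, hg, Complex.sub_re]
    simp only at h1 h2
    linarith [h3.2, h4.1]
  have hbound : ∀ w ∈ Metric.sphere (0 : ℂ) (R / 2), ‖g w‖ ≤ 4 * B := by
    intro w hw
    have hw' : ‖w‖ = R / 2 := by simpa using hw
    have := Complex.borelCaratheodory_zero (by positivity : 0 < 2 * B) hgd hre hR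
      (z := w) (by simp [hw']; linarith) (by simp [hg])
    rw [hw'] at this
    refine this.trans (le_of_eq ?_)
    field_simp
    ring
  have hder := Complex.norm_deriv_le_of_forall_mem_sphere_norm_le (by positivity : 0 < R / 2)
    (hgd.mono (by
      rw [closure_ball _ (by positivity)]
      exact Metric.closedBall_subset_ball (by linarith))).diffContOnCl hbound
  have hFd := (hF _ h0).differentiableAt
  have hgF : deriv g 0 = deriv F z₀ := by
    simp only [hg, deriv_sub_const]
    rw [deriv_comp_const_add]; simp
  have hfd : HasFDerivAt f (Complex.reCLM.comp
      ((ContinuousLinearMap.toSpanSingleton ℂ (deriv F z₀)).restrictScalars ℝ)) z₀ := by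
    have h1 := Complex.reCLM.hasFDerivAt.comp z₀
      (hFd.hasDerivAt.hasFDerivAt.restrictScalars ℝ)
    refine h1.congr_of_eventuallyEq ?_
    filter_upwards [Metric.ball_mem_nhds z₀ hR] with w hw
    exact (hFf hw).symm
  rw [hfd.fderiv]
  have : ‖h * deriv F z₀‖ ≤ 8 * B / R * ‖h‖ := by
    rw [norm_mul, mul_comm]
    rw [hgF] at hder
    refine mul_le_mul_of_nonneg_right (hder.trans (le_of_eq ?_)) (norm_nonneg _)
    field_simp
    ring
  refine le_trans ?_ this
  simpa using Complex.abs_re_le_norm (h * deriv F z₀)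

theorem norm_wirtinger_le {v : ℂ → ℂ} {z₀ : ℂ} {R B : ℝ} (hR : 0 < R)
    (hB : 0 < B) (hv : HarmonicOnNhd v (Metric.ball z₀ R))
    (hb : ∀ z ∈ Metric.ball z₀ R, ‖v z‖ ≤ B) :
    ‖wirtinger v z₀‖ ≤ 32 * B / R := by
  have h0 : z₀ ∈ Metric.ball z₀ R := Metric.mem_ball_self hR
  rw [wirtinger_eq_re_im (differentiableAt_of_harmonicAt (hv z₀ h0))]
  have h1 := abs_fderiv_le_of_harmonicOnNhd_ball hR hB (fun z hz => harmonicAt_re (hv z hz))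
    (fun z hz => (Complex.abs_re_le_norm _).trans (hb z hz))
  have h2 := abs_fderiv_le_of_harmonicOnNhd_ball hR hB (fun z hz => harmonicAt_im (hv z hz))
    (fun z hz => (Complex.abs_im_le_norm _).trans (hb z hz))
  have e1 := h1 1
  have e2 := h1 Complex.I
  have e3 := h2 1
  have e4 := h2 Complex.I
  simp only [norm_one, Complex.norm_I, mul_one] at e1 e2 e3 e4
  refine (norm_add_le _ _).trans ?_
  rw [norm_mul, Complex.norm_I, one_mul]
  refine (add_le_add (norm_sub_le _ _) (norm_sub_le _ _)).trans ?_
  simp only [norm_mul, Complex.norm_I, one_mul, Complex.norm_real, Real.norm_eq_abs]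
  calc _ ≤ (8 * B / R + 8 * B / R) + (8 * B / R + 8 * B / R) := by gcongr
    _ = 32 * B / R := by ring

/-- A harmonic function vanishing at infinity has a gradient that is `o(1/|z|)`. -/
theorem tendsto_mul_wirtinger_cobounded {v : ℂ → ℂ} {r : ℝ}
    (hv : HarmonicOnNhd v {z : ℂ | r ≤ ‖z‖}) (h0 : Tendsto v (cobounded ℂ) (𝓝 0)) :
    Tendsto (fun z => z * wirtinger v z) (cobounded ℂ) (𝓝 0) := by
  rw [Metric.tendsto_nhds]
  intro δ hδ
  have h1 : ∀ᶠ z in cobounded ℂ, ‖v z‖ < δ / 128 := by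
    have := (Metric.tendsto_nhds.1 h0) (δ / 128) (by positivity)
    simpa using this
  have h2 := (Filter.hasBasis_cobounded_norm (E := ℂ)).eventually_iff.1 h1
  obtain ⟨K, -, hK⟩ := h2
  have h3 : ∀ᶠ z : ℂ in cobounded ℂ, max (max (2 * K) (2 * r)) 1 ≤ ‖z‖ :=
    (tendsto_norm_cobounded_atTop).eventually_ge_atTop _
  filter_upwards [h3] with z hz
  have hzK : 2 * K ≤ ‖z‖ := (le_max_left _ _).trans ((le_max_left _ _).trans hz)
  have hzr : 2 * r ≤ ‖z‖ := (le_max_right _ _).trans ((le_max_left _ _).trans hz)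
  have hz1 : 1 ≤ ‖z‖ := (le_max_right _ _).trans hz
  have hball : ∀ w ∈ Metric.ball z (‖z‖ / 2), ‖z‖ / 2 ≤ ‖w‖ := by
    intro w hw
    have h5 : ‖z - w‖ < ‖z‖ / 2 := by
      rw [← dist_eq_norm, dist_comm]; exact hw
    have h6 := norm_sub_norm_le z w
    linarith
  have := norm_wirtinger_le (v := v) (z₀ := z) (R := ‖z‖ / 2) (B := δ / 128) (by positivity)
    (by positivity) (fun w hw => hv w (by
      have := hball w hw
      change r ≤ ‖w‖
      linarith)) (fun w hw => (hK (by
      have := hball w hw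
      change K ≤ ‖w‖
      linarith)).le)
  rw [dist_zero_right, norm_mul]
  calc ‖z‖ * ‖wirtinger v z‖ ≤ ‖z‖ * (32 * (δ / 128) / (‖z‖ / 2)) := by gcongr
    _ = δ / 2 := by field_simp; ring
    _ < δ := by linarith

/-! ### Gluing along a circle and reflection -/

/-- Two holomorphic functions, one in the punctured disk, tending to `0` at the centre, the other in
the exterior, tending to `0` at infinity, that agree on the circle are both zero: they glue to a
bounded entire function. -/
theorem eq_zero_of_eqOn_circle {φ ψ : ℂ → ℂ} {r : ℝ} (hr : 0 < r)
    (hφ : ∀ z : ℂ, z ≠ 0 → ‖z‖ ≤ r → AnalyticAt ℂ φ z) (hφ0 : Tendsto φ (𝓝[≠] 0) (𝓝 0))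
    (hψ : ∀ z : ℂ, r ≤ ‖z‖ → AnalyticAt ℂ ψ z) (hψ0 : Tendsto ψ (cobounded ℂ) (𝓝 0))
    (h : ∀ z : ℂ, ‖z‖ = r → φ z = ψ z) :
    (∀ z : ℂ, z ≠ 0 → ‖z‖ ≤ r → φ z = 0) ∧ ∀ z : ℂ, r ≤ ‖z‖ → ψ z = 0 := by
  classical
  set g : ℂ → ℂ := fun z => if z = 0 then 0 else if ‖z‖ ≤ r then φ z else ψ z with hg
  have hin : ∀ z : ℂ, z ≠ 0 → ‖z‖ < r → g =ᶠ[𝓝 z] φ := by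
    intro z hz hzr
    filter_upwards [isOpen_ne.mem_nhds hz,
      (isOpen_lt continuous_norm continuous_const).mem_nhds hzr] with w hw hwr
    have hw' : ‖w‖ < r := hwr
    simp only [hg]
    rw [if_neg hw, if_pos hw'.le]
  have hout : ∀ z : ℂ, r < ‖z‖ → g =ᶠ[𝓝 z] ψ := by
    intro z hzr
    filter_upwards [(isOpen_lt continuous_const continuous_norm).mem_nhds hzr] with w hwr
    have hw' : r < ‖w‖ := hwr
    simp only [hg]
    rw [if_neg (by intro h; simp [h] at hw'; linarith), if_neg (not_le.2 hw')]
  have hon : ∀ z : ℂ, ‖z‖ = r → g =ᶠ[𝓝 z] φ := by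
    intro z hz
    have hz0 : z ≠ 0 := by intro h; simp [h] at hz; linarith
    have hfreq : ∃ᶠ w in 𝓝[≠] z, φ w = ψ w := by
      -- points of the circle accumulate at `z`
      have hcont : Tendsto (fun t : ℝ => z * Complex.exp (t * Complex.I)) (𝓝[≠] 0) (𝓝[≠] z) := by
        refine tendsto_nhdsWithin_iff.2 ⟨?_, ?_⟩
        · have : Continuous (fun t : ℝ => z * Complex.exp (t * Complex.I)) := by fun_prop
          have h1 := this.tendsto 0
          simp only [Complex.ofReal_zero, zero_mul, Complex.exp_zero, mul_one] at h1
          exact h1.mono_left nhdsWithin_le_nhds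
        · have hI : Set.Ioo (-1 : ℝ) 1 ∈ 𝓝 (0 : ℝ) := Ioo_mem_nhds (by norm_num) (by norm_num)
          filter_upwards [nhdsWithin_le_nhds hI, self_mem_nhdsWithin] with t ht ht0
          intro hzt
          have h2 : Complex.exp (t * Complex.I) = 1 := by
            have : z * Complex.exp (t * Complex.I) = z * 1 := by simpa using hzt
            exact mul_left_cancel₀ hz0 this
          have h3 := congrArg Complex.im h2
          rw [Complex.exp_ofReal_mul_I_im, Complex.one_im] at h3
          have h4 := Real.sin_eq_zero_iff_of_lt_of_lt (x := t)
            (by linarith [ht.1, Real.pi_gt_three]) (by linarith [ht.2, Real.pi_gt_three])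
          exact ht0 (h4.1 h3)
      have : ∃ᶠ t : ℝ in 𝓝[≠] (0 : ℝ), φ (z * Complex.exp (t * Complex.I)) =
          ψ (z * Complex.exp (t * Complex.I)) := by
        refine (Eventually.of_forall fun t => h _ ?_).frequently
        rw [norm_mul, Complex.norm_exp_ofReal_mul_I, mul_one, hz]
      exact hcont.frequently this
    have hev := ((hφ z hz0 hz.le).frequently_eq_iff_eventually_eq (hψ z hz.ge)).1 hfreq
    filter_upwards [hev, isOpen_ne.mem_nhds hz0] with w hw hw0
    simp only [hg]
    rw [if_neg hw0]
    split_ifs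
    · rfl
    · exact hw.symm
  have hd0 : ∀ z : ℂ, z ≠ 0 → DifferentiableAt ℂ g z := by
    intro z hz
    rcases lt_trichotomy ‖z‖ r with h1 | h1 | h1
    · exact (hφ z hz h1.le).differentiableAt.congr_of_eventuallyEq (hin z hz h1)
    · exact (hφ z hz h1.le).differentiableAt.congr_of_eventuallyEq (hon z h1)
    · exact (hψ z h1.le).differentiableAt.congr_of_eventuallyEq (hout z h1)
  have hc0 : ContinuousAt g 0 := by
    rw [continuousAt_iff_punctured_nhds]
    have : g 0 = 0 := by simp [hg]
    rw [this]
    refine hφ0.congr' ?_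
    filter_upwards [self_mem_nhdsWithin, nhdsWithin_le_nhds
      ((isOpen_lt continuous_norm continuous_const).mem_nhds
        (show ‖(0 : ℂ)‖ < r by simpa using hr))] with w hw hwr
    have hw' : ‖w‖ < r := hwr
    simp only [hg]
    rw [if_neg (show w ≠ 0 from hw), if_pos hw'.le]
  have hd : Differentiable ℂ g := by
    intro z
    by_cases hz : z = 0
    · rw [hz]
      refine (Complex.analyticAt_of_differentiable_on_punctured_nhds_of_continuousAt ?_
        hc0).differentiableAt
      filter_upwards [self_mem_nhdsWithin] with w hw using hd0 w hw
    · exact hd0 z hz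
  have hlim : Tendsto g (cocompact ℂ) (𝓝 0) := by
    rw [← Metric.cobounded_eq_cocompact]
    refine hψ0.congr' ?_
    filter_upwards [tendsto_norm_cobounded_atTop.eventually_gt_atTop r] with z hz
    exact (hout z hz).eq_of_nhds.symm
  have hzero : ∀ z, g z = 0 := fun z => hd.apply_eq_of_tendsto_cocompact z hlim
  have hφz : ∀ z : ℂ, z ≠ 0 → ‖z‖ ≤ r → φ z = 0 := by
    intro z hz hzr
    rw [← hzero z]
    simp only [hg]
    rw [if_neg hz, if_pos hzr]
  refine ⟨hφz, fun z hz => ?_⟩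
  rcases hz.eq_or_lt with h1 | h1
  · rw [← h z h1.symm]
    exact hφz z (by intro h; simp [h] at h1; linarith) h1.ge
  · rw [← hzero z]
    exact (hout z h1).eq_of_nhds.symm

/-- The Schwarz reflection `z ↦ conj (H (r² / conj z))` in the circle of radius `r`. -/
noncomputable def circleReflection (r : ℝ) (H : ℂ → ℂ) (z : ℂ) : ℂ :=
  (starRingEnd ℂ) (H ((starRingEnd ℂ) ((r : ℂ) ^ 2 / z)))

theorem norm_conj_sq_div (r : ℝ) (z : ℂ) :
    ‖(starRingEnd ℂ) ((r : ℂ) ^ 2 / z)‖ = r ^ 2 / ‖z‖ := by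
  rw [RCLike.norm_conj, norm_div, norm_pow, Complex.norm_real, Real.norm_eq_abs, sq_abs]

theorem analyticAt_circleReflection {r : ℝ} {H : ℂ → ℂ} {z : ℂ} (hz : z ≠ 0)
    (hH : AnalyticAt ℂ H ((starRingEnd ℂ) ((r : ℂ) ^ 2 / z))) :
    AnalyticAt ℂ (circleReflection r H) z := by
  have h1 : ∀ᶠ w in 𝓝 z, DifferentiableAt ℂ H ((starRingEnd ℂ) ((r : ℂ) ^ 2 / w)) := by
    have hc : ContinuousAt (fun w : ℂ => (starRingEnd ℂ) ((r : ℂ) ^ 2 / w)) z :=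
      Complex.continuous_conj.continuousAt.comp (continuousAt_const.div continuousAt_id hz)
    exact hc.eventually (hH.eventually_analyticAt.mono fun w hw => hw.differentiableAt)
  refine Complex.analyticAt_iff_eventually_differentiableAt.2 ?_
  filter_upwards [h1, isOpen_ne.mem_nhds hz] with w hw hw0
  have h2 := hw.conj_conj
  rw [Complex.conj_conj] at h2
  have h3 : DifferentiableAt ℂ (fun w : ℂ => (r : ℂ) ^ 2 / w) w :=
    (differentiableAt_const _).div differentiableAt_id hw0
  exact DifferentiableAt.comp (g := (starRingEnd ℂ) ∘ H ∘ (starRingEnd ℂ)) w h2 h3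

theorem circleReflection_of_norm_eq {r : ℝ} {H : ℂ → ℂ} {z : ℂ} (hr : 0 < r) (hz : ‖z‖ = r) :
    circleReflection r H z = (starRingEnd ℂ) (H z) := by
  have hz0 : z ≠ 0 := by intro h; simp [h] at hz; linarith
  have : (starRingEnd ℂ) ((r : ℂ) ^ 2 / z) = z := by
    rw [← hz, ← Complex.mul_conj', mul_div_cancel_left₀ _ hz0, Complex.conj_conj]
  rw [circleReflection, this]

theorem tendsto_circleReflection_zero {r : ℝ} {H : ℂ → ℂ} (hr : 0 < r)
    (hH : Tendsto H (cobounded ℂ) (𝓝 0)) : Tendsto (circleReflection r H) (𝓝[≠] 0) (𝓝 0) := by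
  have h1 : Tendsto (fun z : ℂ => (starRingEnd ℂ) ((r : ℂ) ^ 2 / z)) (𝓝[≠] 0) (cobounded ℂ) := by
    rw [← tendsto_norm_atTop_iff_cobounded]
    simp_rw [norm_conj_sq_div]
    have h2 : Tendsto (fun z : ℂ => ‖z‖) (𝓝[≠] 0) (𝓝[>] 0) := by
      refine tendsto_nhdsWithin_iff.2 ⟨?_, ?_⟩
      · have := (continuous_norm (E := ℂ)).tendsto 0
        rw [norm_zero] at this
        exact this.mono_left nhdsWithin_le_nhds
      · filter_upwards [self_mem_nhdsWithin] with z hz using norm_pos_iff.2 hz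
    exact (tendsto_inv_nhdsGT_zero.comp h2).const_mul_atTop (by positivity : 0 < r ^ 2)
  have h3 := (Complex.continuous_conj.tendsto 0).comp (hH.comp h1)
  rw [map_zero] at h3
  exact h3

theorem tendsto_circleReflection_cobounded {r : ℝ} {H : ℂ → ℂ} (hH : Tendsto H (𝓝 0) (𝓝 0)) :
    Tendsto (circleReflection r H) (cobounded ℂ) (𝓝 0) := by
  have h1 : Tendsto (fun z : ℂ => (starRingEnd ℂ) ((r : ℂ) ^ 2 / z)) (cobounded ℂ) (𝓝 0) := by
    rw [tendsto_zero_iff_norm_tendsto_zero]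
    simp_rw [norm_conj_sq_div]
    exact tendsto_norm_cobounded_atTop.const_div_atTop _
  have h3 := (Complex.continuous_conj.tendsto 0).comp (hH.comp h1)
  rw [map_zero] at h3
  exact h3

/-! ### Uniqueness for the transmission problem on a disk -/

theorem fderiv_self_eq_wirtinger {v : ℂ → ℂ} {z : ℂ} (hv : DifferentiableAt ℝ v z) :
    fderiv ℝ v z z = (z * wirtinger v z
      + (starRingEnd ℂ) (z * wirtinger (fun w => (starRingEnd ℂ) (v w)) z)) / 2 := by
  rw [fderiv_eq_wirtinger hv]
  simp only [map_mul]
  ring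

theorem fderiv_I_mul_self_eq_wirtinger {v : ℂ → ℂ} {z : ℂ} (hv : DifferentiableAt ℝ v z) :
    fderiv ℝ v z (Complex.I * z) = Complex.I * (z * wirtinger v z
      - (starRingEnd ℂ) (z * wirtinger (fun w => (starRingEnd ℂ) (v w)) z)) / 2 := by
  rw [fderiv_eq_wirtinger hv]
  simp only [map_mul, Complex.conj_I]
  ring

theorem fderiv_eq_zero_of_wirtinger {v : ℂ → ℂ} {z : ℂ} (hv : DifferentiableAt ℝ v z)
    (h1 : wirtinger v z = 0) (h2 : wirtinger (fun w => (starRingEnd ℂ) (v w)) z = 0) :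
    fderiv ℝ v z = 0 := by
  refine ContinuousLinearMap.ext fun h => ?_
  simp [fderiv_eq_wirtinger hv, h1, h2]

theorem tendsto_conj_cobounded {v : ℂ → ℂ} {l : Filter ℂ} (h : Tendsto v l (𝓝 0)) :
    Tendsto (fun z => (starRingEnd ℂ) (v z)) l (𝓝 0) := by
  have := (Complex.continuous_conj.tendsto 0).comp h
  rw [map_zero] at this
  exact this

theorem hasDerivAt_along_circle {v : ℂ → ℂ} {z : ℂ} (hv : DifferentiableAt ℝ v z) :
    HasDerivAt (fun t : ℝ => v (z * Complex.exp (t * Complex.I)))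
      (fderiv ℝ v z (Complex.I * z)) 0 := by
  have h1 : HasDerivAt (fun t : ℝ => z * Complex.exp (t * Complex.I)) (Complex.I * z) 0 := by
    have h2 := ((Complex.ofRealCLM.hasDerivAt (x := (0 : ℝ))).mul_const Complex.I).cexp.const_mul z
    simpa [mul_comm] using h2
  have h3 : HasFDerivAt v (fderiv ℝ v z)
      ((fun t : ℝ => z * Complex.exp (t * Complex.I)) 0) := by
    simpa using hv.hasFDerivAt
  exact h3.comp_hasDerivAt (0 : ℝ) h1

/-- A function whose gradient vanishes in the exterior of a disk and that tends to `0` at infinity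
vanishes there. -/
theorem eq_zero_of_fderiv_eq_zero_exterior {v : ℂ → ℂ} {r : ℝ} (hr : 0 < r)
    (hd : ∀ z : ℂ, r ≤ ‖z‖ → DifferentiableAt ℝ v z)
    (hf : ∀ z : ℂ, r ≤ ‖z‖ → fderiv ℝ v z = 0) (h0 : Tendsto v (cobounded ℂ) (𝓝 0))
    {z : ℂ} (hz : r ≤ ‖z‖) : v z = 0 := by
  have hz0 : 0 < ‖z‖ := hr.trans_le hz
  -- `v` is constant along the ray through `z`
  have hray : ∀ t ∈ Set.Ici (1 : ℝ), v (t * z) = v z := by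
    intro t ht
    have hdiff : ∀ s ∈ Set.Ici (1 : ℝ),
        HasDerivWithinAt (fun s : ℝ => v (s * z)) 0 (Set.Ici 1) s := by
      intro s hs
      have hs1 : (1 : ℝ) ≤ s := hs
      have hsz : r ≤ ‖(s : ℂ) * z‖ := by
        rw [norm_mul, Complex.norm_real, Real.norm_eq_abs, abs_of_pos (by linarith)]
        nlinarith
      have h1 : HasDerivAt (fun s : ℝ => (s : ℂ) * z) z s := by
        simpa using (Complex.ofRealCLM.hasDerivAt (x := s)).mul_const z
      have h2 := (hd _ hsz).hasFDerivAt.comp_hasDerivAt s h1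
      rw [hf _ hsz] at h2
      exact h2.hasDerivWithinAt
    have := (convex_Ici (1 : ℝ)).norm_image_sub_le_of_norm_hasDerivWithin_le (C := 0)
      (f := fun s : ℝ => v (s * z)) (f' := fun _ => 0) hdiff (by simp)
      (Set.mem_Ici.2 le_rfl : (1 : ℝ) ∈ Set.Ici 1) ht
    have h3 : v (t * z) - v z = 0 := by simpa using this
    exact sub_eq_zero.1 h3
  have hlim : Tendsto (fun t : ℝ => (t : ℂ) * z) atTop (cobounded ℂ) := by
    rw [← tendsto_norm_atTop_iff_cobounded]
    simp only [norm_mul, Complex.norm_real, Real.norm_eq_abs]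
    exact tendsto_abs_atTop_atTop.atTop_mul_const hz0
  have h4 : Tendsto (fun _ : ℝ => v z) atTop (𝓝 0) := by
    refine (h0.comp hlim).congr' ?_
    filter_upwards [eventually_ge_atTop (1 : ℝ)] with t ht using hray t ht
  exact tendsto_nhds_unique tendsto_const_nhds h4

/-- Uniqueness for the homogeneous transmission problem on the disk of radius `r`, for a complex
permittivity `e ≠ -1`. Reflecting the two Wirtinger derivatives in the circle turns the transmission
conditions into equalities between holomorphic functions inside and outside the disk. -/
theorem transmission_unique {v : TwoSidedField} {r : ℝ} {e : ℂ} (hr : 0 < r) (he : e ≠ -1)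
    (hv : v.Harmonic r) (hinf : Tendsto v.outer (cobounded ℂ) (𝓝 0))
    (hjump : ∀ z : ℂ, ‖z‖ = r → v.outer z = v.inner z)
    (hflux : ∀ z : ℂ, ‖z‖ = r → fderiv ℝ v.outer z z = e * fderiv ℝ v.inner z z) :
    (∀ z : ℂ, ‖z‖ ≤ r → v.inner z = 0) ∧ ∀ z : ℂ, r ≤ ‖z‖ → v.outer z = 0 := by
  obtain ⟨hin, hout⟩ := hv
  have hdin : ∀ z : ℂ, ‖z‖ ≤ r → DifferentiableAt ℝ v.inner z :=
    fun z hz => differentiableAt_of_harmonicAt (hin z hz)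
  have hdout : ∀ z : ℂ, r ≤ ‖z‖ → DifferentiableAt ℝ v.outer z :=
    fun z hz => differentiableAt_of_harmonicAt (hout z hz)
  set Ai : ℂ → ℂ := fun z => z * wirtinger v.inner z with hAi
  set Ao : ℂ → ℂ := fun z => z * wirtinger v.outer z with hAo
  set Hi : ℂ → ℂ := fun z => z * wirtinger (fun w => (starRingEnd ℂ) (v.inner w)) z with hHi
  set Ho : ℂ → ℂ := fun z => z * wirtinger (fun w => (starRingEnd ℂ) (v.outer w)) z with hHo
  have aAi : ∀ z : ℂ, ‖z‖ ≤ r → AnalyticAt ℂ Ai z :=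
    fun z hz => analyticAt_id.mul (analyticAt_wirtinger (hin z hz))
  have aAo : ∀ z : ℂ, r ≤ ‖z‖ → AnalyticAt ℂ Ao z :=
    fun z hz => analyticAt_id.mul (analyticAt_wirtinger (hout z hz))
  have aHi : ∀ z : ℂ, ‖z‖ ≤ r → AnalyticAt ℂ Hi z :=
    fun z hz => analyticAt_id.mul (analyticAt_wirtinger (harmonicAt_conj (hin z hz)))
  have aHo : ∀ z : ℂ, r ≤ ‖z‖ → AnalyticAt ℂ Ho z :=
    fun z hz => analyticAt_id.mul (analyticAt_wirtinger (harmonicAt_conj (hout z hz)))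
  have h0r : ‖(0 : ℂ)‖ ≤ r := by simpa using hr.le
  have lAi : Tendsto Ai (𝓝 0) (𝓝 0) := by
    have := (aAi 0 h0r).continuousAt.tendsto
    simpa [hAi] using this
  have lHi : Tendsto Hi (𝓝 0) (𝓝 0) := by
    have := (aHi 0 h0r).continuousAt.tendsto
    simpa [hHi] using this
  have lAo : Tendsto Ao (cobounded ℂ) (𝓝 0) := tendsto_mul_wirtinger_cobounded hout hinf
  have lHo : Tendsto Ho (cobounded ℂ) (𝓝 0) :=
    tendsto_mul_wirtinger_cobounded (fun z hz => harmonicAt_conj (hout z hz))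
      (tendsto_conj_cobounded hinf)
  have arHo : ∀ z : ℂ, z ≠ 0 → ‖z‖ ≤ r → AnalyticAt ℂ (circleReflection r Ho) z := by
    intro z hz hzr
    refine analyticAt_circleReflection hz (aHo _ ?_)
    rw [norm_conj_sq_div, le_div_iff₀ (norm_pos_iff.2 hz)]
    nlinarith
  have arHi : ∀ z : ℂ, r ≤ ‖z‖ → AnalyticAt ℂ (circleReflection r Hi) z := by
    intro z hzr
    have hz : 0 < ‖z‖ := hr.trans_le hzr
    refine analyticAt_circleReflection (norm_pos_iff.1 hz) (aHi _ ?_)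
    rw [norm_conj_sq_div, div_le_iff₀ hz]
    nlinarith
  -- the two transmission conditions on the circle in terms of the Wirtinger derivatives
  have htan : ∀ z : ℂ, ‖z‖ = r →
      Ao z - (starRingEnd ℂ) (Ho z) = Ai z - (starRingEnd ℂ) (Hi z) := by
    intro z hz
    have h1 := hasDerivAt_along_circle (hdout z hz.ge)
    have h2 := hasDerivAt_along_circle (hdin z hz.le)
    have h3 : (fun t : ℝ => v.outer (z * Complex.exp (t * Complex.I))) =
        fun t : ℝ => v.inner (z * Complex.exp (t * Complex.I)) := by
      funext t
      exact hjump _ (by rw [norm_mul, Complex.norm_exp_ofReal_mul_I, mul_one, hz])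
    rw [h3] at h1
    have h4 := h1.unique h2
    rw [fderiv_I_mul_self_eq_wirtinger (hdout z hz.ge),
      fderiv_I_mul_self_eq_wirtinger (hdin z hz.le)] at h4
    have h5 : Complex.I / 2 * (Ao z - (starRingEnd ℂ) (Ho z)) =
        Complex.I / 2 * (Ai z - (starRingEnd ℂ) (Hi z)) := by
      simp only [hAo, hHo, hAi, hHi]
      linear_combination h4
    exact mul_left_cancel₀ (by simp) h5
  have hnor : ∀ z : ℂ, ‖z‖ = r →
      Ao z + (starRingEnd ℂ) (Ho z) = e * (Ai z + (starRingEnd ℂ) (Hi z)) := by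
    intro z hz
    have h4 := hflux z hz
    rw [fderiv_self_eq_wirtinger (hdout z hz.ge), fderiv_self_eq_wirtinger (hdin z hz.le)] at h4
    simp only [hAo, hHo, hAi, hHi]
    linear_combination 2 * h4
  obtain ⟨g1, g2⟩ := eq_zero_of_eqOn_circle (φ := fun z => Ai z + circleReflection r Ho z)
    (ψ := fun z => Ao z + circleReflection r Hi z) hr
    (fun z hz hzr => (aAi z hzr).add (arHo z hz hzr))
    (by simpa using (lAi.mono_left nhdsWithin_le_nhds).add (tendsto_circleReflection_zero hr lHo))
    (fun z hzr => (aAo z hzr).add (arHi z hzr))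
    (by simpa using lAo.add (tendsto_circleReflection_cobounded lHi))
    (fun z hz => by
      simp only [circleReflection_of_norm_eq hr hz]
      linear_combination -htan z hz)
  have hcirc : ∀ z : ℂ, ‖z‖ = r → Ai z = -circleReflection r Hi z := by
    intro z hz
    have hz0 : z ≠ 0 := by intro h; simp [h] at hz; linarith
    have e1 := g1 z hz0 hz.le
    have e2 := g2 z hz.ge
    simp only [circleReflection_of_norm_eq hr hz] at e1 e2 ⊢
    have e3 := hnor z hz
    have h1e : 1 + e ≠ 0 := fun h => he (by linear_combination h)
    have : (1 + e) * (Ai z + (starRingEnd ℂ) (Hi z)) = 0 := by linear_combination e1 + e2 - e3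
    rcases mul_eq_zero.1 this with h | h
    · exact absurd h h1e
    · linear_combination h
  obtain ⟨g3, g4⟩ := eq_zero_of_eqOn_circle (φ := Ai) (ψ := fun z => -circleReflection r Hi z) hr
    (fun z _ hzr => aAi z hzr) (lAi.mono_left nhdsWithin_le_nhds)
    (fun z hzr => (arHi z hzr).neg)
    (by simpa using (tendsto_circleReflection_cobounded (r := r) lHi).neg) hcirc
  have zHi : ∀ z : ℂ, z ≠ 0 → ‖z‖ ≤ r → Hi z = 0 := by
    intro z hz hzr
    have h1 := g4 ((starRingEnd ℂ) ((r : ℂ) ^ 2 / z)) (by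
      rw [norm_conj_sq_div, le_div_iff₀ (norm_pos_iff.2 hz)]; nlinarith)
    have hrc : (r : ℂ) ≠ 0 := by exact_mod_cast hr.ne'
    simp only [circleReflection, neg_eq_zero, map_eq_zero] at h1
    convert h1 using 2
    simp only [map_div₀, map_pow, Complex.conj_conj, Complex.conj_ofReal]
    field_simp
  have zHo : ∀ z : ℂ, r ≤ ‖z‖ → Ho z = 0 := by
    intro z hzr
    have hz : 0 < ‖z‖ := hr.trans_le hzr
    have hz0 : z ≠ 0 := norm_pos_iff.1 hz
    have hrc : (r : ℂ) ≠ 0 := by exact_mod_cast hr.ne'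
    have hw0 : (starRingEnd ℂ) ((r : ℂ) ^ 2 / z) ≠ 0 := by
      rw [map_ne_zero]; exact div_ne_zero (pow_ne_zero _ hrc) hz0
    have hwr : ‖(starRingEnd ℂ) ((r : ℂ) ^ 2 / z)‖ ≤ r := by
      rw [norm_conj_sq_div, div_le_iff₀ hz]; nlinarith
    have h1 := g1 _ hw0 hwr
    rw [g3 _ hw0 hwr, zero_add] at h1
    simp only [circleReflection, map_eq_zero] at h1
    convert h1 using 2
    simp only [map_div₀, map_pow, Complex.conj_conj, Complex.conj_ofReal]
    field_simp
  have zAo : ∀ z : ℂ, r ≤ ‖z‖ → Ao z = 0 := by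
    intro z hzr
    have e1 := g2 z hzr
    have e2 := g4 z hzr
    linear_combination e1 + e2
  have fout : ∀ z : ℂ, r ≤ ‖z‖ → fderiv ℝ v.outer z = 0 := by
    intro z hzr
    have hz0 : z ≠ 0 := norm_pos_iff.1 (hr.trans_le hzr)
    exact fderiv_eq_zero_of_wirtinger (hdout z hzr)
      ((mul_eq_zero.1 (zAo z hzr)).resolve_left hz0) ((mul_eq_zero.1 (zHo z hzr)).resolve_left hz0)
  have vout : ∀ z : ℂ, r ≤ ‖z‖ → v.outer z = 0 :=
    fun z hz => eq_zero_of_fderiv_eq_zero_exterior hr hdout fout hinf hz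
  have fin' : ∀ z : ℂ, z ≠ 0 → ‖z‖ ≤ r → fderiv ℝ v.inner z = 0 := by
    intro z hz0 hzr
    exact fderiv_eq_zero_of_wirtinger (hdin z hzr)
      ((mul_eq_zero.1 (g3 z hz0 hzr)).resolve_left hz0)
      ((mul_eq_zero.1 (zHi z hz0 hzr)).resolve_left hz0)
  have fin : ∀ z : ℂ, ‖z‖ ≤ r → fderiv ℝ v.inner z = 0 := by
    intro z hzr
    by_cases hz0 : z = 0
    · -- at the centre the gradient vanishes by continuity
      subst hz0
      have hc : ContinuousAt (fderiv ℝ v.inner) 0 :=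
        ((hin 0 h0r).1.fderiv_right (m := 1) (by norm_num)).continuousAt
      have h1 : Tendsto (fderiv ℝ v.inner) (𝓝[≠] 0) (𝓝 0) := by
        refine tendsto_const_nhds.congr' ?_
        filter_upwards [self_mem_nhdsWithin, nhdsWithin_le_nhds
          ((isOpen_lt continuous_norm continuous_const).mem_nhds
            (show ‖(0 : ℂ)‖ < r by simpa using hr))] with w hw hwr
        exact (fin' w hw (le_of_lt hwr)).symm
      exact tendsto_nhds_unique (hc.tendsto.mono_left nhdsWithin_le_nhds) h1
    · exact fin' z hz0 hzr
  refine ⟨fun z hz => ?_, vout⟩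
  have hconv : Convex ℝ (Metric.closedBall (0 : ℂ) r) := convex_closedBall 0 r
  have hrr : ‖(r : ℂ)‖ = r := by simp [abs_of_pos hr]
  have h1 := hconv.norm_image_sub_le_of_norm_hasFDerivWithin_le (C := 0) (f := v.inner)
    (f' := fun _ => (0 : ℂ →L[ℝ] ℂ)) (x := (r : ℂ)) (y := z)
    (fun w hw => by
      have hw' : ‖w‖ ≤ r := by simpa using hw
      have := (hdin w hw').hasFDerivAt
      rw [fin w hw'] at this
      exact this.hasFDerivWithinAt) (by simp) (by simp [abs_of_pos hr]) (by simpa using hz)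
  have h2 : v.inner z - v.inner r = 0 := by simpa using h1
  rw [sub_eq_zero.1 h2, ← hjump _ hrr, vout _ hrr.ge]

/-! ### Unique continuation -/

theorem eventually_eq_zero_of_harmonicAt {v : ℂ → ℂ} {z : ℂ} (hv : HarmonicAt v z)
    (h : ∃ᶠ w in 𝓝 z, v =ᶠ[𝓝 w] 0) : v =ᶠ[𝓝 z] 0 := by
  obtain ⟨ρ, hρ, hball⟩ := Metric.eventually_nhds_iff_ball.1 hv.eventually
  have han : AnalyticOnNhd ℝ v (Metric.ball z ρ) :=
    fun w hw => analyticAt_real_of_harmonicAt (hball w hw)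
  obtain ⟨w, hw, hwb⟩ := (h.and_eventually (Metric.ball_mem_nhds z hρ)).exists
  have := han.eqOn_zero_of_preconnected_of_eventuallyEq_zero
    (convex_ball z ρ).isPreconnected hwb hw
  filter_upwards [Metric.ball_mem_nhds z hρ] with y hy using this hy

theorem eventually_eq_zero_of_disk {v : ℂ → ℂ} {r : ℝ} (hr : 0 < r)
    (hv : HarmonicOnNhd v {z : ℂ | ‖z‖ ≤ r}) (h0 : ∀ z : ℂ, ‖z‖ ≤ r → v z = 0) {z : ℂ}
    (hz : ‖z‖ ≤ r) : v =ᶠ[𝓝 z] 0 := by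
  refine eventually_eq_zero_of_harmonicAt (hv z hz) ?_
  have hmem : z ∈ closure (Metric.ball (0 : ℂ) r) := by
    rw [closure_ball _ hr.ne']; simpa using hz
  refine (mem_closure_iff_frequently.1 hmem).mono fun w hw => ?_
  filter_upwards [Metric.isOpen_ball.mem_nhds hw] with y hy
  exact h0 y (by simpa using (Metric.mem_ball.1 hy).le)

theorem eventually_eq_zero_of_exterior {v : ℂ → ℂ} {r : ℝ} (hr : 0 < r)
    (hv : HarmonicOnNhd v {z : ℂ | r ≤ ‖z‖}) (h0 : ∀ z : ℂ, r ≤ ‖z‖ → v z = 0) {z : ℂ}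
    (hz : r ≤ ‖z‖) : v =ᶠ[𝓝 z] 0 := by
  refine eventually_eq_zero_of_harmonicAt (hv z hz) ?_
  have hmem : z ∈ closure (Metric.closedBall (0 : ℂ) r)ᶜ := by
    rw [closure_compl, interior_closedBall _ hr.ne']; simpa using hz
  refine (mem_closure_iff_frequently.1 hmem).mono fun w hw => ?_
  filter_upwards [Metric.isClosed_closedBall.isOpen_compl.mem_nhds hw] with y hy
  refine h0 y ?_
  have : ¬ ‖y‖ ≤ r := by simpa using hy
  exact (not_le.1 this).le

/-! ### Geometry of the perturbed boundary -/

namespace NanowireModel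

theorem velocity_eq (M : NanowireModel) (ε θ : ℝ) :
    M.velocity ε θ = Complex.I * (M.r₀ * ((1 + ε * Real.cos (M.n * θ) : ℝ)
      + (ε * (M.n * Real.sin (M.n * θ)) : ℝ) * Complex.I)) * Complex.exp (θ * Complex.I) := by
  have h1 : HasDerivAt (fun t : ℝ => M.r₀ * (1 + ε * Real.cos (M.n * t)))
      (M.r₀ * (ε * (-Real.sin (M.n * θ) * M.n))) θ := by
    have := ((((hasDerivAt_id θ).const_mul (M.n : ℝ)).cos).const_mul ε).const_add 1
    simpa using this.const_mul M.r₀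
  have h2 : HasDerivAt (fun t : ℝ => Complex.exp ((t : ℂ) * Complex.I))
      (Complex.exp ((θ : ℂ) * Complex.I) * Complex.I) θ := by
    simpa using ((Complex.ofRealCLM.hasDerivAt (x := θ)).mul_const Complex.I).cexp
  have h3 := (h1.ofReal_comp.mul h2).deriv
  refine (show M.velocity ε θ = _ from h3).trans ?_
  have hI := Complex.I_sq
  push_cast
  linear_combination (-(M.r₀ * (ε * (M.n * Complex.sin (M.n * θ))))
    * Complex.exp ((θ : ℂ) * Complex.I)) * hI

theorem neg_I_mul_velocity (M : NanowireModel) (ε θ : ℝ) :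
    -Complex.I * M.velocity ε θ = (M.r₀ * ((1 + ε * Real.cos (M.n * θ) : ℝ)
      + (ε * (M.n * Real.sin (M.n * θ)) : ℝ) * Complex.I)) * Complex.exp (θ * Complex.I) := by
  rw [velocity_eq, ← mul_assoc, ← mul_assoc, neg_mul, Complex.I_mul_I, neg_neg, one_mul]

theorem speed_sq (M : NanowireModel) (ε θ : ℝ) :
    M.speed ε θ ^ 2 = M.r₀ ^ 2 * ((1 + ε * Real.cos (M.n * θ)) ^ 2
      + (ε * (M.n * Real.sin (M.n * θ))) ^ 2) := by
  rw [speed, velocity_eq, norm_mul, Complex.norm_exp_ofReal_mul_I, mul_one, norm_mul,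
    Complex.norm_I, one_mul, norm_mul, mul_pow, Complex.norm_real, Real.norm_eq_abs, sq_abs,
    Complex.sq_norm, Complex.normSq_add_mul_I]

theorem norm_curve (M : NanowireModel) (hr₀ : 0 < M.r₀) (ε θ : ℝ) :
    ‖M.curve ε θ‖ = M.r₀ * |1 + ε * Real.cos (M.n * θ)| := by
  rw [curve, norm_mul, Complex.norm_exp_ofReal_mul_I, mul_one, Complex.norm_real, Real.norm_eq_abs,
    abs_mul, abs_of_pos hr₀]

theorem abs_mul_cos_le {ε : ℝ} (hε : 0 ≤ ε) (x : ℝ) : |ε * Real.cos x| ≤ ε := by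
  rw [abs_mul, abs_of_nonneg hε]
  exact mul_le_of_le_one_right hε (Real.abs_cos_le_one x)

theorem half_le_one_add_mul_cos {ε : ℝ} (hε : 0 ≤ ε) (hε' : ε ≤ 1 / 2) (x : ℝ) :
    1 / 2 ≤ 1 + ε * Real.cos x := by
  have := (abs_le.1 (abs_mul_cos_le hε x)).1
  linarith

theorem eventually_small {δ : ℝ} (hδ : 0 < δ) : ∀ᶠ ε : ℝ in 𝓝[>] 0, 0 < ε ∧ ε ≤ δ := by
  filter_upwards [self_mem_nhdsWithin, nhdsWithin_le_nhds (Iic_mem_nhds hδ)] with ε h1 h2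
    using ⟨h1, h2⟩

theorem half_le_speed (M : NanowireModel) {ε : ℝ} (hε : 0 ≤ ε)
    (hε' : ε ≤ 1 / 2) (θ : ℝ) : M.r₀ / 2 ≤ M.speed ε θ := by
  refine le_of_sq_le_sq ?_ (norm_nonneg _)
  rw [speed_sq, div_pow, div_eq_mul_inv]
  refine mul_le_mul_of_nonneg_left ?_ (sq_nonneg _)
  have := half_le_one_add_mul_cos hε hε' (M.n * θ)
  nlinarith [sq_nonneg (ε * (M.n * Real.sin (M.n * θ)))]

/-- For small `ε` the whole curve lies in any given neighbourhood of the circle of radius `r₀`. -/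
theorem eventually_curve_mem (M : NanowireModel) (hr₀ : 0 < M.r₀) {p : ℂ → Prop}
    (hp : ∀ z : ℂ, ‖z‖ = M.r₀ → ∀ᶠ w in 𝓝 z, p w) :
    ∀ᶠ ε : ℝ in 𝓝[>] 0, ∀ θ : ℝ, ∀ᶠ w in 𝓝 (M.curve ε θ), p w := by
  have hK : IsCompact (Metric.sphere (0 : ℂ) M.r₀) := isCompact_sphere 0 M.r₀
  have hU : IsOpen {z : ℂ | ∀ᶠ w in 𝓝 z, p w} := isOpen_setOfPred_eventually_nhds
  obtain ⟨δ, hδ, hsub⟩ := hK.exists_thickening_subset_open hU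
    (fun z hz => hp z (by simpa using hz))
  filter_upwards [eventually_small (δ := δ / (2 * M.r₀)) (by positivity)] with ε hε θ
  refine hsub (Metric.mem_thickening_iff.2
    ⟨(M.r₀ : ℂ) * Complex.exp (θ * Complex.I), by simp [Complex.norm_exp_ofReal_mul_I,
      abs_of_pos hr₀], ?_⟩)
  have h1 : M.curve ε θ - (M.r₀ : ℂ) * Complex.exp (θ * Complex.I) =
      ((M.r₀ * (ε * Real.cos (M.n * θ)) : ℝ) : ℂ) * Complex.exp (θ * Complex.I) := by
    rw [curve]; push_cast; ring
  rw [dist_eq_norm, h1, norm_mul, Complex.norm_exp_ofReal_mul_I, mul_one, Complex.norm_real,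
    Real.norm_eq_abs, abs_mul, abs_of_pos hr₀]
  calc M.r₀ * |ε * Real.cos (M.n * θ)| ≤ M.r₀ * (δ / (2 * M.r₀)) := by
        gcongr; exact (abs_mul_cos_le hε.1.le _).trans hε.2
    _ = δ / 2 := by field_simp
    _ < δ := by linarith

theorem curve_zero (M : NanowireModel) (θ : ℝ) :
    M.curve 0 θ = M.r₀ * Complex.exp (θ * Complex.I) := by simp [curve]

theorem normal_zero (M : NanowireModel) (hr₀ : 0 < M.r₀) (θ : ℝ) :
    M.normal 0 θ = Complex.exp (θ * Complex.I) := by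
  have h1 : M.speed 0 θ = M.r₀ := by
    have := M.speed_sq 0 θ
    simp only [zero_mul, add_zero, one_pow, ne_eq, OfNat.ofNat_ne_zero, not_false_eq_true,
      zero_pow, mul_one] at this
    exact (sq_eq_sq₀ (norm_nonneg _) hr₀.le).1 this
  have hr : (M.r₀ : ℂ) ≠ 0 := by exact_mod_cast hr₀.ne'
  rw [normal, tangent, mul_div_assoc', neg_I_mul_velocity, h1]
  simp only [zero_mul, add_zero, Complex.ofReal_one, Complex.ofReal_zero, mul_one]
  field_simp

theorem tendsto_curve (M : NanowireModel) (θ : ℝ) :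
    Tendsto (fun ε => M.curve ε θ) (𝓝[>] 0) (𝓝 (M.curve 0 θ)) := by
  have : Continuous (fun ε => M.curve ε θ) := by unfold curve; fun_prop
  exact (this.tendsto 0).mono_left nhdsWithin_le_nhds

theorem tendsto_normal (M : NanowireModel) (hr₀ : 0 < M.r₀) (θ : ℝ) :
    Tendsto (fun ε => M.normal ε θ) (𝓝[>] 0) (𝓝 (M.normal 0 θ)) := by
  have hv : Continuous (fun ε => M.velocity ε θ) := by
    simp only [velocity_eq]; fun_prop
  have hs : Continuous (fun ε => (M.speed ε θ : ℂ)) := by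
    unfold speed; fun_prop
  have h0 : (M.speed 0 θ : ℂ) ≠ 0 := by
    have := M.half_le_speed le_rfl (by norm_num) θ
    exact_mod_cast (by linarith : 0 < M.speed 0 θ).ne'
  have : ContinuousAt (fun ε => M.normal ε θ) 0 := by
    unfold normal tangent
    exact continuousAt_const.mul (hv.continuousAt.div hs.continuousAt h0)
  exact this.tendsto.mono_left nhdsWithin_le_nhds

theorem norm_curve_zero (M : NanowireModel) (hr₀ : 0 < M.r₀) (θ : ℝ) : ‖M.curve 0 θ‖ = M.r₀ := by
  rw [norm_curve M hr₀]; simp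

theorem tendsto_comp_curve (M : NanowireModel) {v : ℂ → ℂ} {θ : ℝ}
    (hv : HarmonicAt v (M.curve 0 θ)) :
    Tendsto (fun ε => v (M.curve ε θ)) (𝓝[>] 0) (𝓝 (v (M.curve 0 θ))) :=
  hv.1.continuousAt.tendsto.comp (M.tendsto_curve θ)

theorem tendsto_dNormal (M : NanowireModel) (hr₀ : 0 < M.r₀) {v : ℂ → ℂ} {θ : ℝ}
    (hv : HarmonicAt v (M.curve 0 θ)) :
    Tendsto (fun ε => M.dNormal v ε θ) (𝓝[>] 0) (𝓝 (M.dNormal v 0 θ)) := by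
  have hc : ContinuousAt (fderiv ℝ v) (M.curve 0 θ) :=
    (hv.1.fderiv_right (m := 1) (by norm_num)).continuousAt
  have h : Tendsto (fun ε => fderiv ℝ v (M.curve ε θ)) (𝓝[>] 0) (𝓝 (fderiv ℝ v (M.curve 0 θ))) :=
    hc.tendsto.comp (M.tendsto_curve θ)
  exact (isBoundedBilinearMap_apply.continuous.tendsto
    (fderiv ℝ v (M.curve 0 θ), M.normal 0 θ)).comp (h.prodMk_nhds (M.tendsto_normal hr₀ θ))

/-! ### Uniform second-order errors -/

theorem IsSecondOrder.tendsto {G : ℝ → ℝ → ℂ} (h : IsSecondOrder G) (θ : ℝ) :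
    Tendsto (fun ε => G ε θ) (𝓝[>] 0) (𝓝 0) := by
  obtain ⟨C, hC⟩ := h
  have h1 : Tendsto (fun ε : ℝ => C * ε ^ 2) (𝓝[>] 0) (𝓝 0) := by
    have : Continuous (fun ε : ℝ => C * ε ^ 2) := by fun_prop
    have := this.tendsto 0
    simp only [ne_eq, OfNat.ofNat_ne_zero, not_false_eq_true, zero_pow, mul_zero] at this
    exact this.mono_left nhdsWithin_le_nhds
  exact squeeze_zero_norm' (hC.mono fun ε h => h θ) h1

theorem IsSecondOrder.tendsto_div {G : ℝ → ℝ → ℂ} (h : IsSecondOrder G) (θ : ℝ) :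
    Tendsto (fun ε : ℝ => (ε : ℂ)⁻¹ * G ε θ) (𝓝[>] 0) (𝓝 0) := by
  obtain ⟨C, hC⟩ := h
  have h1 : Tendsto (fun ε : ℝ => C * ε) (𝓝[>] 0) (𝓝 0) := by
    have : Continuous (fun ε : ℝ => C * ε) := by fun_prop
    have := this.tendsto 0
    simp only [mul_zero] at this
    exact this.mono_left nhdsWithin_le_nhds
  refine squeeze_zero_norm' ?_ h1
  filter_upwards [hC, self_mem_nhdsWithin] with ε h hε
  have hε' : (0 : ℝ) < ε := hε
  rw [norm_mul, norm_inv, Complex.norm_real, Real.norm_eq_abs, abs_of_pos hε',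
    inv_mul_le_iff₀ hε']
  exact (h θ).trans (le_of_eq (by ring))

theorem IsSecondOrder.congr {F G : ℝ → ℝ → ℂ} (h : IsSecondOrder F)
    (hFG : ∀ᶠ ε : ℝ in 𝓝[>] 0, ∀ θ, F ε θ = G ε θ) : IsSecondOrder G := by
  obtain ⟨C, hC⟩ := h
  refine ⟨C, ?_⟩
  filter_upwards [hC, hFG] with ε h1 h2 θ
  rw [← h2 θ]; exact h1 θ

theorem IsSecondOrder.sub {F G : ℝ → ℝ → ℂ} (hF : IsSecondOrder F) (hG : IsSecondOrder G) :
    IsSecondOrder fun ε θ => F ε θ - G ε θ := by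
  obtain ⟨C, hC⟩ := hF
  obtain ⟨D, hD⟩ := hG
  refine ⟨C + D, ?_⟩
  filter_upwards [hC, hD] with ε h1 h2 θ
  calc ‖F ε θ - G ε θ‖ ≤ ‖F ε θ‖ + ‖G ε θ‖ := norm_sub_le _ _
    _ ≤ C * ε ^ 2 + D * ε ^ 2 := add_le_add (h1 θ) (h2 θ)
    _ = (C + D) * ε ^ 2 := by ring

/-! ### Uniqueness of the expansion -/

theorem dNormal_add_mul (M : NanowireModel) {v₀ v₁ : ℂ → ℂ} {ε θ : ℝ} (c : ℂ)
    (h₀ : DifferentiableAt ℝ v₀ (M.curve ε θ)) (h₁ : DifferentiableAt ℝ v₁ (M.curve ε θ)) :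
    M.dNormal (fun z => v₀ z + c * v₁ z) ε θ = M.dNormal v₀ ε θ + c * M.dNormal v₁ ε θ := by
  unfold dNormal
  have h : HasFDerivAt (fun z => v₀ z + c * v₁ z)
      (fderiv ℝ v₀ (M.curve ε θ) + c • fderiv ℝ v₁ (M.curve ε θ)) (M.curve ε θ) :=
    h₀.hasFDerivAt.add (h₁.hasFDerivAt.const_mul c)
  rw [h.fderiv]
  simp

theorem fderiv_self_eq_dNormal (M : NanowireModel) (hr₀ : 0 < M.r₀) (v : ℂ → ℂ) (θ : ℝ) :
    fderiv ℝ v (M.curve 0 θ) (M.curve 0 θ) = M.r₀ * M.dNormal v 0 θ := by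
  unfold dNormal
  rw [M.normal_zero hr₀]
  conv_lhs => arg 2; rw [curve_zero, ← Complex.real_smul]
  rw [map_smul, Complex.real_smul]

theorem exists_curve_zero_eq (M : NanowireModel) {z : ℂ} (hz : ‖z‖ = M.r₀) :
    ∃ θ : ℝ, M.curve 0 θ = z := by
  refine ⟨z.arg, ?_⟩
  rw [curve_zero, ← hz, Complex.norm_mul_exp_arg_mul_I]

/-- If `v₀ + ε v₁` satisfies the homogeneous transmission conditions on `∂Ω_ε` up to `O(ε²)`, then
both terms vanish: letting `ε → 0` kills `v₀`, and then dividing by `ε` kills `v₁`. -/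
theorem homogeneous_expansion_unique (M : NanowireModel) (hr₀ : 0 < M.r₀) {e : ℂ} (he : e ≠ -1)
    {v₀ v₁ : TwoSidedField} (h₀ : v₀.Harmonic M.r₀) (h₁ : v₁.Harmonic M.r₀)
    (hinf₀ : Tendsto v₀.outer (cobounded ℂ) (𝓝 0)) (hinf₁ : Tendsto v₁.outer (cobounded ℂ) (𝓝 0))
    (hjump : IsSecondOrder fun ε θ =>
      (v₀.expand v₁ ε).outer (M.curve ε θ) - (v₀.expand v₁ ε).inner (M.curve ε θ))
    (hflux : IsSecondOrder fun ε θ =>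
      M.dNormal (v₀.expand v₁ ε).outer ε θ - e * M.dNormal (v₀.expand v₁ ε).inner ε θ) :
    ((∀ z : ℂ, ‖z‖ ≤ M.r₀ → v₀.inner z = 0) ∧ ∀ z : ℂ, M.r₀ ≤ ‖z‖ → v₀.outer z = 0) ∧
      (∀ z : ℂ, ‖z‖ ≤ M.r₀ → v₁.inner z = 0) ∧ ∀ z : ℂ, M.r₀ ≤ ‖z‖ → v₁.outer z = 0 := by
  have hi₀ : ∀ θ, HarmonicAt v₀.inner (M.curve 0 θ) :=
    fun θ => h₀.1 _ (M.norm_curve_zero hr₀ θ).le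
  have ho₀ : ∀ θ, HarmonicAt v₀.outer (M.curve 0 θ) :=
    fun θ => h₀.2 _ (M.norm_curve_zero hr₀ θ).ge
  have hi₁ : ∀ θ, HarmonicAt v₁.inner (M.curve 0 θ) :=
    fun θ => h₁.1 _ (M.norm_curve_zero hr₀ θ).le
  have ho₁ : ∀ θ, HarmonicAt v₁.outer (M.curve 0 θ) :=
    fun θ => h₁.2 _ (M.norm_curve_zero hr₀ θ).ge
  have hε : Tendsto (fun ε : ℝ => (ε : ℂ)) (𝓝[>] 0) (𝓝 0) := by
    have := Complex.continuous_ofReal.tendsto 0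
    rw [Complex.ofReal_zero] at this
    exact this.mono_left nhdsWithin_le_nhds
  -- near the circle the normal derivative is linear in the field
  have hlin : ∀ w₀ w₁ : ℂ → ℂ, (∀ z : ℂ, ‖z‖ = M.r₀ → HarmonicAt w₀ z) →
      (∀ z : ℂ, ‖z‖ = M.r₀ → HarmonicAt w₁ z) → ∀ᶠ ε : ℝ in 𝓝[>] 0, ∀ θ : ℝ,
      M.dNormal (fun z => w₀ z + (ε : ℂ) * w₁ z) ε θ =
        M.dNormal w₀ ε θ + (ε : ℂ) * M.dNormal w₁ ε θ := by
    intro w₀ w₁ g₀ g₁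
    filter_upwards [M.eventually_curve_mem hr₀ (fun z hz => (g₀ z hz).eventually),
      M.eventually_curve_mem hr₀ (fun z hz => (g₁ z hz).eventually)] with ε k₀ k₁ θ
    exact M.dNormal_add_mul _ (differentiableAt_of_harmonicAt (k₀ θ).self_of_nhds)
      (differentiableAt_of_harmonicAt (k₁ θ).self_of_nhds)
  have hlo := hlin v₀.outer v₁.outer (fun z hz => h₀.2 z hz.ge) (fun z hz => h₁.2 z hz.ge)
  have hli := hlin v₀.inner v₁.inner (fun z hz => h₀.1 z hz.le) (fun z hz => h₁.1 z hz.le)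
  have hflux' : IsSecondOrder fun ε θ =>
      (M.dNormal v₀.outer ε θ + (ε : ℂ) * M.dNormal v₁.outer ε θ)
        - e * (M.dNormal v₀.inner ε θ + (ε : ℂ) * M.dNormal v₁.inner ε θ) := by
    refine hflux.congr ?_
    filter_upwards [hlo, hli] with ε k1 k2 θ
    rw [← k1 θ, ← k2 θ]
    rfl
  have hjump' : IsSecondOrder fun ε θ =>
      (v₀.outer (M.curve ε θ) + (ε : ℂ) * v₁.outer (M.curve ε θ))
        - (v₀.inner (M.curve ε θ) + (ε : ℂ) * v₁.inner (M.curve ε θ)) := hjump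
  have key₀ : (∀ z : ℂ, ‖z‖ ≤ M.r₀ → v₀.inner z = 0) ∧
      ∀ z : ℂ, M.r₀ ≤ ‖z‖ → v₀.outer z = 0 := by
    refine transmission_unique hr₀ he h₀ hinf₀ ?_ ?_
    · intro z hz
      obtain ⟨θ, rfl⟩ := M.exists_curve_zero_eq hz
      have h1 := ((M.tendsto_comp_curve (ho₀ θ)).add (hε.mul (M.tendsto_comp_curve (ho₁ θ)))).sub
        ((M.tendsto_comp_curve (hi₀ θ)).add (hε.mul (M.tendsto_comp_curve (hi₁ θ))))
      have h2 := tendsto_nhds_unique h1 (hjump'.tendsto θ)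
      linear_combination h2
    · intro z hz
      obtain ⟨θ, rfl⟩ := M.exists_curve_zero_eq hz
      have h1 := ((M.tendsto_dNormal hr₀ (ho₀ θ)).add
        (hε.mul (M.tendsto_dNormal hr₀ (ho₁ θ)))).sub
        (((M.tendsto_dNormal hr₀ (hi₀ θ)).add
        (hε.mul (M.tendsto_dNormal hr₀ (hi₁ θ)))).const_mul e)
      have h2 := tendsto_nhds_unique h1 (hflux'.tendsto θ)
      rw [M.fderiv_self_eq_dNormal hr₀, M.fderiv_self_eq_dNormal hr₀]
      linear_combination (M.r₀ : ℂ) * h2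
  refine ⟨key₀, ?_⟩
  have zi := M.eventually_curve_mem hr₀ (p := fun z => v₀.inner z = 0)
    (fun z hz => eventually_eq_zero_of_disk hr₀ h₀.1 key₀.1 hz.le)
  have zo := M.eventually_curve_mem hr₀ (p := fun z => v₀.outer z = 0)
    (fun z hz => eventually_eq_zero_of_exterior hr₀ h₀.2 key₀.2 hz.ge)
  have hd0 : ∀ {v : ℂ → ℂ} {ε θ : ℝ}, (∀ᶠ w in 𝓝 (M.curve ε θ), v w = 0) →
      M.dNormal v ε θ = 0 := by
    intro v ε θ h
    have h' : v =ᶠ[𝓝 (M.curve ε θ)] fun _ => 0 := h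
    simp [dNormal, h'.fderiv_eq]
  refine transmission_unique hr₀ he h₁ hinf₁ ?_ ?_
  · intro z hz
    obtain ⟨θ, rfl⟩ := M.exists_curve_zero_eq hz
    have h1 := (M.tendsto_comp_curve (ho₁ θ)).sub (M.tendsto_comp_curve (hi₁ θ))
    have h2 := hjump'.tendsto_div θ
    refine sub_eq_zero.1 (tendsto_nhds_unique (h1.congr' ?_) h2)
    filter_upwards [zi, zo, self_mem_nhdsWithin] with ε k1 k2 hε
    have hε' : (ε : ℂ) ≠ 0 := by exact_mod_cast (ne_of_gt hε : ε ≠ 0)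
    rw [(k1 θ).self_of_nhds, (k2 θ).self_of_nhds]
    field_simp
    ring
  · intro z hz
    obtain ⟨θ, rfl⟩ := M.exists_curve_zero_eq hz
    have h1 := (M.tendsto_dNormal hr₀ (ho₁ θ)).sub ((M.tendsto_dNormal hr₀ (hi₁ θ)).const_mul e)
    have h2 := hflux'.tendsto_div θ
    have h3 : M.dNormal v₁.outer 0 θ - e * M.dNormal v₁.inner 0 θ = 0 := by
      refine tendsto_nhds_unique (h1.congr' ?_) h2
      filter_upwards [zi, zo, self_mem_nhdsWithin] with ε k1 k2 hε
      have hε' : (ε : ℂ) ≠ 0 := by exact_mod_cast (ne_of_gt hε : ε ≠ 0)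
      rw [hd0 (k1 θ), hd0 (k2 θ)]
      field_simp
      ring
    rw [M.fderiv_self_eq_dNormal hr₀, M.fderiv_self_eq_dNormal hr₀]
    linear_combination (M.r₀ : ℂ) * h3

end NanowireModel

namespace TwoSidedField

/-- The difference of two fields. -/
def diff (u w : TwoSidedField) : TwoSidedField where
  inner z := u.inner z - w.inner z
  outer z := u.outer z - w.outer z

theorem Harmonic.diff {u w : TwoSidedField} {r : ℝ} (hu : u.Harmonic r) (hw : w.Harmonic r) :
    (u.diff w).Harmonic r :=
  ⟨hu.1.sub hw.1, hu.2.sub hw.2⟩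

theorem expand_diff_inner (u₀ u₁ w₀ w₁ : TwoSidedField) (ε : ℝ) :
    ((u₀.diff w₀).expand (u₁.diff w₁) ε).inner =
      fun z => (u₀.expand u₁ ε).inner z - (w₀.expand w₁ ε).inner z := by
  funext z; simp only [expand, TwoSidedField.diff]; ring

theorem expand_diff_outer (u₀ u₁ w₀ w₁ : TwoSidedField) (ε : ℝ) :
    ((u₀.diff w₀).expand (u₁.diff w₁) ε).outer =
      fun z => (u₀.expand u₁ ε).outer z - (w₀.expand w₁ ε).outer z := by
  funext z; simp only [expand, TwoSidedField.diff]; ring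

end TwoSidedField

namespace NanowireModel

theorem dNormal_sub (M : NanowireModel) {v w : ℂ → ℂ} {ε θ : ℝ}
    (hv : DifferentiableAt ℝ v (M.curve ε θ)) (hw : DifferentiableAt ℝ w (M.curve ε θ)) :
    M.dNormal (fun z => v z - w z) ε θ = M.dNormal v ε θ - M.dNormal w ε θ := by
  have h : HasFDerivAt (fun z => v z - w z)
      (fderiv ℝ v (M.curve ε θ) - fderiv ℝ w (M.curve ε θ)) (M.curve ε θ) :=
    hv.hasFDerivAt.sub hw.hasFDerivAt
  unfold dNormal
  rw [h.fderiv]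
  simp

theorem eventually_differentiableAt_expand (M : NanowireModel) (hr₀ : 0 < M.r₀)
    {u₀ u₁ : TwoSidedField} (h₀ : u₀.Harmonic M.r₀) (h₁ : u₁.Harmonic M.r₀) :
    ∀ᶠ ε : ℝ in 𝓝[>] 0, ∀ θ : ℝ,
      DifferentiableAt ℝ (u₀.expand u₁ ε).inner (M.curve ε θ) ∧
        DifferentiableAt ℝ (u₀.expand u₁ ε).outer (M.curve ε θ) := by
  filter_upwards [M.eventually_curve_mem hr₀ (fun z hz => (h₀.1 z hz.le).eventually),
    M.eventually_curve_mem hr₀ (fun z hz => (h₁.1 z hz.le).eventually),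
    M.eventually_curve_mem hr₀ (fun z hz => (h₀.2 z hz.ge).eventually),
    M.eventually_curve_mem hr₀ (fun z hz => (h₁.2 z hz.ge).eventually)] with ε k1 k2 k3 k4 θ
  exact ⟨(differentiableAt_of_harmonicAt (k1 θ).self_of_nhds).add
      ((differentiableAt_of_harmonicAt (k2 θ).self_of_nhds).const_mul _),
    (differentiableAt_of_harmonicAt (k3 θ).self_of_nhds).add
      ((differentiableAt_of_harmonicAt (k4 θ).self_of_nhds).const_mul _)⟩

/-- Two first-order expansions whose jumps and fluxes across `∂Ω_ε` agree up to `O(ε²)` are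
equal. -/
theorem expansion_unique (M : NanowireModel) (hr₀ : 0 < M.r₀) {e : ℂ} (he : e ≠ -1)
    {v₀ v₁ w₀ w₁ : TwoSidedField} (hv₀ : v₀.Harmonic M.r₀) (hv₁ : v₁.Harmonic M.r₀)
    (hw₀ : w₀.Harmonic M.r₀) (hw₁ : w₁.Harmonic M.r₀)
    (hinf₀ : Tendsto (fun z => v₀.outer z - w₀.outer z) (cobounded ℂ) (𝓝 0))
    (hinf₁ : Tendsto (fun z => v₁.outer z - w₁.outer z) (cobounded ℂ) (𝓝 0))
    (hjump : IsSecondOrder fun ε θ =>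
      ((v₀.expand v₁ ε).outer (M.curve ε θ) - (v₀.expand v₁ ε).inner (M.curve ε θ))
        - ((w₀.expand w₁ ε).outer (M.curve ε θ) - (w₀.expand w₁ ε).inner (M.curve ε θ)))
    (hflux : IsSecondOrder fun ε θ =>
      (M.dNormal (v₀.expand v₁ ε).outer ε θ - e * M.dNormal (v₀.expand v₁ ε).inner ε θ)
        - (M.dNormal (w₀.expand w₁ ε).outer ε θ - e * M.dNormal (w₀.expand w₁ ε).inner ε θ)) :
    ((∀ z : ℂ, ‖z‖ ≤ M.r₀ → (v₀.diff w₀).inner z = 0) ∧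
        ∀ z : ℂ, M.r₀ ≤ ‖z‖ → (v₀.diff w₀).outer z = 0) ∧
      (∀ z : ℂ, ‖z‖ ≤ M.r₀ → (v₁.diff w₁).inner z = 0) ∧
        ∀ z : ℂ, M.r₀ ≤ ‖z‖ → (v₁.diff w₁).outer z = 0 := by
  refine M.homogeneous_expansion_unique hr₀ he (hv₀.diff hw₀) (hv₁.diff hw₁) hinf₀ hinf₁ ?_ ?_
  · refine hjump.congr (Eventually.of_forall fun ε θ => ?_)
    rw [TwoSidedField.expand_diff_inner, TwoSidedField.expand_diff_outer]
    ring
  · refine hflux.congr ?_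
    filter_upwards [M.eventually_differentiableAt_expand hr₀ hv₀ hv₁,
      M.eventually_differentiableAt_expand hr₀ hw₀ hw₁] with ε kv kw θ
    rw [TwoSidedField.expand_diff_inner, TwoSidedField.expand_diff_outer,
      M.dNormal_sub (kv θ).1 (kw θ).1, M.dNormal_sub (kv θ).2 (kw θ).2]
    ring

theorem tendsto_zero_of_isBigO_norm_inv {v : ℂ → ℂ}
    (h : v =O[cobounded ℂ] (fun z => ‖z‖⁻¹)) : Tendsto v (cobounded ℂ) (𝓝 0) :=
  h.trans_tendsto (tendsto_inv_atTop_zero.comp tendsto_norm_cobounded_atTop)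

/-- The second-harmonic part of the field expansion is unique. The fundamental field is unique by
itself; hence the sources `P_⊥` and `σ` are determined, and the difference of two second-harmonic
fields satisfies homogeneous conditions. -/
theorem IsFieldExpansion.secondHarmonic_unique {M : NanowireModel} (hr₀ : 0 < M.r₀)
    {eω e2ω : ℂ} (he : eω ≠ -1) (he2 : e2ω ≠ -1)
    {u₀ u₁ U₀ U₁ u₀' u₁' U₀' U₁' : TwoSidedField}
    (h : M.IsFieldExpansion eω e2ω u₀ u₁ U₀ U₁) (h' : M.IsFieldExpansion eω e2ω u₀' u₁' U₀' U₁') :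
    ((∀ z : ℂ, ‖z‖ ≤ M.r₀ → U₀.inner z = U₀'.inner z) ∧
        ∀ z : ℂ, M.r₀ ≤ ‖z‖ → U₀.outer z = U₀'.outer z) ∧
      (∀ z : ℂ, ‖z‖ ≤ M.r₀ → U₁.inner z = U₁'.inner z) ∧
        ∀ z : ℂ, M.r₀ ≤ ‖z‖ → U₁.outer z = U₁'.outer z := by
  have hu := M.expansion_unique hr₀ he h.harmonic_u₀ h.harmonic_u₁ h'.harmonic_u₀ h'.harmonic_u₁
    (by
      have := (tendsto_zero_of_isBigO_norm_inv h.infinity_u₀).sub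
        (tendsto_zero_of_isBigO_norm_inv h'.infinity_u₀)
      rw [sub_zero] at this
      exact this.congr fun z => by ring)
    (by
      have := (tendsto_zero_of_isBigO_norm_inv h.infinity_u₁).sub
        (tendsto_zero_of_isBigO_norm_inv h'.infinity_u₁)
      rwa [sub_zero] at this)
    (h.jump_u.sub h'.jump_u) (h.flux_u.sub h'.flux_u)
  -- the two fundamental fields agree near the boundary curves
  have hnear : ∀ᶠ ε : ℝ in 𝓝[>] 0, ∀ θ : ℝ,
      (u₀.expand u₁ ε).inner =ᶠ[𝓝 (M.curve ε θ)] (u₀'.expand u₁' ε).inner := by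
    filter_upwards [M.eventually_curve_mem hr₀ (p := fun z => (u₀.diff u₀').inner z = 0)
        (fun z hz => eventually_eq_zero_of_disk hr₀ (h.harmonic_u₀.diff h'.harmonic_u₀).1
          hu.1.1 hz.le),
      M.eventually_curve_mem hr₀ (p := fun z => (u₁.diff u₁').inner z = 0)
        (fun z hz => eventually_eq_zero_of_disk hr₀ (h.harmonic_u₁.diff h'.harmonic_u₁).1
          hu.2.1 hz.le)] with ε k0 k1 θ
    filter_upwards [k0 θ, k1 θ] with z e0 e1
    simp only [TwoSidedField.diff] at e0 e1
    simp only [TwoSidedField.expand]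
    linear_combination e0 + (ε : ℂ) * e1
  have hPperp : ∀ᶠ ε : ℝ in 𝓝[>] 0, ∀ θ : ℝ,
      M.Pperp eω (u₀.expand u₁ ε) ε θ = M.Pperp eω (u₀'.expand u₁' ε) ε θ := by
    filter_upwards [hnear] with ε k θ
    simp only [Pperp, dNormal, (k θ).fderiv_eq]
  have hcharge : ∀ᶠ ε : ℝ in 𝓝[>] 0, ∀ θ : ℝ,
      M.surfaceCharge eω (u₀.expand u₁ ε) ε θ = M.surfaceCharge eω (u₀'.expand u₁' ε) ε θ := by
    filter_upwards [hnear] with ε k θ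
    have hP : (fun t => M.Ppar eω (u₀.expand u₁ ε) ε t) =
        fun t => M.Ppar eω (u₀'.expand u₁' ε) ε t := by
      funext t
      simp only [Ppar, dNormal, dTangent, (k t).fderiv_eq]
    simp only [surfaceCharge, hP]
  have hU := M.expansion_unique hr₀ he2 h.harmonic_U₀ h.harmonic_U₁ h'.harmonic_U₀ h'.harmonic_U₁
    (by simpa using h.infinity_U₀.sub h'.infinity_U₀)
    (by simpa using h.infinity_U₁.sub h'.infinity_U₁)
    ((h.jump_U.sub h'.jump_U).congr (by
      filter_upwards [hPperp] with ε k θ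
      rw [k θ]; ring))
    ((h.flux_U.sub h'.flux_U).congr (by
      filter_upwards [hcharge] with ε k θ
      rw [k θ]; ring))
  exact ⟨⟨fun z hz => sub_eq_zero.1 (hU.1.1 z hz), fun z hz => sub_eq_zero.1 (hU.1.2 z hz)⟩,
    fun z hz => sub_eq_zero.1 (hU.2.1 z hz), fun z hz => sub_eq_zero.1 (hU.2.2 z hz)⟩

end NanowireModel

/-! ### Calculus of uniform first-order expansions -/

/-- `G ε θ = g₀ θ + ε g₁ θ + O(ε²)` as `ε → 0⁺`, uniformly in `θ`, with bounded `g₀` and `g₁`. -/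
structure FirstOrder (G : ℝ → ℝ → ℂ) (g₀ g₁ : ℝ → ℂ) : Prop where
  bdd₀ : ∃ C : ℝ, ∀ θ, ‖g₀ θ‖ ≤ C
  bdd₁ : ∃ C : ℝ, ∀ θ, ‖g₁ θ‖ ≤ C
  rem : NanowireModel.IsSecondOrder fun ε θ => G ε θ - (g₀ θ + (ε : ℂ) * g₁ θ)

namespace FirstOrder

variable {G H : ℝ → ℝ → ℂ} {g₀ g₁ h₀ h₁ : ℝ → ℂ}

theorem congr {g₀' g₁' : ℝ → ℂ} (h : FirstOrder G g₀ g₁) (e₀ : ∀ θ, g₀ θ = g₀' θ)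
    (e₁ : ∀ θ, g₁ θ = g₁' θ) : FirstOrder G g₀' g₁' := by
  obtain rfl : g₀ = g₀' := funext e₀
  obtain rfl : g₁ = g₁' := funext e₁
  exact h

theorem isSecondOrder (h : FirstOrder G g₀ g₁) (e₀ : ∀ θ, g₀ θ = 0) (e₁ : ∀ θ, g₁ θ = 0) :
    NanowireModel.IsSecondOrder G :=
  h.rem.congr (Eventually.of_forall fun ε θ => by rw [e₀, e₁]; ring)

theorem of_bounded {g : ℝ → ℂ} {C : ℝ} (hg : ∀ θ, ‖g θ‖ ≤ C) :
    FirstOrder (fun _ θ => g θ) g (fun _ => 0) where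
  bdd₀ := ⟨C, hg⟩
  bdd₁ := ⟨0, by simp⟩
  rem := ⟨0, by simp⟩

theorem const (a : ℂ) : FirstOrder (fun _ _ => a) (fun _ => a) (fun _ => 0) :=
  of_bounded (C := ‖a‖) fun _ => le_rfl

theorem eps : FirstOrder (fun ε _ => (ε : ℂ)) (fun _ => 0) (fun _ => 1) where
  bdd₀ := ⟨0, by simp⟩
  bdd₁ := ⟨1, by simp⟩
  rem := ⟨0, by simp⟩

theorem eventually_bounded (h : FirstOrder G g₀ g₁) :
    ∃ C : ℝ, 0 ≤ C ∧ ∀ᶠ ε : ℝ in 𝓝[>] 0, ∀ θ, ‖G ε θ‖ ≤ C := by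
  obtain ⟨⟨A, hA⟩, ⟨B, hB⟩, ⟨C, hC⟩⟩ := h
  refine ⟨|A| + |B| + |C|, by positivity, ?_⟩
  filter_upwards [hC, NanowireModel.eventually_small one_pos] with ε h1 hε θ
  have e1 : ‖(ε : ℂ) * g₁ θ‖ ≤ |B| := by
    rw [norm_mul, Complex.norm_real, Real.norm_eq_abs, abs_of_pos hε.1]
    calc ε * ‖g₁ θ‖ ≤ 1 * |B| := by
          gcongr
          · exact hε.2
          · exact (hB θ).trans (le_abs_self B)
      _ = |B| := one_mul _
  have e2 : C * ε ^ 2 ≤ |C| := by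
    calc C * ε ^ 2 ≤ |C| * 1 ^ 2 := by
          gcongr
          · exact le_abs_self C
          · exact hε.1.le
          · exact hε.2
      _ = |C| := by ring
  calc ‖G ε θ‖ = ‖g₀ θ + (ε : ℂ) * g₁ θ + (G ε θ - (g₀ θ + (ε : ℂ) * g₁ θ))‖ := by ring_nf
    _ ≤ ‖g₀ θ‖ + ‖(ε : ℂ) * g₁ θ‖ + ‖G ε θ - (g₀ θ + (ε : ℂ) * g₁ θ)‖ := norm_add₃_le
    _ ≤ |A| + |B| + |C| :=
        add_le_add (add_le_add ((hA θ).trans (le_abs_self A)) e1) ((h1 θ).trans e2)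

end FirstOrder

namespace NanowireModel

theorem IsSecondOrder.add {F G : ℝ → ℝ → ℂ} (hF : IsSecondOrder F) (hG : IsSecondOrder G) :
    IsSecondOrder fun ε θ => F ε θ + G ε θ := by
  obtain ⟨C, hC⟩ := hF
  obtain ⟨D, hD⟩ := hG
  refine ⟨C + D, ?_⟩
  filter_upwards [hC, hD] with ε h1 h2 θ
  calc ‖F ε θ + G ε θ‖ ≤ ‖F ε θ‖ + ‖G ε θ‖ := norm_add_le _ _
    _ ≤ C * ε ^ 2 + D * ε ^ 2 := add_le_add (h1 θ) (h2 θ)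
    _ = (C + D) * ε ^ 2 := by ring

theorem IsSecondOrder.mul_bounded {F G : ℝ → ℝ → ℂ} {B : ℝ} (hF : IsSecondOrder F)
    (hG : ∀ᶠ ε : ℝ in 𝓝[>] 0, ∀ θ, ‖G ε θ‖ ≤ B) :
    IsSecondOrder fun ε θ => F ε θ * G ε θ := by
  obtain ⟨C, hC⟩ := hF
  refine ⟨|C| * |B|, ?_⟩
  filter_upwards [hC, hG] with ε h1 h2 θ
  rw [norm_mul]
  calc ‖F ε θ‖ * ‖G ε θ‖ ≤ (|C| * ε ^ 2) * |B| := by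
        gcongr
        · exact (h1 θ).trans (by gcongr; exact le_abs_self C)
        · exact (h2 θ).trans (le_abs_self B)
    _ = |C| * |B| * ε ^ 2 := by ring

end NanowireModel

namespace FirstOrder

variable {G H : ℝ → ℝ → ℂ} {g₀ g₁ h₀ h₁ : ℝ → ℂ}

theorem add (hG : FirstOrder G g₀ g₁) (hH : FirstOrder H h₀ h₁) :
    FirstOrder (fun ε θ => G ε θ + H ε θ) (fun θ => g₀ θ + h₀ θ) (fun θ => g₁ θ + h₁ θ) where
  bdd₀ := by
    obtain ⟨A, hA⟩ := hG.bdd₀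
    obtain ⟨B, hB⟩ := hH.bdd₀
    exact ⟨A + B, fun θ => (norm_add_le _ _).trans (add_le_add (hA θ) (hB θ))⟩
  bdd₁ := by
    obtain ⟨A, hA⟩ := hG.bdd₁
    obtain ⟨B, hB⟩ := hH.bdd₁
    exact ⟨A + B, fun θ => (norm_add_le _ _).trans (add_le_add (hA θ) (hB θ))⟩
  rem := (hG.rem.add hH.rem).congr (Eventually.of_forall fun ε θ => by ring)

theorem mul (hG : FirstOrder G g₀ g₁) (hH : FirstOrder H h₀ h₁) :
    FirstOrder (fun ε θ => G ε θ * H ε θ) (fun θ => g₀ θ * h₀ θ)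
      (fun θ => g₀ θ * h₁ θ + g₁ θ * h₀ θ) := by
  obtain ⟨A₀, hA₀⟩ := hG.bdd₀
  obtain ⟨A₁, hA₁⟩ := hG.bdd₁
  obtain ⟨B₀, hB₀⟩ := hH.bdd₀
  obtain ⟨B₁, hB₁⟩ := hH.bdd₁
  have hmul : ∀ {x y : ℂ} {A B : ℝ}, ‖x‖ ≤ A → ‖y‖ ≤ B → ‖x * y‖ ≤ A * B := by
    intro x y A B hx hy
    rw [norm_mul]
    exact mul_le_mul hx hy (norm_nonneg _) ((norm_nonneg _).trans hx)
  refine ⟨⟨A₀ * B₀, fun θ => hmul (hA₀ θ) (hB₀ θ)⟩, ⟨A₀ * B₁ + A₁ * B₀, fun θ =>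
    (norm_add_le _ _).trans (add_le_add (hmul (hA₀ θ) (hB₁ θ)) (hmul (hA₁ θ) (hB₀ θ)))⟩, ?_⟩
  obtain ⟨K, -, hK⟩ := hH.eventually_bounded
  have hL : ∀ᶠ ε : ℝ in 𝓝[>] 0, ∀ θ, ‖g₀ θ + (ε : ℂ) * g₁ θ‖ ≤ A₀ + A₁ := by
    filter_upwards [NanowireModel.eventually_small one_pos] with ε hε θ
    refine (norm_add_le _ _).trans (add_le_add (hA₀ θ) ?_)
    rw [norm_mul, Complex.norm_real, Real.norm_eq_abs, abs_of_pos hε.1]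
    calc ε * ‖g₁ θ‖ ≤ 1 * ‖g₁ θ‖ := by gcongr; exact hε.2
      _ ≤ A₁ := by rw [one_mul]; exact hA₁ θ
  have hsq : NanowireModel.IsSecondOrder fun ε θ => (ε : ℂ) ^ 2 * (g₁ θ * h₁ θ) := by
    refine ⟨A₁ * B₁, Eventually.of_forall fun ε θ => ?_⟩
    rw [norm_mul, norm_pow, Complex.norm_real, Real.norm_eq_abs, sq_abs, mul_comm]
    gcongr
    exact hmul (hA₁ θ) (hB₁ θ)
  refine (((hG.rem.mul_bounded hK).add (hH.rem.mul_bounded hL)).add hsq).congr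
    (Eventually.of_forall fun ε θ => ?_)
  ring

theorem const_mul (a : ℂ) (hG : FirstOrder G g₀ g₁) :
    FirstOrder (fun ε θ => a * G ε θ) (fun θ => a * g₀ θ) (fun θ => a * g₁ θ) :=
  ((const a).mul hG).congr (fun _ => rfl) fun θ => by ring

theorem eps_mul (hG : FirstOrder G g₀ g₁) :
    FirstOrder (fun ε θ => (ε : ℂ) * G ε θ) (fun _ => 0) (fun θ => g₀ θ) :=
  (eps.mul hG).congr (fun θ => by ring) fun θ => by ring

theorem sub (hG : FirstOrder G g₀ g₁) (hH : FirstOrder H h₀ h₁) :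
    FirstOrder (fun ε θ => G ε θ - H ε θ) (fun θ => g₀ θ - h₀ θ) (fun θ => g₁ θ - h₁ θ) := by
  simpa only [neg_one_mul, ← sub_eq_add_neg] using hG.add (hH.const_mul (-1))

theorem eventually_half_le_norm (hG : FirstOrder G (fun _ => 1) g₁) :
    ∀ᶠ ε : ℝ in 𝓝[>] 0, ∀ θ, 1 / 2 ≤ ‖G ε θ‖ := by
  obtain ⟨B, hB⟩ := hG.bdd₁
  obtain ⟨C, hC⟩ := hG.rem
  filter_upwards [hC, NanowireModel.eventually_small one_pos,
    NanowireModel.eventually_small (δ := 1 / (2 * (|B| + |C| + 1))) (by positivity)]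
    with ε h1 hε hε' θ
  have h2 : ‖(1 : ℂ) - G ε θ‖ ≤ 1 / 2 := by
    calc ‖(1 : ℂ) - G ε θ‖ = ‖(-(G ε θ - (1 + (ε : ℂ) * g₁ θ))) - (ε : ℂ) * g₁ θ‖ := by ring_nf
      _ ≤ ‖G ε θ - (1 + (ε : ℂ) * g₁ θ)‖ + ‖(ε : ℂ) * g₁ θ‖ := by
          refine (norm_sub_le _ _).trans (le_of_eq ?_)
          rw [norm_neg]
      _ ≤ |C| * ε + ε * |B| := by
          refine add_le_add ((h1 θ).trans ?_) ?_
          · calc C * ε ^ 2 ≤ |C| * ε ^ 2 := by gcongr; exact le_abs_self C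
              _ ≤ |C| * ε := by gcongr; nlinarith [hε.1, hε.2]
          · rw [norm_mul, Complex.norm_real, Real.norm_eq_abs, abs_of_pos hε.1]
            have := hε.1
            gcongr
            exact (hB θ).trans (le_abs_self B)
      _ = (|B| + |C|) * ε := by ring
      _ ≤ (|B| + |C| + 1) * (1 / (2 * (|B| + |C| + 1))) := by
          exact mul_le_mul (by linarith) hε'.2 hε.1.le (by positivity)
      _ = 1 / 2 := by field_simp
  have h3 := norm_sub_norm_le (1 : ℂ) (G ε θ)
  rw [norm_one] at h3
  linarith

theorem inv (hG : FirstOrder G (fun _ => 1) g₁) :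
    FirstOrder (fun ε θ => (G ε θ)⁻¹) (fun _ => 1) (fun θ => -g₁ θ) := by
  have hlin : FirstOrder (fun ε θ => 1 - (ε : ℂ) * g₁ θ) (fun _ => 1) (fun θ => -g₁ θ) := by
    obtain ⟨B, hB⟩ := hG.bdd₁
    exact ((const 1).sub (of_bounded hB).eps_mul).congr (fun θ => by ring) fun θ => by ring
  refine ⟨hlin.bdd₀, hlin.bdd₁, ?_⟩
  have h1 : NanowireModel.IsSecondOrder fun ε θ => 1 - G ε θ * (1 - (ε : ℂ) * g₁ θ) :=
    ((const 1).sub (hG.mul hlin)).isSecondOrder (fun θ => by ring) fun θ => by ring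
  have h2 : ∀ᶠ ε : ℝ in 𝓝[>] 0, ∀ θ, ‖(G ε θ)⁻¹‖ ≤ 2 := by
    filter_upwards [hG.eventually_half_le_norm] with ε h θ
    rw [norm_inv]
    exact inv_le_of_inv_le₀ (by norm_num) (by simpa using h θ)
  refine (h1.mul_bounded h2).congr ?_
  filter_upwards [hG.eventually_half_le_norm] with ε h θ
  have : G ε θ ≠ 0 := norm_pos_iff.1 (by linarith [h θ])
  field_simp
  ring

theorem pow (hG : FirstOrder G (fun _ => 1) g₁) (k : ℕ) :
    FirstOrder (fun ε θ => G ε θ ^ k) (fun _ => 1) (fun θ => k * g₁ θ) := by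
  induction k with
  | zero =>
    simp only [pow_zero]
    exact (const 1).congr (fun _ => rfl) fun _ => by simp
  | succ k ih =>
    have := (ih.mul hG).congr (g₀' := fun _ => 1) (g₁' := fun θ => ((k + 1 : ℕ) : ℂ) * g₁ θ)
      (fun θ => by ring) (fun θ => by push_cast; ring)
    simpa only [pow_succ] using this

theorem zpow (hG : FirstOrder G (fun _ => 1) g₁) (p : ℤ) :
    FirstOrder (fun ε θ => G ε θ ^ p) (fun _ => 1) (fun θ => p * g₁ θ) := by
  obtain ⟨k, rfl | rfl⟩ := p.eq_nat_or_neg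
  · simp only [zpow_natCast, Int.cast_natCast]
    exact hG.pow k
  · simp only [zpow_neg, zpow_natCast, Int.cast_neg, Int.cast_natCast, neg_mul]
    exact (hG.pow k).inv

end FirstOrder

/-! ### Polar modes and their traces on the perturbed boundary -/

/-- The function `cos (p θ)` with complex values. -/
noncomputable def cosC (p : ℤ) (θ : ℝ) : ℂ := ((Real.cos (p * θ) : ℝ) : ℂ)

/-- The function `sin (p θ)` with complex values. -/
noncomputable def sinC (p : ℤ) (θ : ℝ) : ℂ := ((Real.sin (p * θ) : ℝ) : ℂ)

theorem norm_cosC_le (p : ℤ) (θ : ℝ) : ‖cosC p θ‖ ≤ 1 := by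
  rw [cosC, Complex.norm_real]; exact Real.abs_cos_le_one _

theorem norm_sinC_le (p : ℤ) (θ : ℝ) : ‖sinC p θ‖ ≤ 1 := by
  rw [sinC, Complex.norm_real]; exact Real.abs_sin_le_one _

theorem cosC_neg (p : ℤ) (θ : ℝ) : cosC (-p) θ = cosC p θ := by
  simp [cosC]

theorem sinC_neg (p : ℤ) (θ : ℝ) : sinC (-p) θ = -sinC p θ := by
  simp [sinC]

theorem cosC_add (p q : ℤ) (θ : ℝ) :
    cosC (p + q) θ = cosC p θ * cosC q θ - sinC p θ * sinC q θ := by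
  simp only [cosC, sinC]; push_cast; rw [add_mul, Complex.cos_add]

theorem sinC_add (p q : ℤ) (θ : ℝ) :
    sinC (p + q) θ = sinC p θ * cosC q θ + cosC p θ * sinC q θ := by
  simp only [cosC, sinC]; push_cast; rw [add_mul, Complex.sin_add]

theorem cosC_sub (p q : ℤ) (θ : ℝ) :
    cosC (p - q) θ = cosC p θ * cosC q θ + sinC p θ * sinC q θ := by
  rw [sub_eq_add_neg, cosC_add, cosC_neg, sinC_neg]; ring

theorem sinC_sub (p q : ℤ) (θ : ℝ) :
    sinC (p - q) θ = sinC p θ * cosC q θ - cosC p θ * sinC q θ := by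
  rw [sub_eq_add_neg, sinC_add, cosC_neg, sinC_neg]; ring

theorem cosC_two (θ : ℝ) : cosC 2 θ = cosC 1 θ ^ 2 - sinC 1 θ ^ 2 := by
  rw [show (2 : ℤ) = 1 + 1 by norm_num, cosC_add]; ring

theorem sinC_two (θ : ℝ) : sinC 2 θ = 2 * sinC 1 θ * cosC 1 θ := by
  rw [show (2 : ℤ) = 1 + 1 by norm_num, sinC_add]; ring

theorem cosC_sq_add_sinC_sq (p : ℤ) (θ : ℝ) : cosC p θ ^ 2 + sinC p θ ^ 2 = 1 := by
  simp only [cosC, sinC]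
  exact_mod_cast Real.cos_sq_add_sin_sq (p * θ)

theorem hasDerivAt_cosC (p : ℤ) (θ : ℝ) : HasDerivAt (cosC p) (-(p * sinC p θ)) θ := by
  refine (((hasDerivAt_id' θ).const_mul (p : ℝ)).cos.ofReal_comp).congr_deriv ?_
  simp only [sinC, Complex.ofReal_mul, Complex.ofReal_neg, mul_one, Complex.ofReal_intCast]
  ring

theorem hasDerivAt_sinC (p : ℤ) (θ : ℝ) : HasDerivAt (sinC p) (p * cosC p θ) θ := by
  refine (((hasDerivAt_id' θ).const_mul (p : ℝ)).sin.ofReal_comp).congr_deriv ?_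
  simp only [cosC, Complex.ofReal_mul, mul_one, Complex.ofReal_intCast]
  ring

theorem FirstOrder.cosC (p : ℤ) :
    FirstOrder (fun _ θ => _root_.cosC p θ) (_root_.cosC p) (fun _ => 0) :=
  of_bounded (norm_cosC_le p)

theorem FirstOrder.sinC (p : ℤ) :
    FirstOrder (fun _ θ => _root_.sinC p θ) (_root_.sinC p) (fun _ => 0) :=
  of_bounded (norm_sinC_le p)

/-- The harmonic function `(|z| / r) ^ p * cos (p arg z)`, i.e. `Re ((z / r) ^ p)`, with `p`
positive inside and negative outside the disk of radius `r`. -/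
noncomputable def polarMode (r : ℝ) (p : ℤ) (z : ℂ) : ℂ := ((((z / r) ^ p).re : ℝ) : ℂ)

theorem norm_polarMode_le (r : ℝ) (p : ℤ) (z : ℂ) : ‖polarMode r p z‖ ≤ (‖z‖ / |r|) ^ p := by
  rw [polarMode, Complex.norm_real]
  refine (Complex.abs_re_le_norm _).trans (le_of_eq ?_)
  rw [norm_zpow, norm_div, Complex.norm_real, Real.norm_eq_abs]

theorem harmonicAt_ofReal {f : ℂ → ℝ} {z : ℂ} (h : HarmonicAt f z) :
    HarmonicAt (fun w => ((f w : ℝ) : ℂ)) z := h.comp_CLM Complex.ofRealCLM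

theorem harmonicAt_polarMode_of_ne {r : ℝ} (p : ℤ) {z : ℂ} (hr : r ≠ 0) (hz : z ≠ 0) :
    HarmonicAt (polarMode r p) z := by
  have hrc : (r : ℂ) ≠ 0 := by exact_mod_cast hr
  have h1 : AnalyticAt ℂ (fun w : ℂ => (w / r) ^ p) z :=
    (analyticAt_id.div analyticAt_const hrc).zpow (div_ne_zero hz hrc)
  exact harmonicAt_ofReal (AnalyticAt.harmonicAt_re h1)

theorem harmonicAt_polarMode_of_nonneg (r : ℝ) {p : ℤ} (hp : 0 ≤ p) (z : ℂ) :
    HarmonicAt (polarMode r p) z := by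
  obtain ⟨k, rfl⟩ := Int.eq_ofNat_of_zero_le hp
  have h1 : AnalyticAt ℂ (fun w : ℂ => (w / r) ^ (k : ℤ)) z := by
    simp only [zpow_natCast, div_eq_mul_inv]
    exact (analyticAt_id.mul analyticAt_const).pow k
  exact harmonicAt_ofReal (AnalyticAt.harmonicAt_re h1)

/-- The ratio `1 + ε cos (n θ)` between the radius of the perturbed boundary and `r₀`. -/
noncomputable def stretch (n : ℤ) (ε θ : ℝ) : ℂ := 1 + ε * cosC n θ

/-- The trace of a polar mode on the perturbed boundary. -/
noncomputable def modeTrace (n p : ℤ) (ε θ : ℝ) : ℂ := stretch n ε θ ^ p * cosC p θ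

/-- The normal derivative of a polar mode on the perturbed boundary, times the speed. -/
noncomputable def modeNormal (n p : ℤ) (ε θ : ℝ) : ℂ :=
  p * stretch n ε θ ^ (p - 1) * (stretch n ε θ * cosC p θ - ε * (n * sinC n θ) * sinC p θ)

/-- The tangential derivative of a polar mode on the perturbed boundary, times the speed. -/
noncomputable def modeTangent (n p : ℤ) (ε θ : ℝ) : ℂ :=
  -(p * stretch n ε θ ^ (p - 1) * (stretch n ε θ * sinC p θ + ε * (n * sinC n θ) * cosC p θ))

/-- The angular derivative of `modeNormal`. -/
noncomputable def modeNormalDeriv (n p : ℤ) (ε θ : ℝ) : ℂ :=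
  p * ((p - 1) * stretch n ε θ ^ (p - 2) * (-(ε * (n * sinC n θ)))
      * (stretch n ε θ * cosC p θ - ε * (n * sinC n θ) * sinC p θ)
    + stretch n ε θ ^ (p - 1) * (-(ε * (n * sinC n θ)) * cosC p θ - stretch n ε θ * (p * sinC p θ)
      - (ε * (n * (n * cosC n θ)) * sinC p θ + ε * (n * sinC n θ) * (p * cosC p θ))))

/-- The angular derivative of `modeTangent`. -/
noncomputable def modeTangentDeriv (n p : ℤ) (ε θ : ℝ) : ℂ :=
  -(p * ((p - 1) * stretch n ε θ ^ (p - 2) * (-(ε * (n * sinC n θ)))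
      * (stretch n ε θ * sinC p θ + ε * (n * sinC n θ) * cosC p θ)
    + stretch n ε θ ^ (p - 1) * (-(ε * (n * sinC n θ)) * sinC p θ + stretch n ε θ * (p * cosC p θ)
      + (ε * (n * (n * cosC n θ)) * cosC p θ - ε * (n * sinC n θ) * (p * sinC p θ)))))

/-- The square of the ratio between the speed of the perturbed boundary and `r₀`. -/
noncomputable def speedRatioSq (n : ℤ) (ε θ : ℝ) : ℂ :=
  stretch n ε θ ^ 2 + (ε * (n * sinC n θ)) ^ 2

/-- The angular derivative of `(speedRatioSq n ε θ)⁻¹`. -/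
noncomputable def speedRatioSqInvDeriv (n : ℤ) (ε θ : ℝ) : ℂ :=
  -(2 * stretch n ε θ * (-(ε * (n * sinC n θ)))
    + 2 * (ε * (n * sinC n θ)) * (ε * (n * (n * cosC n θ)))) * ((speedRatioSq n ε θ)⁻¹) ^ 2

theorem firstOrder_stretch (n : ℤ) : FirstOrder (stretch n) (fun _ => 1) (cosC n) :=
  ((FirstOrder.const 1).add (FirstOrder.cosC n).eps_mul).congr (fun θ => by ring) fun θ => by ring

theorem firstOrder_eps_mul_sin (n : ℤ) :
    FirstOrder (fun ε θ => (ε : ℂ) * (n * sinC n θ)) (fun _ => 0) (fun θ => n * sinC n θ) :=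
  ((FirstOrder.sinC n).const_mul n).eps_mul

theorem firstOrder_eps_mul_cos (n : ℤ) :
    FirstOrder (fun ε θ => (ε : ℂ) * (n * (n * cosC n θ))) (fun _ => 0)
      (fun θ => n * (n * cosC n θ)) :=
  (((FirstOrder.cosC n).const_mul n).const_mul n).eps_mul

theorem firstOrder_modeTrace (n p : ℤ) :
    FirstOrder (modeTrace n p) (cosC p) (fun θ => p * cosC n θ * cosC p θ) :=
  (((firstOrder_stretch n).zpow p).mul (FirstOrder.cosC p)).congr (fun θ => by ring)
    fun θ => by ring

theorem firstOrder_modeNormal (n p : ℤ) :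
    FirstOrder (modeNormal n p) (fun θ => p * cosC p θ)
      (fun θ => p * (p * cosC n θ * cosC p θ - n * sinC n θ * sinC p θ)) :=
  ((((firstOrder_stretch n).zpow (p - 1)).const_mul p).mul
    (((firstOrder_stretch n).mul (FirstOrder.cosC p)).sub
      ((firstOrder_eps_mul_sin n).mul (FirstOrder.sinC p)))).congr (fun θ => by ring)
    fun θ => by push_cast; ring

theorem firstOrder_modeTangent (n p : ℤ) :
    FirstOrder (modeTangent n p) (fun θ => -(p * sinC p θ))
      (fun θ => -(p * (p * cosC n θ * sinC p θ + n * sinC n θ * cosC p θ))) := by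
  have h := ((((firstOrder_stretch n).zpow (p - 1)).const_mul p).mul
    (((firstOrder_stretch n).mul (FirstOrder.sinC p)).add
      ((firstOrder_eps_mul_sin n).mul (FirstOrder.cosC p)))).const_mul (-1)
  have h' := h.congr (g₀' := fun θ => -(p * sinC p θ))
    (g₁' := fun θ => -(p * (p * cosC n θ * sinC p θ + n * sinC n θ * cosC p θ)))
    (fun θ => by ring) fun θ => by push_cast; ring
  simp only [neg_one_mul] at h'
  exact h'

theorem firstOrder_modeNormalDeriv (n p : ℤ) :
    FirstOrder (modeNormalDeriv n p) (fun θ => -(p * (p * sinC p θ)))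
      (fun θ => -(p * ((p * p + n * n) * cosC n θ * sinC p θ
        + 2 * n * p * sinC n θ * cosC p θ))) := by
  have hs := firstOrder_stretch n
  have hq := firstOrder_eps_mul_sin n
  have hc := firstOrder_eps_mul_cos n
  have C := FirstOrder.cosC p
  have S := FirstOrder.sinC p
  have hq' := hq.const_mul (-1)
  have h := ((((hs.zpow (p - 2)).const_mul (p - 1)).mul hq').mul
      ((hs.mul C).sub (hq.mul S))).add
    ((hs.zpow (p - 1)).mul (((hq'.mul C).sub (hs.mul (S.const_mul p))).sub
      ((hc.mul S).add (hq.mul (C.const_mul p)))))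
  have h' := (h.const_mul p).congr (g₀' := fun θ => -(p * (p * sinC p θ)))
    (g₁' := fun θ => -(p * ((p * p + n * n) * cosC n θ * sinC p θ
        + 2 * n * p * sinC n θ * cosC p θ)))
    (fun θ => by ring) fun θ => by push_cast; ring
  simp only [neg_one_mul] at h'
  exact h'

theorem firstOrder_modeTangentDeriv (n p : ℤ) :
    FirstOrder (modeTangentDeriv n p) (fun θ => -(p * (p * cosC p θ)))
      (fun θ => -(p * ((p * p + n * n) * cosC n θ * cosC p θ
        - 2 * n * p * sinC n θ * sinC p θ))) := by
  have hs := firstOrder_stretch n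
  have hq := firstOrder_eps_mul_sin n
  have hc := firstOrder_eps_mul_cos n
  have C := FirstOrder.cosC p
  have S := FirstOrder.sinC p
  have hq' := hq.const_mul (-1)
  have h := ((((hs.zpow (p - 2)).const_mul (p - 1)).mul hq').mul
      ((hs.mul S).add (hq.mul C))).add
    ((hs.zpow (p - 1)).mul (((hq'.mul S).add (hs.mul (C.const_mul p))).add
      ((hc.mul C).sub (hq.mul (S.const_mul p)))))
  have h' := ((h.const_mul p).const_mul (-1)).congr (g₀' := fun θ => -(p * (p * cosC p θ)))
    (g₁' := fun θ => -(p * ((p * p + n * n) * cosC n θ * cosC p θ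
        - 2 * n * p * sinC n θ * sinC p θ)))
    (fun θ => by ring) fun θ => by push_cast; ring
  simp only [neg_one_mul] at h'
  exact h'

theorem firstOrder_speedRatioSq (n : ℤ) :
    FirstOrder (speedRatioSq n) (fun _ => 1) (fun θ => 2 * cosC n θ) := by
  have hs := firstOrder_stretch n
  have hq := firstOrder_eps_mul_sin n
  have h := ((hs.mul hs).add (hq.mul hq)).congr (g₀' := fun _ => 1) (g₁' := fun θ => 2 * cosC n θ)
    (fun θ => by ring) fun θ => by ring
  simp only [← sq] at h
  exact h

theorem firstOrder_speedRatioSqInv (n : ℤ) :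
    FirstOrder (fun ε θ => (speedRatioSq n ε θ)⁻¹) (fun _ => 1) (fun θ => -(2 * cosC n θ)) :=
  (firstOrder_speedRatioSq n).inv

theorem firstOrder_speedRatioSqInvDeriv (n : ℤ) :
    FirstOrder (speedRatioSqInvDeriv n) (fun _ => 0) (fun θ => 2 * n * sinC n θ) := by
  have hs := firstOrder_stretch n
  have hq := firstOrder_eps_mul_sin n
  have hc := firstOrder_eps_mul_cos n
  have hd := firstOrder_speedRatioSqInv n
  have h := (((((hs.const_mul 2).mul (hq.const_mul (-1))).add
    ((hq.const_mul 2).mul hc)).const_mul (-1)).mul (hd.mul hd)).congr (g₀' := fun _ => 0)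
    (g₁' := fun θ => 2 * n * sinC n θ) (fun θ => by ring) fun θ => by ring
  simp only [neg_one_mul, ← sq] at h
  exact h

theorem hasDerivAt_stretch (n : ℤ) (ε θ : ℝ) :
    HasDerivAt (stretch n ε) (-(ε * (n * sinC n θ))) θ := by
  refine (((hasDerivAt_cosC n θ).const_mul (ε : ℂ)).const_add 1).congr_deriv ?_
  ring

theorem hasDerivAt_stretch_zpow (n p : ℤ) {ε θ : ℝ} (h : stretch n ε θ ≠ 0) :
    HasDerivAt (fun t => stretch n ε t ^ p)
      (p * stretch n ε θ ^ (p - 1) * (-(ε * (n * sinC n θ)))) θ := by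
  exact (hasDerivAt_zpow p _ (Or.inl h)).comp θ (hasDerivAt_stretch n ε θ)

theorem hasDerivAt_eps_mul_sin (n : ℤ) (ε θ : ℝ) :
    HasDerivAt (fun t => (ε : ℂ) * (n * sinC n t)) (ε * (n * (n * cosC n θ))) θ :=
  ((hasDerivAt_sinC n θ).const_mul (n : ℂ)).const_mul (ε : ℂ)

theorem hasDerivAt_modeNormal (n p : ℤ) {ε θ : ℝ} (h : stretch n ε θ ≠ 0) :
    HasDerivAt (modeNormal n p ε) (modeNormalDeriv n p ε θ) θ := by
  have h1 := ((hasDerivAt_stretch_zpow n (p - 1) h).const_mul (p : ℂ)).mul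
    (((hasDerivAt_stretch n ε θ).mul (hasDerivAt_cosC p θ)).sub
      ((hasDerivAt_eps_mul_sin n ε θ).mul (hasDerivAt_sinC p θ)))
  refine h1.congr_deriv ?_
  rw [modeNormalDeriv, show p - 1 - 1 = p - 2 by ring]
  simp only [Pi.mul_apply, Pi.sub_apply]
  push_cast
  ring

theorem hasDerivAt_modeTangent (n p : ℤ) {ε θ : ℝ} (h : stretch n ε θ ≠ 0) :
    HasDerivAt (modeTangent n p ε) (modeTangentDeriv n p ε θ) θ := by
  have h1 := (((hasDerivAt_stretch_zpow n (p - 1) h).const_mul (p : ℂ)).mul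
    (((hasDerivAt_stretch n ε θ).mul (hasDerivAt_sinC p θ)).add
      ((hasDerivAt_eps_mul_sin n ε θ).mul (hasDerivAt_cosC p θ)))).neg
  refine h1.congr_deriv ?_
  rw [modeTangentDeriv, show p - 1 - 1 = p - 2 by ring]
  simp only [Pi.mul_apply, Pi.add_apply]
  push_cast
  ring

theorem hasDerivAt_speedRatioSqInv (n : ℤ) {ε θ : ℝ} (h : speedRatioSq n ε θ ≠ 0) :
    HasDerivAt (fun t => (speedRatioSq n ε t)⁻¹) (speedRatioSqInvDeriv n ε θ) θ := by
  have h1 := ((hasDerivAt_stretch n ε θ).pow 2).add ((hasDerivAt_eps_mul_sin n ε θ).pow 2)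
  have h2 : HasDerivAt (speedRatioSq n ε) _ θ := h1
  refine (h2.inv h).congr_deriv ?_
  rw [speedRatioSqInvDeriv, div_eq_mul_inv, inv_pow]
  push_cast
  ring

namespace NanowireModel

/-- The function `v` is differentiable at the point of `∂Ω_ε` with parameter `θ`; its derivatives
along the outward normal and the tangent, both times the speed, are `x` and `y`. -/
def HasBoundaryDerivs (M : NanowireModel) (v : ℂ → ℂ) (ε θ : ℝ) (x y : ℂ) : Prop :=
  ∃ L : ℂ →L[ℝ] ℂ, HasFDerivAt v L (M.curve ε θ) ∧ L (-Complex.I * M.velocity ε θ) = x ∧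
    L (M.velocity ε θ) = y

theorem HasBoundaryDerivs.add {M : NanowireModel} {v w : ℂ → ℂ} {ε θ : ℝ} {x y x' y' : ℂ}
    (hv : M.HasBoundaryDerivs v ε θ x y) (hw : M.HasBoundaryDerivs w ε θ x' y') :
    M.HasBoundaryDerivs (fun z => v z + w z) ε θ (x + x') (y + y') := by
  obtain ⟨L, hL, rfl, rfl⟩ := hv
  obtain ⟨K, hK, rfl, rfl⟩ := hw
  exact ⟨L + K, hL.add hK, rfl, rfl⟩

theorem HasBoundaryDerivs.const_mul {M : NanowireModel} {v : ℂ → ℂ} {ε θ : ℝ} {x y : ℂ} (c : ℂ)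
    (hv : M.HasBoundaryDerivs v ε θ x y) :
    M.HasBoundaryDerivs (fun z => c * v z) ε θ (c * x) (c * y) := by
  obtain ⟨L, hL, rfl, rfl⟩ := hv
  exact ⟨c • L, hL.const_mul c, rfl, rfl⟩

theorem hasBoundaryDerivs_const (M : NanowireModel) (c : ℂ) (ε θ : ℝ) :
    M.HasBoundaryDerivs (fun _ => c) ε θ 0 0 :=
  ⟨0, hasFDerivAt_const _ _, rfl, rfl⟩

theorem HasBoundaryDerivs.dNormal_eq {M : NanowireModel} {v : ℂ → ℂ} {ε θ : ℝ} {x y : ℂ}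
    (h : M.HasBoundaryDerivs v ε θ x y) : M.dNormal v ε θ = x / M.speed ε θ := by
  obtain ⟨L, hL, rfl, -⟩ := h
  have : M.normal ε θ = (M.speed ε θ)⁻¹ • (-Complex.I * M.velocity ε θ) := by
    rw [normal, tangent, Complex.real_smul, Complex.ofReal_inv]; ring
  rw [dNormal, hL.fderiv, this, map_smul, Complex.real_smul, Complex.ofReal_inv]
  ring

theorem HasBoundaryDerivs.dTangent_eq {M : NanowireModel} {v : ℂ → ℂ} {ε θ : ℝ} {x y : ℂ}
    (h : M.HasBoundaryDerivs v ε θ x y) : M.dTangent v ε θ = y / M.speed ε θ := by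
  obtain ⟨L, hL, -, rfl⟩ := h
  have : M.tangent ε θ = (M.speed ε θ)⁻¹ • M.velocity ε θ := by
    rw [tangent, Complex.real_smul, Complex.ofReal_inv]; ring
  rw [dTangent, hL.fderiv, this, map_smul, Complex.real_smul, Complex.ofReal_inv]
  ring

theorem stretch_eq_ofReal (n : ℕ) (ε θ : ℝ) :
    stretch n ε θ = ((1 + ε * Real.cos (n * θ) : ℝ) : ℂ) := by
  simp [stretch, cosC]

theorem stretch_ne_zero (n : ℕ) {ε : ℝ} (hε : 0 ≤ ε) (hε' : ε ≤ 1 / 2) (θ : ℝ) :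
    stretch n ε θ ≠ 0 := by
  rw [stretch_eq_ofReal]
  have := half_le_one_add_mul_cos hε hε' (n * θ)
  exact_mod_cast (by linarith : (0 : ℝ) < 1 + ε * Real.cos (n * θ)).ne'

theorem speed_sq_eq (M : NanowireModel) (ε θ : ℝ) :
    (M.speed ε θ : ℂ) ^ 2 = (M.r₀ : ℂ) ^ 2 * speedRatioSq M.n ε θ := by
  rw [← Complex.ofReal_pow, speed_sq, speedRatioSq, stretch_eq_ofReal, sinC]
  push_cast
  ring

theorem curve_div (M : NanowireModel) (hr₀ : 0 < M.r₀) (ε θ : ℝ) :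
    M.curve ε θ / M.r₀ =
      ((1 + ε * Real.cos (M.n * θ) : ℝ) : ℂ) * Complex.exp (θ * Complex.I) := by
  have hr : (M.r₀ : ℂ) ≠ 0 := by exact_mod_cast hr₀.ne'
  rw [curve, Complex.ofReal_mul, mul_assoc, mul_div_cancel_left₀ _ hr]

theorem exp_mul_I_zpow (p : ℤ) (θ : ℝ) :
    Complex.exp (θ * Complex.I) ^ p =
      ((Real.cos (p * θ) : ℝ) : ℂ) + ((Real.sin (p * θ) : ℝ) : ℂ) * Complex.I := by
  rw [← Complex.exp_int_mul, ← mul_assoc, Complex.exp_mul_I]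
  push_cast
  rfl

theorem polarMode_curve (M : NanowireModel) (hr₀ : 0 < M.r₀) (p : ℤ) (ε θ : ℝ) :
    polarMode M.r₀ p (M.curve ε θ) = modeTrace M.n p ε θ := by
  rw [polarMode, curve_div M hr₀, mul_zpow, exp_mul_I_zpow, ← Complex.ofReal_zpow,
    Complex.re_ofReal_mul, modeTrace, stretch_eq_ofReal, cosC]
  simp only [Complex.add_re, Complex.mul_re, Complex.ofReal_re, Complex.ofReal_im, Complex.I_re,
    Complex.I_im]
  push_cast
  ring

theorem hasBoundaryDerivs_polarMode (M : NanowireModel) (hr₀ : 0 < M.r₀) (p : ℤ) {ε θ : ℝ}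
    (hs : stretch M.n ε θ ≠ 0) :
    M.HasBoundaryDerivs (polarMode M.r₀ p) ε θ (modeNormal M.n p ε θ) (modeTangent M.n p ε θ) := by
  have hr : (M.r₀ : ℂ) ≠ 0 := by exact_mod_cast hr₀.ne'
  have hz : M.curve ε θ / M.r₀ ≠ 0 := by
    rw [curve_div M hr₀, ← stretch_eq_ofReal]
    exact mul_ne_zero hs (Complex.exp_ne_zero _)
  have h1 : HasDerivAt (fun w : ℂ => (w / M.r₀) ^ p)
      (p * (M.curve ε θ / M.r₀) ^ (p - 1) * (1 / M.r₀)) (M.curve ε θ) :=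
    HasDerivAt.comp (M.curve ε θ) (h := fun w : ℂ => w / M.r₀) (h₂ := fun w : ℂ => w ^ p)
      (hasDerivAt_zpow p _ (Or.inl hz)) ((hasDerivAt_id' _).div_const _)
  have h2 := (Complex.ofRealCLM.comp Complex.reCLM).hasFDerivAt.comp (M.curve ε θ)
    (h1.hasFDerivAt.restrictScalars ℝ)
  -- the complex derivative along the unnormalized normal
  have key : (-Complex.I * M.velocity ε θ) *
        (p * (M.curve ε θ / M.r₀) ^ (p - 1) * (1 / M.r₀)) =
      ((p * (1 + ε * Real.cos (M.n * θ)) ^ (p - 1) : ℝ) : ℂ) *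
        ((((1 + ε * Real.cos (M.n * θ) : ℝ) : ℂ)
          + ((ε * (M.n * Real.sin (M.n * θ)) : ℝ) : ℂ) * Complex.I)
          * (((Real.cos (p * θ) : ℝ) : ℂ) + ((Real.sin (p * θ) : ℝ) : ℂ) * Complex.I)) := by
    rw [← exp_mul_I_zpow, neg_I_mul_velocity, curve_div M hr₀, mul_zpow,
      zpow_sub_one₀ (Complex.exp_ne_zero _)]
    have := Complex.exp_ne_zero (θ * Complex.I)
    push_cast
    field_simp
  have key' : M.velocity ε θ * (p * (M.curve ε θ / M.r₀) ^ (p - 1) * (1 / M.r₀)) =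
      ((p * (1 + ε * Real.cos (M.n * θ)) ^ (p - 1) : ℝ) : ℂ) *
        (Complex.I * ((((1 + ε * Real.cos (M.n * θ) : ℝ) : ℂ)
          + ((ε * (M.n * Real.sin (M.n * θ)) : ℝ) : ℂ) * Complex.I)
          * (((Real.cos (p * θ) : ℝ) : ℂ) + ((Real.sin (p * θ) : ℝ) : ℂ) * Complex.I))) := by
    calc _ = Complex.I * ((-Complex.I * M.velocity ε θ) *
          (p * (M.curve ε θ / M.r₀) ^ (p - 1) * (1 / M.r₀))) := by
          linear_combination (M.velocity ε θ * (p * (M.curve ε θ / M.r₀) ^ (p - 1)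
            * (1 / M.r₀))) * Complex.I_mul_I
      _ = _ := by rw [key]; ring
  refine ⟨_, h2, ?_, ?_⟩
  · change ((((-Complex.I * M.velocity ε θ) *
        (p * (M.curve ε θ / M.r₀) ^ (p - 1) * (1 / M.r₀))).re : ℝ) : ℂ) = _
    rw [key, Complex.re_ofReal_mul, modeNormal, stretch_eq_ofReal, cosC, sinC, sinC]
    simp only [Complex.mul_re, Complex.add_re, Complex.add_im, Complex.ofReal_re,
      Complex.ofReal_im, Complex.I_re, Complex.I_im, Complex.mul_im]
    push_cast
    ring
  · change (((M.velocity ε θ *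
        (p * (M.curve ε θ / M.r₀) ^ (p - 1) * (1 / M.r₀))).re : ℝ) : ℂ) = _
    rw [key', Complex.re_ofReal_mul, modeTangent, stretch_eq_ofReal, cosC, sinC, sinC]
    simp only [Complex.mul_re, Complex.add_re, Complex.add_im, Complex.ofReal_re,
      Complex.ofReal_im, Complex.I_re, Complex.I_im, Complex.mul_im]
    push_cast
    ring

theorem isBigO_polarMode {r : ℝ} (hr : 0 < r) {p : ℤ} (hp : p ≤ -1) :
    polarMode r p =O[cobounded ℂ] (fun z => ‖z‖⁻¹) := by
  refine IsBigO.of_bound r ?_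
  filter_upwards [tendsto_norm_cobounded_atTop.eventually_ge_atTop r] with z hz
  have hz0 : 0 < ‖z‖ := hr.trans_le hz
  calc ‖polarMode r p z‖ ≤ (‖z‖ / |r|) ^ p := norm_polarMode_le r p z
    _ ≤ (‖z‖ / |r|) ^ (-1 : ℤ) := by
        refine zpow_le_zpow_right₀ ?_ hp
        rw [abs_of_pos hr, le_div_iff₀ hr, one_mul]; exact hz
    _ = r * ‖(‖z‖⁻¹ : ℝ)‖ := by
        rw [abs_of_pos hr, zpow_neg_one, norm_inv, norm_norm, inv_div]; rfl

theorem tendsto_polarMode {r : ℝ} (hr : 0 < r) {p : ℤ} (hp : p ≤ -1) :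
    Tendsto (polarMode r p) (cobounded ℂ) (𝓝 0) :=
  tendsto_zero_of_isBigO_norm_inv (isBigO_polarMode hr hp)

end NanowireModel

/-! ### Construction of the field expansion -/

namespace NanowireModel

/-- Leading term of the fundamental field: `a x₁` inside, and outside the background plus a dipole
that makes the field continuous. -/
noncomputable def fundamental₀ (M : NanowireModel) (a : ℂ) : TwoSidedField where
  inner z := M.r₀ * a * polarMode M.r₀ 1 z
  outer z := -(M.E * M.r₀) * polarMode M.r₀ 1 z + M.r₀ * (a + M.E) * polarMode M.r₀ (-1) z

/-- First-order term of the fundamental field: the mode `n - 1` inside, the modes `n ± 1`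
outside. -/
noncomputable def fundamental₁ (M : NanowireModel) (e a b : ℂ) : TwoSidedField where
  inner z := M.r₀ * b * polarMode M.r₀ (M.n - 1) z
  outer z := M.r₀ * (b - a * (e - 1) / 2) * polarMode M.r₀ (-(M.n - 1)) z
    + M.r₀ * (-(a * (e - 1) / 2)) * polarMode M.r₀ (-(M.n + 1)) z

/-- Leading term of the second-harmonic field: a constant and the mode `2`. -/
noncomputable def harmonic₀ (M : NanowireModel) (κ α β : ℂ) : TwoSidedField where
  inner z := κ + α * polarMode M.r₀ 2 z
  outer z := β * polarMode M.r₀ (-2) z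

/-- First-order term of the second-harmonic field: the modes `n - 2`, `n` and `n + 2`. -/
noncomputable def harmonic₁ (M : NanowireModel) (k₁ k₂ k₃ m₁ m₂ m₃ : ℂ) : TwoSidedField where
  inner z := k₁ * polarMode M.r₀ (M.n - 2) z + k₂ * polarMode M.r₀ M.n z
    + k₃ * polarMode M.r₀ (M.n + 2) z
  outer z := m₁ * polarMode M.r₀ (-(M.n - 2)) z + m₂ * polarMode M.r₀ (-M.n) z
    + m₃ * polarMode M.r₀ (-(M.n + 2)) z

theorem harmonicAt_mul_polarMode_of_nonneg (r : ℝ) {p : ℤ} (hp : 0 ≤ p) (c z : ℂ) :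
    HarmonicAt (fun w => c * polarMode r p w) z :=
  (harmonicAt_polarMode_of_nonneg r hp z).comp_CLM (c • ContinuousLinearMap.id ℝ ℂ)

theorem harmonicAt_mul_polarMode_of_ne {r : ℝ} (p : ℤ) (c : ℂ) {z : ℂ} (hr : r ≠ 0) (hz : z ≠ 0) :
    HarmonicAt (fun w => c * polarMode r p w) z :=
  (harmonicAt_polarMode_of_ne p hr hz).comp_CLM (c • ContinuousLinearMap.id ℝ ℂ)

theorem harmonicAt_const (c z : ℂ) : HarmonicAt (fun _ : ℂ => c) z :=
  AnalyticAt.harmonicAt analyticAt_const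

section

variable {M : NanowireModel}

theorem ne_zero_of_le_norm {r : ℝ} (hr : 0 < r) {z : ℂ} (hz : r ≤ ‖z‖) : z ≠ 0 :=
  norm_pos_iff.1 (hr.trans_le hz)

theorem harmonic_fundamental₀ (hr₀ : 0 < M.r₀) (a : ℂ) : (M.fundamental₀ a).Harmonic M.r₀ :=
  ⟨fun z _ => harmonicAt_mul_polarMode_of_nonneg _ (by norm_num) _ z, fun _ hz =>
    (harmonicAt_mul_polarMode_of_ne _ _ hr₀.ne' (ne_zero_of_le_norm hr₀ hz)).add
      (harmonicAt_mul_polarMode_of_ne _ _ hr₀.ne' (ne_zero_of_le_norm hr₀ hz))⟩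

theorem harmonic_fundamental₁ (hr₀ : 0 < M.r₀) (hn : 3 ≤ M.n) (e a b : ℂ) :
    (M.fundamental₁ e a b).Harmonic M.r₀ :=
  ⟨fun z _ => harmonicAt_mul_polarMode_of_nonneg _ (by omega) _ z, fun _ hz =>
    (harmonicAt_mul_polarMode_of_ne _ _ hr₀.ne' (ne_zero_of_le_norm hr₀ hz)).add
      (harmonicAt_mul_polarMode_of_ne _ _ hr₀.ne' (ne_zero_of_le_norm hr₀ hz))⟩

theorem harmonic_harmonic₀ (hr₀ : 0 < M.r₀) (κ α β : ℂ) : (M.harmonic₀ κ α β).Harmonic M.r₀ :=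
  ⟨fun z _ => (harmonicAt_const κ z).add
      (harmonicAt_mul_polarMode_of_nonneg _ (by norm_num) _ z), fun _ hz =>
    harmonicAt_mul_polarMode_of_ne _ _ hr₀.ne' (ne_zero_of_le_norm hr₀ hz)⟩

theorem harmonic_harmonic₁ (hr₀ : 0 < M.r₀) (hn : 3 ≤ M.n) (k₁ k₂ k₃ m₁ m₂ m₃ : ℂ) :
    (M.harmonic₁ k₁ k₂ k₃ m₁ m₂ m₃).Harmonic M.r₀ :=
  ⟨fun z _ => ((harmonicAt_mul_polarMode_of_nonneg _ (by omega) _ z).add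
      (harmonicAt_mul_polarMode_of_nonneg _ (by omega) _ z)).add
      (harmonicAt_mul_polarMode_of_nonneg _ (by omega) _ z), fun _ hz =>
    ((harmonicAt_mul_polarMode_of_ne _ _ hr₀.ne' (ne_zero_of_le_norm hr₀ hz)).add
      (harmonicAt_mul_polarMode_of_ne _ _ hr₀.ne' (ne_zero_of_le_norm hr₀ hz))).add
      (harmonicAt_mul_polarMode_of_ne _ _ hr₀.ne' (ne_zero_of_le_norm hr₀ hz))⟩

theorem infinity_fundamental₀ (hr₀ : 0 < M.r₀) (a : ℂ) :
    (fun z => (M.fundamental₀ a).outer z - M.background z) =O[cobounded ℂ] (fun z => ‖z‖⁻¹) := by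
  have h : (fun z => (M.fundamental₀ a).outer z - M.background z) =
      fun z => M.r₀ * (a + M.E) * polarMode M.r₀ (-1) z := by
    have hr : (M.r₀ : ℂ) ≠ 0 := by exact_mod_cast hr₀.ne'
    funext z
    simp only [fundamental₀, background, polarMode, zpow_one, Complex.div_ofReal_re]
    push_cast
    field_simp
    ring
  rw [h]
  exact (isBigO_polarMode hr₀ (by norm_num)).const_mul_left _

theorem infinity_fundamental₁ (hr₀ : 0 < M.r₀) (hn : 3 ≤ M.n) (e a b : ℂ) :
    (M.fundamental₁ e a b).outer =O[cobounded ℂ] (fun z => ‖z‖⁻¹) :=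
  ((isBigO_polarMode hr₀ (by omega)).const_mul_left _).add
    ((isBigO_polarMode hr₀ (by omega)).const_mul_left _)

theorem tendsto_mul_polarMode {r : ℝ} (hr : 0 < r) {p : ℤ} (hp : p ≤ -1) (c : ℂ) :
    Tendsto (fun z => c * polarMode r p z) (cobounded ℂ) (𝓝 0) := by
  simpa using (tendsto_polarMode hr hp).const_mul c

theorem infinity_harmonic₀ (hr₀ : 0 < M.r₀) (κ α β : ℂ) :
    Tendsto (M.harmonic₀ κ α β).outer (cobounded ℂ) (𝓝 0) :=
  tendsto_mul_polarMode hr₀ (by norm_num) β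

theorem infinity_harmonic₁ (hr₀ : 0 < M.r₀) (hn : 3 ≤ M.n) (k₁ k₂ k₃ m₁ m₂ m₃ : ℂ) :
    Tendsto (M.harmonic₁ k₁ k₂ k₃ m₁ m₂ m₃).outer (cobounded ℂ) (𝓝 0) := by
  have := ((tendsto_mul_polarMode hr₀ (p := -(M.n - 2)) (by omega) m₁).add
    (tendsto_mul_polarMode hr₀ (p := -M.n) (by omega) m₂)).add
    (tendsto_mul_polarMode hr₀ (p := -(M.n + 2)) (by omega) m₃)
  rw [add_zero, add_zero] at this
  exact this

/-- The unnormalized normal derivative of the inner fundamental field, divided by `r₀`. -/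
noncomputable def innerNormal (n : ℤ) (a b : ℂ) (ε θ : ℝ) : ℂ :=
  a * modeNormal n 1 ε θ + ε * (b * modeNormal n (n - 1) ε θ)

/-- The unnormalized tangential derivative of the inner fundamental field, divided by `r₀`. -/
noncomputable def innerTangent (n : ℤ) (a b : ℂ) (ε θ : ℝ) : ℂ :=
  a * modeTangent n 1 ε θ + ε * (b * modeTangent n (n - 1) ε θ)

theorem hasBoundaryDerivs_fundamental_inner (hr₀ : 0 < M.r₀) (e a b : ℂ) {ε θ : ℝ}
    (hs : stretch M.n ε θ ≠ 0) :
    M.HasBoundaryDerivs ((M.fundamental₀ a).expand (M.fundamental₁ e a b) ε).inner ε θ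
      (M.r₀ * innerNormal M.n a b ε θ) (M.r₀ * innerTangent M.n a b ε θ) := by
  have h := ((M.hasBoundaryDerivs_polarMode hr₀ 1 hs).const_mul (M.r₀ * a)).add
    (((M.hasBoundaryDerivs_polarMode hr₀ (M.n - 1) hs).const_mul (M.r₀ * b)).const_mul (ε : ℂ))
  convert h using 1
  · rfl
  · rw [innerNormal]; ring
  · rw [innerTangent]; ring

theorem eventually_stretch_ne_zero (n : ℕ) :
    ∀ᶠ ε : ℝ in 𝓝[>] 0, ∀ θ : ℝ, stretch n ε θ ≠ 0 := by
  filter_upwards [eventually_small (δ := 1 / 2) (by norm_num)] with ε hε θ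
  exact stretch_ne_zero n hε.1.le hε.2 θ

theorem eventually_speed_inv_le (hr₀ : 0 < M.r₀) :
    ∀ᶠ ε : ℝ in 𝓝[>] 0, ∀ θ : ℝ, ‖((M.speed ε θ : ℝ) : ℂ)⁻¹‖ ≤ 2 / M.r₀ := by
  filter_upwards [eventually_small (δ := 1 / 2) (by norm_num)] with ε hε θ
  have h := M.half_le_speed hε.1.le hε.2 θ
  rw [norm_inv, Complex.norm_real, Real.norm_eq_abs,
    abs_of_nonneg (show 0 ≤ M.speed ε θ from norm_nonneg _)]
  calc (M.speed ε θ)⁻¹ ≤ (M.r₀ / 2)⁻¹ := inv_anti₀ (by positivity) h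
    _ = 2 / M.r₀ := inv_div _ _

/-- Continuity of the fundamental field across `∂Ω_ε` up to `O(ε²)`. The hypothesis is the order `0`
flux condition: it enters the order `1` jump because the traces are taken on the perturbed curve. -/
theorem jump_fundamental (hr₀ : 0 < M.r₀) {e a b : ℂ} (ha : a * (1 + e) = -2 * M.E) :
    IsSecondOrder fun ε θ =>
      ((M.fundamental₀ a).expand (M.fundamental₁ e a b) ε).outer (M.curve ε θ)
        - ((M.fundamental₀ a).expand (M.fundamental₁ e a b) ε).inner (M.curve ε θ) := by
  have V := firstOrder_modeTrace M.n
  have h := ((((V 1).const_mul (-(M.E * M.r₀) : ℂ)).add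
      ((V (-1)).const_mul (M.r₀ * (a + M.E)))).add
    ((((V (-(M.n - 1))).const_mul (M.r₀ * (b - a * (e - 1) / 2))).add
      ((V (-(M.n + 1))).const_mul (M.r₀ * (-(a * (e - 1) / 2))))).eps_mul)).sub
    (((V 1).const_mul (M.r₀ * a)).add ((V (M.n - 1)).const_mul (M.r₀ * b)).eps_mul)
  -- the orders `0` and `1` of the expansion, then its identification with the jump
  refine (h.isSecondOrder (fun θ => ?_) fun θ => ?_).congr (Eventually.of_forall fun ε θ => ?_)
  · simp only [cosC_neg]; ring
  · simp only [cosC_neg, cosC_sub, cosC_add]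
    push_cast
    linear_combination (-(M.r₀ : ℂ) * cosC M.n θ * cosC 1 θ) * ha
  · simp only [TwoSidedField.expand, fundamental₀, fundamental₁, polarMode_curve M hr₀]

theorem flux_fundamental (hr₀ : 0 < M.r₀) {e a b : ℂ} (ha : a * (1 + e) = -2 * M.E)
    (hb : b * (1 + e) = a * (e - 1)) :
    IsSecondOrder fun ε θ =>
      M.dNormal ((M.fundamental₀ a).expand (M.fundamental₁ e a b) ε).outer ε θ
        - e * M.dNormal ((M.fundamental₀ a).expand (M.fundamental₁ e a b) ε).inner ε θ := by
  have N := firstOrder_modeNormal M.n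
  have h := ((((N 1).const_mul (-(M.E * M.r₀) : ℂ)).add
      ((N (-1)).const_mul (M.r₀ * (a + M.E)))).add
    ((((N (-(M.n - 1))).const_mul (M.r₀ * (b - a * (e - 1) / 2))).add
      ((N (-(M.n + 1))).const_mul (M.r₀ * (-(a * (e - 1) / 2))))).eps_mul)).sub
    ((((N 1).const_mul a).add ((N (M.n - 1)).const_mul b).eps_mul).const_mul (e * M.r₀))
  refine ((h.isSecondOrder (fun θ => ?_) fun θ => ?_).mul_bounded
    (eventually_speed_inv_le hr₀)).congr ?_
  · simp only [cosC_neg]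
    push_cast
    linear_combination (-(M.r₀ : ℂ) * cosC 1 θ) * ha
  · simp only [cosC_neg, sinC_neg, cosC_sub, cosC_add]
    push_cast
    linear_combination -(M.r₀ * (M.n - 1) * (cosC M.n θ * cosC 1 θ + sinC M.n θ * sinC 1 θ)) * hb
  · filter_upwards [eventually_stretch_ne_zero M.n] with ε hs θ
    have P := fun p => M.hasBoundaryDerivs_polarMode hr₀ p (hs θ)
    have ho : M.HasBoundaryDerivs
        ((M.fundamental₀ a).expand (M.fundamental₁ e a b) ε).outer ε θ _ _ :=
      (((P 1).const_mul (-(M.E * M.r₀) : ℂ)).add ((P (-1)).const_mul (M.r₀ * (a + M.E)))).add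
      ((((P (-(M.n - 1))).const_mul (M.r₀ * (b - a * (e - 1) / 2))).add
        ((P (-(M.n + 1))).const_mul (M.r₀ * (-(a * (e - 1) / 2))))).const_mul (ε : ℂ))
    rw [ho.dNormal_eq, (hasBoundaryDerivs_fundamental_inner hr₀ e a b (hs θ)).dNormal_eq,
      innerNormal]
    ring

theorem firstOrder_innerNormal (n : ℤ) (a b : ℂ) :
    FirstOrder (innerNormal n a b) (fun θ => a * cosC 1 θ)
      (fun θ => a * (cosC n θ * cosC 1 θ - n * sinC n θ * sinC 1 θ)
        + b * (n - 1) * cosC (n - 1) θ) :=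
  (((firstOrder_modeNormal n 1).const_mul a).add
    ((firstOrder_modeNormal n (n - 1)).const_mul b).eps_mul).congr
    (fun θ => by push_cast; ring) fun θ => by push_cast; ring

theorem firstOrder_innerTangent (n : ℤ) (a b : ℂ) :
    FirstOrder (innerTangent n a b) (fun θ => -(a * sinC 1 θ))
      (fun θ => -(a * (cosC n θ * sinC 1 θ + n * sinC n θ * cosC 1 θ)
        + b * (n - 1) * sinC (n - 1) θ)) :=
  (((firstOrder_modeTangent n 1).const_mul a).add
    ((firstOrder_modeTangent n (n - 1)).const_mul b).eps_mul).congr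
    (fun θ => by push_cast; ring) fun θ => by push_cast; ring

end

end NanowireModel

namespace NanowireModel

/-- The angular derivative of `innerNormal`. -/
noncomputable def innerNormalDeriv (n : ℤ) (a b : ℂ) (ε θ : ℝ) : ℂ :=
  a * modeNormalDeriv n 1 ε θ + ε * (b * modeNormalDeriv n (n - 1) ε θ)

/-- The angular derivative of `innerTangent`. -/
noncomputable def innerTangentDeriv (n : ℤ) (a b : ℂ) (ε θ : ℝ) : ℂ :=
  a * modeTangentDeriv n 1 ε θ + ε * (b * modeTangentDeriv n (n - 1) ε θ)

theorem firstOrder_innerNormalDeriv (n : ℤ) (a b : ℂ) :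
    FirstOrder (innerNormalDeriv n a b) (fun θ => -(a * sinC 1 θ))
      (fun θ => -(a * ((1 + n * n) * cosC n θ * sinC 1 θ + 2 * n * sinC n θ * cosC 1 θ)
        + b * (n - 1) ^ 2 * sinC (n - 1) θ)) :=
  (((firstOrder_modeNormalDeriv n 1).const_mul a).add
    ((firstOrder_modeNormalDeriv n (n - 1)).const_mul b).eps_mul).congr
    (fun θ => by push_cast; ring) fun θ => by push_cast; ring

theorem firstOrder_innerTangentDeriv (n : ℤ) (a b : ℂ) :
    FirstOrder (innerTangentDeriv n a b) (fun θ => -(a * cosC 1 θ))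
      (fun θ => -(a * ((1 + n * n) * cosC n θ * cosC 1 θ - 2 * n * sinC n θ * sinC 1 θ)
        + b * (n - 1) ^ 2 * cosC (n - 1) θ)) :=
  (((firstOrder_modeTangentDeriv n 1).const_mul a).add
    ((firstOrder_modeTangentDeriv n (n - 1)).const_mul b).eps_mul).congr
    (fun θ => by push_cast; ring) fun θ => by push_cast; ring

theorem hasDerivAt_innerNormal (n : ℤ) (a b : ℂ) {ε θ : ℝ} (h : stretch n ε θ ≠ 0) :
    HasDerivAt (innerNormal n a b ε) (innerNormalDeriv n a b ε θ) θ :=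
  ((hasDerivAt_modeNormal n 1 h).const_mul a).add
    (((hasDerivAt_modeNormal n (n - 1) h).const_mul b).const_mul (ε : ℂ))

theorem hasDerivAt_innerTangent (n : ℤ) (a b : ℂ) {ε θ : ℝ} (h : stretch n ε θ ≠ 0) :
    HasDerivAt (innerTangent n a b ε) (innerTangentDeriv n a b ε θ) θ :=
  ((hasDerivAt_modeTangent n 1 h).const_mul a).add
    (((hasDerivAt_modeTangent n (n - 1) h).const_mul b).const_mul (ε : ℂ))

variable {M : NanowireModel}

theorem Pperp_fundamental (hr₀ : 0 < M.r₀) (e a b : ℂ) {ε θ : ℝ} (hs : stretch M.n ε θ ≠ 0) :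
    M.Pperp e ((M.fundamental₀ a).expand (M.fundamental₁ e a b) ε) ε θ =
      M.χperp * e ^ 2 * innerNormal M.n a b ε θ ^ 2 * (speedRatioSq M.n ε θ)⁻¹ := by
  have hr : (M.r₀ : ℂ) ≠ 0 := by exact_mod_cast hr₀.ne'
  rw [Pperp, (hasBoundaryDerivs_fundamental_inner hr₀ e a b hs).dNormal_eq, mul_pow, div_pow,
    speed_sq_eq, mul_pow, mul_div_mul_left _ _ (pow_ne_zero 2 hr)]
  ring

theorem Ppar_fundamental (hr₀ : 0 < M.r₀) (e a b : ℂ) {ε θ : ℝ} (hs : stretch M.n ε θ ≠ 0) :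
    M.Ppar e ((M.fundamental₀ a).expand (M.fundamental₁ e a b) ε) ε θ =
      2 * M.χpar * e * (innerNormal M.n a b ε θ * innerTangent M.n a b ε θ
        * (speedRatioSq M.n ε θ)⁻¹) := by
  have hr : (M.r₀ : ℂ) ≠ 0 := by exact_mod_cast hr₀.ne'
  have h := hasBoundaryDerivs_fundamental_inner hr₀ e a b hs
  have hS := M.speed_sq_eq ε θ
  rw [Ppar, h.dNormal_eq, h.dTangent_eq]
  calc _ = 2 * M.χpar * e * ((M.r₀ ^ 2 * (innerNormal M.n a b ε θ * innerTangent M.n a b ε θ))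
        / (M.speed ε θ : ℂ) ^ 2) := by ring
    _ = _ := by rw [hS, mul_div_mul_left _ _ (pow_ne_zero 2 hr)]; ring

theorem jump_harmonic (hr₀ : 0 < M.r₀) {e a b κ α β k₁ k₂ k₃ m₁ m₂ m₃ : ℂ}
    (hκ : κ = -(2 * Real.pi * M.χperp * e ^ 2 * a ^ 2))
    (hαβ : β - α = 2 * Real.pi * M.χperp * e ^ 2 * a ^ 2)
    (h₁ : m₁ - k₁ = α + β
      + 4 * Real.pi * M.χperp * e ^ 2 * ((M.n - 1) * (a * b) - M.n / 2 * a ^ 2))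
    (h₂ : m₂ - k₂ = 4 * Real.pi * M.χperp * e ^ 2 * ((M.n - 1) * (a * b)))
    (h₃ : m₃ - k₃ = α + β + 2 * Real.pi * M.χperp * e ^ 2 * M.n * a ^ 2) :
    IsSecondOrder fun ε θ =>
      ((M.harmonic₀ κ α β).expand (M.harmonic₁ k₁ k₂ k₃ m₁ m₂ m₃) ε).outer (M.curve ε θ)
        - ((M.harmonic₀ κ α β).expand (M.harmonic₁ k₁ k₂ k₃ m₁ m₂ m₃) ε).inner (M.curve ε θ)
        - 4 * (Real.pi : ℂ)
          * M.Pperp e ((M.fundamental₀ a).expand (M.fundamental₁ e a b) ε) ε θ := by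
  have V := firstOrder_modeTrace M.n
  have X := firstOrder_innerNormal M.n a b
  -- the jump condition multiplied by `speedRatioSq`, which clears the only denominator of `P_⊥`
  have h := ((((V (-2)).const_mul β).add
      ((((V (-(M.n - 2))).const_mul m₁).add ((V (-M.n)).const_mul m₂)).add
        ((V (-(M.n + 2))).const_mul m₃)).eps_mul).sub
      (((FirstOrder.const κ).add ((V 2).const_mul α)).add
      ((((V (M.n - 2)).const_mul k₁).add ((V M.n).const_mul k₂)).add
        ((V (M.n + 2)).const_mul k₃)).eps_mul)).mul (firstOrder_speedRatioSq M.n)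
    |>.sub ((X.mul X).const_mul (4 * Real.pi * M.χperp * e ^ 2))
  obtain ⟨B, -, hB⟩ := (firstOrder_speedRatioSqInv M.n).eventually_bounded
  refine ((h.isSecondOrder (fun θ => ?_) fun θ => ?_).mul_bounded hB).congr ?_
  · have hxy := cosC_sq_add_sinC_sq 1 θ
    simp only [cosC_neg, cosC_two]
    linear_combination (cosC 1 θ ^ 2 - sinC 1 θ ^ 2) * hαβ - hκ
      - (2 * Real.pi * M.χperp * e ^ 2 * a ^ 2) * hxy
  · have hxy := cosC_sq_add_sinC_sq 1 θ
    simp only [cosC_neg, cosC_sub, cosC_add, cosC_two, sinC_two]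
    push_cast
    linear_combination
      (cosC M.n θ * (cosC 1 θ ^ 2 - sinC 1 θ ^ 2) + sinC M.n θ * (2 * sinC 1 θ * cosC 1 θ)) * h₁
      + cosC M.n θ * h₂
      + (cosC M.n θ * (cosC 1 θ ^ 2 - sinC 1 θ ^ 2) - sinC M.n θ * (2 * sinC 1 θ * cosC 1 θ)) * h₃
      + (2 * cosC M.n θ * (cosC 1 θ ^ 2 - sinC 1 θ ^ 2)) * hαβ - (2 * cosC M.n θ) * hκ
      - (4 * Real.pi * M.χperp * e ^ 2 * cosC M.n θ * ((M.n - 1) * (a * b) + a ^ 2)) * hxy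
  · filter_upwards [eventually_stretch_ne_zero M.n,
      (firstOrder_speedRatioSq M.n).eventually_half_le_norm] with ε hs hσ θ
    have hσ0 : speedRatioSq M.n ε θ ≠ 0 := norm_pos_iff.1 (by linarith [hσ θ])
    rw [Pperp_fundamental hr₀ e a b (hs θ)]
    simp only [TwoSidedField.expand, harmonic₀, harmonic₁, polarMode_curve M hr₀]
    field_simp

theorem flux_harmonic (hr₀ : 0 < M.r₀) {e f a b κ α β k₁ k₂ k₃ m₁ m₂ m₃ : ℂ}
    (hαβ : β + f * α = 4 * Real.pi * M.χpar * e * a ^ 2)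
    (h₁ : m₁ + f * k₁ = -(β - f * α) + 4 * Real.pi * M.χpar * e * M.n * a ^ 2)
    (h₂ : m₂ + f * k₂ = 8 * Real.pi * M.χpar * e * ((M.n - 1) * (a * b)))
    (h₃ : m₃ + f * k₃ = β - f * α + 4 * Real.pi * M.χpar * e * M.n * a ^ 2) :
    IsSecondOrder fun ε θ =>
      M.dNormal ((M.harmonic₀ κ α β).expand (M.harmonic₁ k₁ k₂ k₃ m₁ m₂ m₃) ε).outer ε θ
        - f * M.dNormal ((M.harmonic₀ κ α β).expand (M.harmonic₁ k₁ k₂ k₃ m₁ m₂ m₃) ε).inner ε θ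
        + 4 * (Real.pi : ℂ)
          * M.surfaceCharge e ((M.fundamental₀ a).expand (M.fundamental₁ e a b) ε) ε θ := by
  have N := firstOrder_modeNormal M.n
  have X := firstOrder_innerNormal M.n a b
  have Y := firstOrder_innerTangent M.n a b
  have X' := firstOrder_innerNormalDeriv M.n a b
  have Y' := firstOrder_innerTangentDeriv M.n a b
  -- the flux condition multiplied by the speed; `P_∥` contains only the square of the speed
  have h := ((((N (-2)).const_mul β).add
      ((((N (-(M.n - 2))).const_mul m₁).add ((N (-M.n)).const_mul m₂)).add
        ((N (-(M.n + 2))).const_mul m₃)).eps_mul).sub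
      ((((N 2).const_mul α).add
      ((((N (M.n - 2)).const_mul k₁).add ((N M.n).const_mul k₂)).add
        ((N (M.n + 2)).const_mul k₃)).eps_mul).const_mul f))
    |>.sub (((((X'.mul Y).add (X.mul Y')).mul (firstOrder_speedRatioSqInv M.n)).add
      ((X.mul Y).mul (firstOrder_speedRatioSqInvDeriv M.n))).const_mul
        (8 * Real.pi * M.χpar * e))
  refine ((h.isSecondOrder (fun θ => ?_) fun θ => ?_).mul_bounded
    (eventually_speed_inv_le hr₀)).congr ?_
  · simp only [cosC_neg, cosC_two]
    push_cast
    linear_combination (-2 * (cosC 1 θ ^ 2 - sinC 1 θ ^ 2)) * hαβ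
  · have hxy := cosC_sq_add_sinC_sq 1 θ
    simp only [cosC_neg, sinC_neg, cosC_sub, cosC_add, sinC_sub, cosC_two, sinC_two]
    push_cast
    linear_combination
      (-(M.n - 2) * (cosC M.n θ * (cosC 1 θ ^ 2 - sinC 1 θ ^ 2)
        + sinC M.n θ * (2 * sinC 1 θ * cosC 1 θ))) * h₁
      - (M.n * cosC M.n θ) * h₂
      - ((M.n + 2) * (cosC M.n θ * (cosC 1 θ ^ 2 - sinC 1 θ ^ 2)
        - sinC M.n θ * (2 * sinC 1 θ * cosC 1 θ))) * h₃
      + (8 * Real.pi * M.χpar * e * M.n * (M.n - 1) * (a * b) * cosC M.n θ) * hxy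
  · filter_upwards [eventually_stretch_ne_zero M.n,
      (firstOrder_speedRatioSq M.n).eventually_half_le_norm] with ε hs hσ θ
    have hσ0 : speedRatioSq M.n ε θ ≠ 0 := norm_pos_iff.1 (by linarith [hσ θ])
    have P := fun p => M.hasBoundaryDerivs_polarMode hr₀ p (hs θ)
    have ho : M.HasBoundaryDerivs
        ((M.harmonic₀ κ α β).expand (M.harmonic₁ k₁ k₂ k₃ m₁ m₂ m₃) ε).outer ε θ _ _ :=
      ((P (-2)).const_mul β).add
        (((((P (-(M.n - 2))).const_mul m₁).add ((P (-M.n)).const_mul m₂)).add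
          ((P (-(M.n + 2))).const_mul m₃)).const_mul (ε : ℂ))
    have hi : M.HasBoundaryDerivs
        ((M.harmonic₀ κ α β).expand (M.harmonic₁ k₁ k₂ k₃ m₁ m₂ m₃) ε).inner ε θ _ _ :=
      ((M.hasBoundaryDerivs_const κ ε θ).add ((P 2).const_mul α)).add
        (((((P (M.n - 2)).const_mul k₁).add ((P M.n).const_mul k₂)).add
          ((P (M.n + 2)).const_mul k₃)).const_mul (ε : ℂ))
    have hP : (fun t => M.Ppar e ((M.fundamental₀ a).expand (M.fundamental₁ e a b) ε) ε t) =
        fun t => 2 * M.χpar * e * (innerNormal M.n a b ε t * innerTangent M.n a b ε t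
          * (speedRatioSq M.n ε t)⁻¹) :=
      funext fun t => Ppar_fundamental hr₀ e a b (hs t)
    have hd := ((((hasDerivAt_innerNormal M.n a b (hs θ)).mul
      (hasDerivAt_innerTangent M.n a b (hs θ))).mul
      (hasDerivAt_speedRatioSqInv M.n hσ0)).const_mul (2 * M.χpar * e)).deriv
    rw [ho.dNormal_eq, hi.dNormal_eq, surfaceCharge, hP]
    refine Eq.trans ?_ (congrArg (fun d => _ + 4 * (Real.pi : ℂ) * -(d / (M.speed ε θ : ℂ)))
      hd.symm)
    simp only [Pi.mul_apply]
    ring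

/-- Every choice of coefficients that solves the order `0` and order `1` transmission conditions
mode by mode gives a field expansion. -/
theorem isFieldExpansion_of_coefficients (hr₀ : 0 < M.r₀) (hn : 3 ≤ M.n)
    {e f a b κ α β k₁ k₂ k₃ m₁ m₂ m₃ : ℂ}
    (ha : a * (1 + e) = -2 * M.E) (hb : b * (1 + e) = a * (e - 1))
    (hκ : κ = -(2 * Real.pi * M.χperp * e ^ 2 * a ^ 2))
    (hj₀ : β - α = 2 * Real.pi * M.χperp * e ^ 2 * a ^ 2)
    (hj₁ : m₁ - k₁ = α + β
      + 4 * Real.pi * M.χperp * e ^ 2 * ((M.n - 1) * (a * b) - M.n / 2 * a ^ 2))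
    (hj₂ : m₂ - k₂ = 4 * Real.pi * M.χperp * e ^ 2 * ((M.n - 1) * (a * b)))
    (hj₃ : m₃ - k₃ = α + β + 2 * Real.pi * M.χperp * e ^ 2 * M.n * a ^ 2)
    (hf₀ : β + f * α = 4 * Real.pi * M.χpar * e * a ^ 2)
    (hf₁ : m₁ + f * k₁ = -(β - f * α) + 4 * Real.pi * M.χpar * e * M.n * a ^ 2)
    (hf₂ : m₂ + f * k₂ = 8 * Real.pi * M.χpar * e * ((M.n - 1) * (a * b)))
    (hf₃ : m₃ + f * k₃ = β - f * α + 4 * Real.pi * M.χpar * e * M.n * a ^ 2) :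
    M.IsFieldExpansion e f (M.fundamental₀ a) (M.fundamental₁ e a b) (M.harmonic₀ κ α β)
      (M.harmonic₁ k₁ k₂ k₃ m₁ m₂ m₃) where
  harmonic_u₀ := harmonic_fundamental₀ hr₀ a
  harmonic_u₁ := harmonic_fundamental₁ hr₀ hn e a b
  harmonic_U₀ := harmonic_harmonic₀ hr₀ κ α β
  harmonic_U₁ := harmonic_harmonic₁ hr₀ hn k₁ k₂ k₃ m₁ m₂ m₃
  infinity_u₀ := infinity_fundamental₀ hr₀ a
  infinity_u₁ := infinity_fundamental₁ hr₀ hn e a b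
  infinity_U₀ := infinity_harmonic₀ hr₀ κ α β
  infinity_U₁ := infinity_harmonic₁ hr₀ hn k₁ k₂ k₃ m₁ m₂ m₃
  jump_u := jump_fundamental hr₀ ha
  flux_u := flux_fundamental hr₀ ha hb
  jump_U := jump_harmonic hr₀ hκ hj₀ hj₁ hj₂ hj₃
  flux_U := flux_harmonic hr₀ hf₀ hf₁ hf₂ hf₃

end NanowireModel

/-! ### Explicit coefficients of the second-harmonic field -/

namespace NanowireModel

/-- The amplitude of the leading fundamental field inside the particle. -/
noncomputable def innerAmp (M : NanowireModel) (e : ℂ) : ℂ := -2 * M.E / (1 + e)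

/-- The amplitude of the first-order fundamental field inside the particle. -/
noncomputable def innerAmp₁ (M : NanowireModel) (e : ℂ) : ℂ := M.innerAmp e * (e - 1) / (1 + e)

/-- The constant part of the leading second-harmonic field inside the particle. -/
noncomputable def constCoeff (M : NanowireModel) (e : ℂ) : ℂ :=
  -(M.χperp * e ^ 2 * (8 * (Real.pi : ℂ) * (M.E : ℂ) ^ 2 / (1 + e) ^ 2))

/-- The coefficient of the mode `2` of the leading second-harmonic field inside the particle. -/
noncomputable def innerCoeff (M : NanowireModel) (e f : ℂ) : ℂ :=
  -((M.χperp * e ^ 2 - 2 * M.χpar * e) * M.prefactor e f)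

/-- The coefficient of the mode `2` of the leading second-harmonic field outside the particle. -/
noncomputable def outerCoeff (M : NanowireModel) (e f : ℂ) : ℂ :=
  (M.χperp * e ^ 2 * f + 2 * M.χpar * e) * M.prefactor e f

/-- The part of the numerator of `M_{n-2}` that is resonant at the double frequency. -/
noncomputable def doubleResidue (M : NanowireModel) (e f : ℂ) : ℂ :=
  (f - 3) * (M.χperp * e ^ 2 * f) + 2 * (((M.n : ℂ) - 1) + ((M.n : ℂ) + 3) * f) * (M.χpar * e)

/-- The part of the numerator of `M_{n-2}` that is resonant at the fundamental frequency. -/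
noncomputable def fundamentalResidue (M : NanowireModel) (e f : ℂ) : ℂ :=
  (((M.n : ℂ) - 2) * e - (3 * (M.n : ℂ) - 2)) * (M.χperp * e ^ 2 * f)

/-- The coefficient `M_{n-2}` normalized by `r₀ ^ (n - 2)`. -/
noncomputable def outerMinus (M : NanowireModel) (e f : ℂ) : ℂ :=
  M.prefactor e f * (M.doubleResidue e f / (1 + f) + M.fundamentalResidue e f / (1 + e))

/-- The coefficient `M_n` normalized by `r₀ ^ n`. -/
noncomputable def outerMid (M : NanowireModel) (e f : ℂ) : ℂ :=
  2 * M.prefactor e f *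
    ((e - 1) / (1 + e) * ((M.n : ℂ) - 1) * (M.χperp * e ^ 2 * f + 2 * M.χpar * e))

/-- The coefficient `M_{n+2}` normalized by `r₀ ^ (n + 2)`. -/
noncomputable def outerPlus (M : NanowireModel) (e f : ℂ) : ℂ :=
  M.prefactor e f * ((M.n : ℂ) + 1) * (M.χperp * e ^ 2 * f + 2 * M.χpar * e)

/-- The coefficient of the mode `n - 2` of the first-order second-harmonic field inside, obtained
from the outer one through the jump condition at order `1`. -/
noncomputable def innerMinus (M : NanowireModel) (e f : ℂ) : ℂ :=
  M.outerMinus e f - (M.innerCoeff e f + M.outerCoeff e f + 4 * Real.pi * M.χperp * e ^ 2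
    * ((M.n - 1) * (M.innerAmp e * M.innerAmp₁ e) - M.n / 2 * M.innerAmp e ^ 2))

/-- The coefficient of the mode `n` of the first-order second-harmonic field inside, obtained from
the outer one through the jump condition at order `1`. -/
noncomputable def innerMid (M : NanowireModel) (e f : ℂ) : ℂ :=
  M.outerMid e f - 4 * Real.pi * M.χperp * e ^ 2 * ((M.n - 1) * (M.innerAmp e * M.innerAmp₁ e))

/-- The coefficient of the mode `n + 2` of the first-order second-harmonic field inside, obtained
from the outer one through the jump condition at order `1`. -/
noncomputable def innerPlus (M : NanowireModel) (e f : ℂ) : ℂ :=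
  M.outerPlus e f - (M.innerCoeff e f + M.outerCoeff e f
    + 2 * Real.pi * M.χperp * e ^ 2 * M.n * M.innerAmp e ^ 2)

/-- The leading second-harmonic field. -/
noncomputable def secondHarmonic₀ (M : NanowireModel) (e f : ℂ) : TwoSidedField :=
  M.harmonic₀ (M.constCoeff e) (M.innerCoeff e f) (M.outerCoeff e f)

/-- The first-order term of the second-harmonic field. -/
noncomputable def secondHarmonic₁ (M : NanowireModel) (e f : ℂ) : TwoSidedField :=
  M.harmonic₁ (M.innerMinus e f) (M.innerMid e f) (M.innerPlus e f)
    (M.outerMinus e f) (M.outerMid e f) (M.outerPlus e f)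

theorem one_add_ne_zero {e : ℂ} (he : e ≠ -1) : 1 + e ≠ 0 := fun h =>
  he (by linear_combination h)

theorem isFieldExpansion_secondHarmonic {M : NanowireModel} (hr₀ : 0 < M.r₀) (hn : 3 ≤ M.n)
    {e f : ℂ} (he : e ≠ -1) (hf : f ≠ -1) :
    M.IsFieldExpansion e f (M.fundamental₀ (M.innerAmp e))
      (M.fundamental₁ e (M.innerAmp e) (M.innerAmp₁ e))
      (M.secondHarmonic₀ e f) (M.secondHarmonic₁ e f) := by
  have h1 := one_add_ne_zero he
  have h2 := one_add_ne_zero hf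
  apply isFieldExpansion_of_coefficients hr₀ hn
  · rw [innerAmp]; field_simp
  · rw [innerAmp₁]; field_simp
  · rw [constCoeff, innerAmp]; field_simp; ring
  · rw [innerCoeff, outerCoeff, prefactor, innerAmp]; field_simp; ring
  · rw [innerMinus]; ring
  · rw [innerMid]; ring
  · rw [innerPlus]; ring
  · rw [innerCoeff, outerCoeff, prefactor, innerAmp]; field_simp; ring
  · rw [innerMinus, outerMinus, innerCoeff, outerCoeff, prefactor, innerAmp₁, innerAmp,
      doubleResidue, fundamentalResidue]
    field_simp
    ring
  · rw [innerMid, outerMid, prefactor, innerAmp₁, innerAmp]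
    field_simp
    ring
  · rw [innerPlus, outerPlus, innerCoeff, outerCoeff, prefactor, innerAmp]
    field_simp
    ring

/-! ### The modes in polar coordinates -/

theorem polarMode_natCast {r : ℝ} (k : ℕ) (z : ℂ) :
    polarMode r k z = (‖z‖ : ℂ) ^ k / (r : ℂ) ^ k * cosMode k z := by
  have h : z / r = ((‖z‖ / r : ℝ) : ℂ) * Complex.exp (z.arg * Complex.I) := by
    conv_lhs => rw [← Complex.norm_mul_exp_arg_mul_I z]
    push_cast
    ring
  rw [polarMode, h, mul_zpow, exp_mul_I_zpow, ← Complex.ofReal_zpow, Complex.re_ofReal_mul,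
    cosMode]
  simp only [Complex.add_re, Complex.mul_re, Complex.ofReal_re, Complex.ofReal_im, Complex.I_re,
    Complex.I_im, Int.cast_natCast, zpow_natCast]
  push_cast
  ring

theorem polarMode_neg_natCast {r : ℝ} (k : ℕ) (z : ℂ) :
    polarMode r (-k) z = (r : ℂ) ^ k / (‖z‖ : ℂ) ^ k * cosMode k z := by
  have h : z / r = ((‖z‖ / r : ℝ) : ℂ) * Complex.exp (z.arg * Complex.I) := by
    conv_lhs => rw [← Complex.norm_mul_exp_arg_mul_I z]
    push_cast
    ring
  rw [polarMode, h, mul_zpow, exp_mul_I_zpow, ← Complex.ofReal_zpow, Complex.re_ofReal_mul,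
    cosMode]
  simp only [Complex.add_re, Complex.mul_re, Complex.ofReal_re, Complex.ofReal_im, Complex.I_re,
    Complex.I_im, Int.cast_natCast, zpow_natCast, zpow_neg, Int.cast_neg, neg_mul, Real.cos_neg]
  push_cast
  rw [← inv_pow, inv_div, div_pow]
  ring

theorem secondHarmonic₀_inner_eq (M : NanowireModel) (e f z : ℂ) :
    (M.secondHarmonic₀ e f).inner z =
      -(M.χperp * e ^ 2 * (8 * (Real.pi : ℂ) * (M.E : ℂ) ^ 2 / (1 + e) ^ 2))
        - (M.χperp * e ^ 2 - 2 * M.χpar * e) * M.prefactor e f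
          * ((‖z‖ : ℂ) ^ 2 / (M.r₀ : ℂ) ^ 2) * cosMode 2 z := by
  have h := polarMode_natCast (r := M.r₀) 2 z
  push_cast at h
  simp only [secondHarmonic₀, harmonic₀, h, constCoeff, innerCoeff]
  ring

theorem secondHarmonic₀_outer_eq (M : NanowireModel) (e f z : ℂ) :
    (M.secondHarmonic₀ e f).outer z =
      (M.χperp * e ^ 2 * f + 2 * M.χpar * e) * M.prefactor e f
        * ((M.r₀ : ℂ) ^ 2 / (‖z‖ : ℂ) ^ 2) * cosMode 2 z := by
  have h := polarMode_neg_natCast (r := M.r₀) 2 z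
  push_cast at h
  simp only [secondHarmonic₀, harmonic₀, h, outerCoeff]
  ring

theorem secondHarmonic₁_outer_eq (M : NanowireModel) (hn : 3 ≤ M.n) (e f z : ℂ) :
    (M.secondHarmonic₁ e f).outer z =
      M.coeffMinus e f / (‖z‖ : ℂ) ^ (M.n - 2) * cosMode (M.n - 2) z
        + M.coeffMid e f / (‖z‖ : ℂ) ^ M.n * cosMode M.n z
        + M.coeffPlus e f / (‖z‖ : ℂ) ^ (M.n + 2) * cosMode (M.n + 2) z := by
  have h1 := polarMode_neg_natCast (r := M.r₀) (M.n - 2) z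
  have h2 := polarMode_neg_natCast (r := M.r₀) M.n z
  have h3 := polarMode_neg_natCast (r := M.r₀) (M.n + 2) z
  rw [Nat.cast_sub (by omega)] at h1
  push_cast at h1 h3
  simp only [secondHarmonic₁, harmonic₁, h1, h2, h3, coeffMinus, coeffMid, coeffPlus, outerMinus,
    outerMid, outerPlus, doubleResidue, fundamentalResidue]
  ring

end NanowireModel

/-! ### Uniform bounds near the resonances -/

/-- Functions of two permittivities of the form
`((1 + e) (1 + f) P + (1 + e) Q + (1 + f) R) / ((1 + e)³ (1 + f)²)` with continuous `P`, `Q`, `R`.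
All coefficients of the second-harmonic field are of this form. -/
def IsResonantCoeff (X : ℂ → ℂ → ℂ) : Prop :=
  ∃ P Q R : ℂ × ℂ → ℂ, Continuous P ∧ Continuous Q ∧ Continuous R ∧
    ∀ e f : ℂ, e ≠ -1 → f ≠ -1 → X e f =
      ((1 + e) * (1 + f) * P (e, f) + (1 + e) * Q (e, f) + (1 + f) * R (e, f))
        / ((1 + e) ^ 3 * (1 + f) ^ 2)

theorem IsResonantCoeff.add {X Y : ℂ → ℂ → ℂ} (hX : IsResonantCoeff X) (hY : IsResonantCoeff Y) :
    IsResonantCoeff fun e f => X e f + Y e f := by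
  obtain ⟨P, Q, R, hP, hQ, hR, h⟩ := hX
  obtain ⟨P', Q', R', hP', hQ', hR', h'⟩ := hY
  refine ⟨P + P', Q + Q', R + R', hP.add hP', hQ.add hQ', hR.add hR', fun e f he hf => ?_⟩
  simp only [h e f he hf, h' e f he hf, Pi.add_apply]
  ring

theorem IsResonantCoeff.sub {X Y : ℂ → ℂ → ℂ} (hX : IsResonantCoeff X) (hY : IsResonantCoeff Y) :
    IsResonantCoeff fun e f => X e f - Y e f := by
  obtain ⟨P, Q, R, hP, hQ, hR, h⟩ := hX
  obtain ⟨P', Q', R', hP', hQ', hR', h'⟩ := hY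
  refine ⟨P - P', Q - Q', R - R', hP.sub hP', hQ.sub hQ', hR.sub hR', fun e f he hf => ?_⟩
  simp only [h e f he hf, h' e f he hf, Pi.sub_apply]
  ring

theorem IsResonantCoeff.congr {X Y : ℂ → ℂ → ℂ} (hX : IsResonantCoeff X)
    (h : ∀ e f, e ≠ -1 → f ≠ -1 → X e f = Y e f) : IsResonantCoeff Y := by
  obtain ⟨P, Q, R, hP, hQ, hR, k⟩ := hX
  exact ⟨P, Q, R, hP, hQ, hR, fun e f he hf => by rw [← h e f he hf, k e f he hf]⟩

/-- The size of the functions satisfying `IsResonantCoeff`. It contains the sizes of all resonances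
in the theorem: `|1 + e|⁻³` for fixed `f`, `|1 + f|⁻²` for fixed `e`, and the sum of the two rates
of the simultaneous resonance. -/
noncomputable def resonanceWeight (e f : ℂ) : ℝ :=
  (‖1 + e‖ * ‖1 + f‖ + ‖1 + e‖ + ‖1 + f‖) / (‖1 + e‖ ^ 3 * ‖1 + f‖ ^ 2)

theorem resonanceWeight_nonneg (e f : ℂ) : 0 ≤ resonanceWeight e f := by
  unfold resonanceWeight; positivity

theorem eventually_norm_le_of_tendsto {ι : Type*} {l : Filter ι} {u : ι → ℂ} {a : ℂ}
    (h : Tendsto u l (𝓝 a)) : ∀ᶠ i in l, ‖u i‖ ≤ ‖a‖ + 1 :=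
  (h.norm.eventually_lt_const (lt_add_one _)).mono fun _ hi => hi.le

theorem IsResonantCoeff.eventually_le {ι : Type*} {l : Filter ι} {e f : ι → ℂ} {e₀ f₀ : ℂ}
    {X : ℂ → ℂ → ℂ} (hX : IsResonantCoeff X) (he : Tendsto e l (𝓝 e₀)) (hf : Tendsto f l (𝓝 f₀))
    (hne : ∀ᶠ i in l, e i ≠ -1 ∧ f i ≠ -1) :
    ∃ C : ℝ, 0 ≤ C ∧ ∀ᶠ i in l, ‖X (e i) (f i)‖ ≤ C * resonanceWeight (e i) (f i) := by
  obtain ⟨P, Q, R, hP, hQ, hR, h⟩ := hX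
  have hef : Tendsto (fun i => (e i, f i)) l (𝓝 (e₀, f₀)) := he.prodMk_nhds hf
  have bP := eventually_norm_le_of_tendsto ((hP.tendsto _).comp hef)
  have bQ := eventually_norm_le_of_tendsto ((hQ.tendsto _).comp hef)
  have bR := eventually_norm_le_of_tendsto ((hR.tendsto _).comp hef)
  set C := (‖P (e₀, f₀)‖ + 1) + (‖Q (e₀, f₀)‖ + 1) + (‖R (e₀, f₀)‖ + 1) with hC
  have nP := norm_nonneg (P (e₀, f₀))
  have nQ := norm_nonneg (Q (e₀, f₀))
  have nR := norm_nonneg (R (e₀, f₀))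
  refine ⟨C, by linarith, ?_⟩
  filter_upwards [hne, bP, bQ, bR] with i hi kP kQ kR
  simp only [Function.comp_apply] at kP kQ kR
  rw [h _ _ hi.1 hi.2, norm_div, norm_mul, norm_pow, norm_pow, resonanceWeight, ← mul_div_assoc]
  gcongr
  calc ‖(1 + e i) * (1 + f i) * P (e i, f i) + (1 + e i) * Q (e i, f i)
        + (1 + f i) * R (e i, f i)‖
      ≤ ‖(1 + e i) * (1 + f i) * P (e i, f i)‖ + ‖(1 + e i) * Q (e i, f i)‖
        + ‖(1 + f i) * R (e i, f i)‖ := norm_add₃_le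
    _ = ‖1 + e i‖ * ‖1 + f i‖ * ‖P (e i, f i)‖ + ‖1 + e i‖ * ‖Q (e i, f i)‖
        + ‖1 + f i‖ * ‖R (e i, f i)‖ := by simp only [norm_mul]
    _ ≤ ‖1 + e i‖ * ‖1 + f i‖ * C + ‖1 + e i‖ * C + ‖1 + f i‖ * C := by
        gcongr <;> linarith
    _ = C * (‖1 + e i‖ * ‖1 + f i‖ + ‖1 + e i‖ + ‖1 + f i‖) := by ring

namespace NanowireModel

theorem isResonantCoeff_prefactor_mul (M : NanowireModel) {g : ℂ × ℂ → ℂ} (hg : Continuous g) :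
    IsResonantCoeff fun e f => M.prefactor e f * g (e, f) := by
  refine ⟨fun p => 8 * (Real.pi : ℂ) * (M.E : ℂ) ^ 2 * g p, fun _ => 0, fun _ => 0, by fun_prop,
    by fun_prop, by fun_prop, fun e f he hf => ?_⟩
  have h1 := one_add_ne_zero he
  have h2 := one_add_ne_zero hf
  simp only [prefactor]
  field_simp
  ring

theorem isResonantCoeff_prefactor_mul_div_double (M : NanowireModel) {g : ℂ × ℂ → ℂ}
    (hg : Continuous g) :
    IsResonantCoeff fun e f => M.prefactor e f * (g (e, f) / (1 + f)) := by
  refine ⟨fun _ => 0, fun p => 8 * (Real.pi : ℂ) * (M.E : ℂ) ^ 2 * g p, fun _ => 0, by fun_prop,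
    by fun_prop, by fun_prop, fun e f he hf => ?_⟩
  have h1 := one_add_ne_zero he
  have h2 := one_add_ne_zero hf
  simp only [prefactor]
  field_simp
  ring

theorem isResonantCoeff_prefactor_mul_div_fundamental (M : NanowireModel) {g : ℂ × ℂ → ℂ}
    (hg : Continuous g) :
    IsResonantCoeff fun e f => M.prefactor e f * (g (e, f) / (1 + e)) := by
  refine ⟨fun _ => 0, fun _ => 0, fun p => 8 * (Real.pi : ℂ) * (M.E : ℂ) ^ 2 * g p, by fun_prop,
    by fun_prop, by fun_prop, fun e f he hf => ?_⟩
  have h1 := one_add_ne_zero he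
  have h2 := one_add_ne_zero hf
  simp only [prefactor]
  field_simp
  ring

variable (M : NanowireModel)

theorem isResonantCoeff_constCoeff : IsResonantCoeff fun e _ => M.constCoeff e := by
  refine (M.isResonantCoeff_prefactor_mul (g := fun p => -(M.χperp * p.1 ^ 2 * (1 + p.2)))
    (by fun_prop)).congr fun e f he hf => ?_
  have h1 := one_add_ne_zero he
  have h2 := one_add_ne_zero hf
  simp only [constCoeff, prefactor]
  field_simp

theorem isResonantCoeff_innerCoeff : IsResonantCoeff M.innerCoeff :=
  (M.isResonantCoeff_prefactor_mul (g := fun p => -(M.χperp * p.1 ^ 2 - 2 * M.χpar * p.1))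
    (by fun_prop)).congr fun e f _ _ => by simp only [innerCoeff]; ring

theorem isResonantCoeff_outerCoeff : IsResonantCoeff M.outerCoeff :=
  (M.isResonantCoeff_prefactor_mul (g := fun p => M.χperp * p.1 ^ 2 * p.2 + 2 * M.χpar * p.1)
    (by fun_prop)).congr fun e f _ _ => by simp only [outerCoeff]; ring

theorem isResonantCoeff_outerMinus : IsResonantCoeff M.outerMinus :=
  ((M.isResonantCoeff_prefactor_mul_div_double
      (g := fun p => M.doubleResidue p.1 p.2) (by unfold doubleResidue; fun_prop)).add
    (M.isResonantCoeff_prefactor_mul_div_fundamental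
      (g := fun p => M.fundamentalResidue p.1 p.2) (by unfold fundamentalResidue; fun_prop))).congr
    fun e f _ _ => by simp only [outerMinus]; ring

theorem isResonantCoeff_outerMid : IsResonantCoeff M.outerMid :=
  (M.isResonantCoeff_prefactor_mul_div_fundamental (g := fun p => 2 * (p.1 - 1)
    * ((M.n : ℂ) - 1) * (M.χperp * p.1 ^ 2 * p.2 + 2 * M.χpar * p.1)) (by fun_prop)).congr
    fun e f _ _ => by simp only [outerMid]; ring

theorem isResonantCoeff_outerPlus : IsResonantCoeff M.outerPlus :=
  (M.isResonantCoeff_prefactor_mul (g := fun p => ((M.n : ℂ) + 1)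
    * (M.χperp * p.1 ^ 2 * p.2 + 2 * M.χpar * p.1)) (by fun_prop)).congr
    fun e f _ _ => by simp only [outerPlus]; ring

theorem isResonantCoeff_mul_innerAmp_sq (c : ℂ) :
    IsResonantCoeff fun e _ => c * e ^ 2 * M.innerAmp e ^ 2 := by
  refine ⟨fun p => c * p.1 ^ 2 * (4 * (M.E : ℂ) ^ 2) * (1 + p.2), fun _ => 0, fun _ => 0,
    by fun_prop, by fun_prop, by fun_prop, fun e f he hf => ?_⟩
  have h1 := one_add_ne_zero he
  have h2 := one_add_ne_zero hf
  simp only [innerAmp]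
  field_simp
  ring

theorem isResonantCoeff_mul_innerAmp_mul (c : ℂ) :
    IsResonantCoeff fun e _ => c * e ^ 2 * (M.innerAmp e * M.innerAmp₁ e) := by
  refine ⟨fun _ => 0, fun _ => 0,
    fun p => c * p.1 ^ 2 * (4 * (M.E : ℂ) ^ 2) * (p.1 - 1) * (1 + p.2), by fun_prop,
    by fun_prop, by fun_prop, fun e f he hf => ?_⟩
  have h1 := one_add_ne_zero he
  have h2 := one_add_ne_zero hf
  simp only [innerAmp₁, innerAmp]
  field_simp
  ring

theorem isResonantCoeff_innerMinus : IsResonantCoeff M.innerMinus :=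
  (((M.isResonantCoeff_outerMinus.sub (M.isResonantCoeff_innerCoeff.add
    M.isResonantCoeff_outerCoeff)).sub
    (M.isResonantCoeff_mul_innerAmp_mul (4 * Real.pi * M.χperp * (M.n - 1)))).add
    (M.isResonantCoeff_mul_innerAmp_sq (4 * Real.pi * M.χperp * (M.n / 2)))).congr
    fun e f _ _ => by simp only [innerMinus]; ring

theorem isResonantCoeff_innerMid : IsResonantCoeff M.innerMid :=
  (M.isResonantCoeff_outerMid.sub
    (M.isResonantCoeff_mul_innerAmp_mul (4 * Real.pi * M.χperp * (M.n - 1)))).congr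
    fun e f _ _ => by simp only [innerMid]; ring

theorem isResonantCoeff_innerPlus : IsResonantCoeff M.innerPlus :=
  ((M.isResonantCoeff_outerPlus.sub (M.isResonantCoeff_innerCoeff.add
    M.isResonantCoeff_outerCoeff)).sub
    (M.isResonantCoeff_mul_innerAmp_sq (2 * Real.pi * M.χperp * M.n))).congr
    fun e f _ _ => by simp only [innerPlus]; ring

/-- The second-harmonic field `U₀ + ε U₁` on the plane. -/
noncomputable def secondHarmonicField (e f : ℂ) (ε : ℝ) : ℂ → ℂ :=
  ((M.secondHarmonic₀ e f).expand (M.secondHarmonic₁ e f) ε).onPlane M.r₀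

variable {M}

theorem norm_polarMode_le_one_of_lt (hr₀ : 0 < M.r₀) {p : ℤ} (hp : 0 ≤ p) {z : ℂ}
    (hz : ‖z‖ < M.r₀) : ‖polarMode M.r₀ p z‖ ≤ 1 := by
  refine (norm_polarMode_le _ _ _).trans ?_
  obtain ⟨k, rfl⟩ := Int.eq_ofNat_of_zero_le hp
  rw [zpow_natCast, abs_of_pos hr₀]
  exact pow_le_one₀ (by positivity) ((div_le_one hr₀).2 hz.le)

theorem norm_polarMode_le_one_of_le (hr₀ : 0 < M.r₀) {p : ℤ} (hp : p ≤ 0) {z : ℂ}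
    (hz : M.r₀ ≤ ‖z‖) : ‖polarMode M.r₀ p z‖ ≤ 1 := by
  refine (norm_polarMode_le _ _ _).trans ?_
  rw [abs_of_pos hr₀]
  exact zpow_le_one_of_nonpos₀ ((one_le_div hr₀).2 hz) hp

theorem norm_mul_le_of_le_one {c w : ℂ} (hw : ‖w‖ ≤ 1) : ‖c * w‖ ≤ ‖c‖ := by
  rw [norm_mul]; exact mul_le_of_le_one_right (norm_nonneg _) hw

theorem secondHarmonicField_of_le {e f : ℂ} {ε : ℝ} {z : ℂ} (hz : M.r₀ ≤ ‖z‖) :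
    M.secondHarmonicField e f ε z = M.outerCoeff e f * polarMode M.r₀ (-2) z
      + ε * (M.outerMinus e f * polarMode M.r₀ (-(M.n - 2)) z
        + M.outerMid e f * polarMode M.r₀ (-M.n) z
        + M.outerPlus e f * polarMode M.r₀ (-(M.n + 2)) z) := by
  rw [secondHarmonicField, TwoSidedField.onPlane, if_neg (not_lt.2 hz)]
  rfl

theorem norm_secondHarmonicField_le_of_le (hr₀ : 0 < M.r₀) (hn : 3 ≤ M.n) {e f : ℂ} {ε : ℝ}
    (hε : 0 < ε) {z : ℂ} (hz : M.r₀ ≤ ‖z‖) :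
    ‖M.secondHarmonicField e f ε z‖ ≤ ‖M.outerCoeff e f‖
      + ε * (‖M.outerMinus e f‖ + ‖M.outerMid e f‖ + ‖M.outerPlus e f‖) := by
  rw [secondHarmonicField_of_le hz]
  refine (norm_add_le _ _).trans (add_le_add
    (norm_mul_le_of_le_one (norm_polarMode_le_one_of_le hr₀ (by norm_num) hz)) ?_)
  rw [norm_mul, Complex.norm_real, Real.norm_eq_abs, abs_of_pos hε]
  refine mul_le_mul_of_nonneg_left (norm_add₃_le.trans ?_) hε.le
  exact add_le_add (add_le_add
    (norm_mul_le_of_le_one (norm_polarMode_le_one_of_le hr₀ (by omega) hz))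
    (norm_mul_le_of_le_one (norm_polarMode_le_one_of_le hr₀ (by omega) hz)))
    (norm_mul_le_of_le_one (norm_polarMode_le_one_of_le hr₀ (by omega) hz))

theorem norm_secondHarmonicField_le_of_lt (hr₀ : 0 < M.r₀) (hn : 3 ≤ M.n) {e f : ℂ} {ε : ℝ}
    (hε : 0 < ε) {z : ℂ} (hz : ‖z‖ < M.r₀) :
    ‖M.secondHarmonicField e f ε z‖ ≤ ‖M.constCoeff e‖ + ‖M.innerCoeff e f‖
      + ε * (‖M.innerMinus e f‖ + ‖M.innerMid e f‖ + ‖M.innerPlus e f‖) := by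
  have h : M.secondHarmonicField e f ε z =
      M.constCoeff e + M.innerCoeff e f * polarMode M.r₀ 2 z
      + ε * (M.innerMinus e f * polarMode M.r₀ (M.n - 2) z
        + M.innerMid e f * polarMode M.r₀ M.n z
        + M.innerPlus e f * polarMode M.r₀ (M.n + 2) z) := by
    rw [secondHarmonicField, TwoSidedField.onPlane, if_pos hz]
    rfl
  rw [h]
  refine (norm_add_le _ _).trans (add_le_add ((norm_add_le _ _).trans (add_le_add le_rfl
    (norm_mul_le_of_le_one (norm_polarMode_le_one_of_lt hr₀ (by norm_num) hz)))) ?_)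
  rw [norm_mul, Complex.norm_real, Real.norm_eq_abs, abs_of_pos hε]
  refine mul_le_mul_of_nonneg_left (norm_add₃_le.trans ?_) hε.le
  exact add_le_add (add_le_add
    (norm_mul_le_of_le_one (norm_polarMode_le_one_of_lt hr₀ (by omega) hz))
    (norm_mul_le_of_le_one (norm_polarMode_le_one_of_lt hr₀ (by omega) hz)))
    (norm_mul_le_of_le_one (norm_polarMode_le_one_of_lt hr₀ (by omega) hz))

/-- Every coefficient, inside or outside, is bounded by a multiple of `resonanceWeight`, and the
modes are bounded by `1`. -/
theorem eventually_norm_secondHarmonicField_le (hr₀ : 0 < M.r₀) (hn : 3 ≤ M.n) {ε : ℝ}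
    (hε : 0 < ε) {ι : Type*} {l : Filter ι} {e f : ι → ℂ} {e₀ f₀ : ℂ}
    (he : Tendsto e l (𝓝 e₀)) (hf : Tendsto f l (𝓝 f₀))
    (hne : ∀ᶠ i in l, e i ≠ -1 ∧ f i ≠ -1) :
    ∃ C : ℝ, 0 ≤ C ∧ ∀ᶠ i in l, ∀ z : ℂ,
      ‖M.secondHarmonicField (e i) (f i) ε z‖ ≤ C * resonanceWeight (e i) (f i) := by
  obtain ⟨C₁, h₁, k₁⟩ := M.isResonantCoeff_constCoeff.eventually_le he hf hne
  obtain ⟨C₂, h₂, k₂⟩ := M.isResonantCoeff_innerCoeff.eventually_le he hf hne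
  obtain ⟨C₃, h₃, k₃⟩ := M.isResonantCoeff_outerCoeff.eventually_le he hf hne
  obtain ⟨C₄, h₄, k₄⟩ := M.isResonantCoeff_outerMinus.eventually_le he hf hne
  obtain ⟨C₅, h₅, k₅⟩ := M.isResonantCoeff_outerMid.eventually_le he hf hne
  obtain ⟨C₆, h₆, k₆⟩ := M.isResonantCoeff_outerPlus.eventually_le he hf hne
  obtain ⟨C₇, h₇, k₇⟩ := M.isResonantCoeff_innerMinus.eventually_le he hf hne
  obtain ⟨C₈, h₈, k₈⟩ := M.isResonantCoeff_innerMid.eventually_le he hf hne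
  obtain ⟨C₉, h₉, k₉⟩ := M.isResonantCoeff_innerPlus.eventually_le he hf hne
  refine ⟨C₁ + C₂ + C₃ + ε * (C₄ + C₅ + C₆ + C₇ + C₈ + C₉), by positivity, ?_⟩
  filter_upwards [k₁, k₂, k₃, k₄, k₅, k₆, k₇, k₈, k₉] with i g₁ g₂ g₃ g₄ g₅ g₆ g₇ g₈ g₉ z
  have hw := resonanceWeight_nonneg (e i) (f i)
  set w := resonanceWeight (e i) (f i)
  rcases lt_or_ge ‖z‖ M.r₀ with hz | hz
  · refine (norm_secondHarmonicField_le_of_lt hr₀ hn hε hz).trans ?_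
    calc _ ≤ C₁ * w + C₂ * w + ε * (C₇ * w + C₈ * w + C₉ * w) := by gcongr
      _ ≤ C₁ * w + C₂ * w + ε * (C₇ * w + C₈ * w + C₉ * w)
          + (C₃ * w + ε * (C₄ * w + C₅ * w + C₆ * w)) := le_add_of_nonneg_right (by positivity)
      _ = _ := by ring
  · refine (norm_secondHarmonicField_le_of_le hr₀ hn hε hz).trans ?_
    calc _ ≤ C₃ * w + ε * (C₄ * w + C₅ * w + C₆ * w) := by gcongr
      _ ≤ C₃ * w + ε * (C₄ * w + C₅ * w + C₆ * w)
          + (C₁ * w + C₂ * w + ε * (C₇ * w + C₈ * w + C₉ * w)) :=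
            le_add_of_nonneg_right (by positivity)
      _ = _ := by ring

end NanowireModel

/-! ### Resonance orders -/

theorem IsResonanceBound.congr {ι : Type*} {l : Filter ι} {ρ : ι → ℝ} {v w : ι → ℂ → ℂ} {S : Set ℂ}
    (h : ∀ᶠ i in l, v i = w i) (hv : IsResonanceBound l ρ v S) : IsResonanceBound l ρ w S := by
  obtain ⟨C, hC⟩ := hv
  refine ⟨C, ?_⟩
  filter_upwards [h, hC] with i hi k
  rwa [← hi]

theorem IsResonanceOrder.congr {ι : Type*} {l : Filter ι} {ρ : ι → ℝ} {v w : ι → ℂ → ℂ} {S : Set ℂ}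
    (h : ∀ᶠ i in l, v i = w i) (hv : IsResonanceOrder l ρ v S) : IsResonanceOrder l ρ w S := by
  obtain ⟨hb, c, hc, k⟩ := hv
  refine ⟨hb.congr h, c, hc, ?_⟩
  filter_upwards [h, k] with i hi k
  rwa [← hi]

theorem isResonanceOrder_congr {ι : Type*} {l : Filter ι} {ρ : ι → ℝ} {v w : ι → ℂ → ℂ} {S : Set ℂ}
    (h : ∀ᶠ i in l, v i = w i) : IsResonanceOrder l ρ v S ↔ IsResonanceOrder l ρ w S :=
  ⟨.congr h, .congr (h.mono fun _ => Eq.symm)⟩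

theorem IsResonanceBound.mono {ι : Type*} {l : Filter ι} {ρ : ι → ℝ} {v : ι → ℂ → ℂ} {S T : Set ℂ}
    (hv : IsResonanceBound l ρ v S) (h : T ⊆ S) : IsResonanceBound l ρ v T := by
  obtain ⟨C, hC⟩ := hv
  exact ⟨C, hC.mono fun _ k z hz => k z (h hz)⟩

theorem IsResonanceBound.of_eventually_le {ι : Type*} {l : Filter ι} {ρ ρ' : ι → ℝ}
    {v : ι → ℂ → ℂ} {S : Set ℂ} {K : ℝ}
    (h : IsResonanceBound l ρ v S) (hρ : ∀ i, 0 ≤ ρ i) (hle : ∀ᶠ i in l, ρ i ≤ K * ρ' i) :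
    IsResonanceBound l ρ' v S := by
  obtain ⟨C, hC⟩ := h
  refine ⟨|C| * K, ?_⟩
  filter_upwards [hC, hle] with i k kle z hz
  calc ‖v i z‖ ≤ C * ρ i := k z hz
    _ ≤ |C| * ρ i := mul_le_mul_of_nonneg_right (le_abs_self C) (hρ i)
    _ ≤ |C| * (K * ρ' i) := mul_le_mul_of_nonneg_left kle (abs_nonneg C)
    _ = |C| * K * ρ' i := by ring

/-- A nonzero limit of a fixed combination of two point values bounds the supremum norm from
below. -/
theorem exists_le_norm_of_tendsto {ι : Type*} {l : Filter ι} {v : ι → ℂ → ℂ} {S : Set ℂ}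
    {z₁ z₂ : ℂ} (h₁ : z₁ ∈ S) (h₂ : z₂ ∈ S) {a L : ℂ} {d : ι → ℂ} (hd : ∀ᶠ i in l, d i ≠ 0)
    (h : Tendsto (fun i => d i * (a * v i z₁ - v i z₂)) l (𝓝 L)) (hL : L ≠ 0) :
    ∃ c : ℝ, 0 < c ∧ ∀ᶠ i in l, ∃ z ∈ S, c * ‖d i‖⁻¹ ≤ ‖v i z‖ := by
  have hL' : 0 < ‖L‖ := norm_pos_iff.2 hL
  refine ⟨‖L‖ / (2 * (‖a‖ + 1)), by positivity, ?_⟩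
  filter_upwards [hd, h.norm.eventually_const_lt (half_lt_self hL')] with i hi k
  by_contra! hcon
  have k₁ := hcon z₁ h₁
  have k₂ := hcon z₂ h₂
  have hdi : 0 < ‖d i‖ := norm_pos_iff.2 hi
  refine absurd k (not_lt.2 ?_)
  calc ‖d i * (a * v i z₁ - v i z₂)‖ ≤ ‖d i‖ * (‖a‖ * ‖v i z₁‖ + ‖v i z₂‖) := by
        rw [norm_mul]
        gcongr
        exact (norm_sub_le _ _).trans_eq (by rw [norm_mul])
    _ ≤ ‖d i‖ * (‖a‖ * (‖L‖ / (2 * (‖a‖ + 1)) * ‖d i‖⁻¹)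
          + ‖L‖ / (2 * (‖a‖ + 1)) * ‖d i‖⁻¹) := by gcongr
    _ = ‖L‖ / 2 := by field_simp

theorem tendsto_nhdsNE_of_eq {X F : ℂ → ℂ} {a : ℂ} (hF : Continuous F)
    (h : ∀ e, e ≠ a → X e = F e) :
    Tendsto X (𝓝[≠] a) (𝓝 (F a)) :=
  (hF.continuousAt.tendsto.mono_left nhdsWithin_le_nhds).congr'
    (eventually_nhdsWithin_of_forall fun e he => (h e he).symm)

namespace NanowireModel

variable {M : NanowireModel}

/-- By uniqueness, every second-harmonic field is the explicit one. -/
theorem IsSecondHarmonic.onPlane_expand (hr₀ : 0 < M.r₀) (hn : 3 ≤ M.n) {e f : ℂ} (he : e ≠ -1)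
    (hf : f ≠ -1) {U₀ U₁ : TwoSidedField} (h : M.IsSecondHarmonic e f U₀ U₁) (ε : ℝ) :
    (U₀.expand U₁ ε).onPlane M.r₀ = M.secondHarmonicField e f ε := by
  obtain ⟨u₀, u₁, h⟩ := h
  obtain ⟨⟨h1, h2⟩, h3, h4⟩ :=
    h.secondHarmonic_unique hr₀ he hf (isFieldExpansion_secondHarmonic hr₀ hn he hf)
  funext z
  simp only [secondHarmonicField, TwoSidedField.onPlane, TwoSidedField.expand]
  split_ifs with hz
  · rw [h1 z hz.le, h3 z hz.le]
  · rw [h2 z (not_lt.1 hz), h4 z (not_lt.1 hz)]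

theorem isResonanceBound_of_resonanceWeight_le (hr₀ : 0 < M.r₀) (hn : 3 ≤ M.n) {ε : ℝ}
    (hε : 0 < ε) {ι : Type*} {l : Filter ι} {e f : ι → ℂ} {e₀ f₀ : ℂ}
    (he : Tendsto e l (𝓝 e₀)) (hf : Tendsto f l (𝓝 f₀))
    (hne : ∀ᶠ i in l, e i ≠ -1 ∧ f i ≠ -1) {ρ : ι → ℝ} {K : ℝ}
    (hw : ∀ᶠ i in l, resonanceWeight (e i) (f i) ≤ K * ρ i) :
    IsResonanceBound l ρ (fun i => M.secondHarmonicField (e i) (f i) ε) Set.univ := by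
  obtain ⟨C, hC, h⟩ := eventually_norm_secondHarmonicField_le hr₀ hn hε he hf hne
  refine ⟨C * K, ?_⟩
  filter_upwards [h, hw] with i k kw z _
  exact (k z).trans ((mul_le_mul_of_nonneg_left kw hC).trans_eq (by ring))

theorem polarMode_two_pow_mul {r : ℝ} (hr : 0 < r) (p : ℤ) (k : ℕ) :
    polarMode r p (2 ^ k * r) = ((2 : ℂ) ^ k) ^ p := by
  have hr' : (r : ℂ) ≠ 0 := Complex.ofReal_ne_zero.2 hr.ne'
  rw [polarMode, mul_div_cancel_right₀ _ hr',
    show ((2 : ℂ) ^ k) ^ p = (((2 : ℝ) ^ k) ^ p : ℝ) by push_cast; rfl, Complex.ofReal_re]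

theorem secondHarmonicField_two_pow_mul (hr₀ : 0 < M.r₀) (e f : ℂ) (ε : ℝ) (k : ℕ) :
    M.secondHarmonicField e f ε (2 ^ k * M.r₀) =
      M.outerCoeff e f * ((2 : ℂ) ^ k)⁻¹ ^ 2
      + ε * (((2 : ℂ) ^ k)⁻¹ ^ M.n * (M.outerMinus e f * ((2 : ℂ) ^ k) ^ 2 + M.outerMid e f
        + M.outerPlus e f * ((2 : ℂ) ^ k)⁻¹ ^ 2)) := by
  have h2 : (2 : ℂ) ^ k ≠ 0 := pow_ne_zero _ two_ne_zero
  have hz : M.r₀ ≤ ‖(2 : ℂ) ^ k * M.r₀‖ := by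
    rw [norm_mul, norm_pow, Complex.norm_real, Real.norm_eq_abs, abs_of_pos hr₀]
    exact le_mul_of_one_le_left hr₀.le (one_le_pow₀ (by norm_num))
  rw [secondHarmonicField_of_le hz, polarMode_two_pow_mul hr₀, polarMode_two_pow_mul hr₀,
    polarMode_two_pow_mul hr₀, polarMode_two_pow_mul hr₀, neg_sub, sub_eq_add_neg, zpow_add₀ h2,
    neg_add, zpow_add₀ h2, zpow_neg _ (M.n : ℤ), zpow_natCast]
  simp only [zpow_neg, zpow_ofNat, inv_pow]
  ring

/-- The values at `2 r₀` and `4 r₀` isolate the coefficient of the mode `n - 2`, up to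
nonresonant contributions. -/
theorem secondHarmonicField_isolate_minus (hr₀ : 0 < M.r₀) (e f : ℂ) (ε : ℝ) :
    ((2 : ℂ)⁻¹ ^ M.n) * M.secondHarmonicField e f ε (2 ^ 1 * M.r₀)
        - M.secondHarmonicField e f ε (2 ^ 2 * M.r₀) =
      ((2 : ℂ)⁻¹ ^ M.n / 4 - 1 / 16) * M.outerCoeff e f
        - 12 * ((2 : ℂ)⁻¹ ^ M.n) ^ 2 * ε * M.outerMinus e f
        + 3 / 16 * ((2 : ℂ)⁻¹ ^ M.n) ^ 2 * ε * M.outerPlus e f := by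
  rw [secondHarmonicField_two_pow_mul hr₀, secondHarmonicField_two_pow_mul hr₀, pow_one,
    ← inv_pow, pow_right_comm _ 2 M.n]
  ring

/-- The values at `2 r₀` and `4 r₀` isolate the coefficient of the mode `n`, up to nonresonant
contributions. -/
theorem secondHarmonicField_isolate_mid (hr₀ : 0 < M.r₀) (e f : ℂ) (ε : ℝ) :
    (4 * (2 : ℂ)⁻¹ ^ M.n) * M.secondHarmonicField e f ε (2 ^ 1 * M.r₀)
        - M.secondHarmonicField e f ε (2 ^ 2 * M.r₀) =
      ((2 : ℂ)⁻¹ ^ M.n - 1 / 16) * M.outerCoeff e f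
        + 3 * ((2 : ℂ)⁻¹ ^ M.n) ^ 2 * ε * M.outerMid e f
        + 15 / 16 * ((2 : ℂ)⁻¹ ^ M.n) ^ 2 * ε * M.outerPlus e f := by
  rw [secondHarmonicField_two_pow_mul hr₀, secondHarmonicField_two_pow_mul hr₀, pow_one,
    ← inv_pow, pow_right_comm _ 2 M.n]
  ring

theorem two_pow_mul_mem (hr₀ : 0 < M.r₀) {k : ℕ} (hk : k ≠ 0) :
    (2 : ℂ) ^ k * M.r₀ ∈ {z : ℂ | M.r₀ < ‖z‖} := by
  rw [Set.mem_ofPred_eq, norm_mul, norm_pow, Complex.norm_real, Real.norm_eq_abs, abs_of_pos hr₀]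
  exact lt_mul_of_one_lt_left hr₀ (one_lt_pow₀ (by norm_num) hk)

section Order

variable {ι : Type*} {l : Filter ι} {e f d : ι → ℂ} {ε : ℝ}

/-- A coefficient `M_{n-2}` of exact order `1 / d` forces a lower bound of this order, if the mode
`2` and the mode `n + 2` are of smaller order; nothing is required of the mode `n`. -/
theorem exists_le_norm_secondHarmonicField_of_minus (hr₀ : 0 < M.r₀) (hε : 0 < ε)
    (hd : ∀ᶠ i in l, d i ≠ 0)
    (h₀ : Tendsto (fun i => d i * M.outerCoeff (e i) (f i)) l (𝓝 0))
    (h₃ : Tendsto (fun i => d i * M.outerPlus (e i) (f i)) l (𝓝 0)) {L : ℂ}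
    (h₁ : Tendsto (fun i => d i * M.outerMinus (e i) (f i)) l (𝓝 L)) (hL : L ≠ 0) :
    ∃ c : ℝ, 0 < c ∧ ∀ᶠ i in l, ∃ z ∈ {z : ℂ | M.r₀ < ‖z‖},
      c * ‖d i‖⁻¹ ≤ ‖M.secondHarmonicField (e i) (f i) ε z‖ := by
  have hε' : (ε : ℂ) ≠ 0 := Complex.ofReal_ne_zero.2 hε.ne'
  refine exists_le_norm_of_tendsto (two_pow_mul_mem hr₀ one_ne_zero)
    (two_pow_mul_mem hr₀ two_ne_zero) (a := (2 : ℂ)⁻¹ ^ M.n)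
    (L := -(12 * ((2 : ℂ)⁻¹ ^ M.n) ^ 2 * ε * L)) hd ?_ (by simp [hε', hL])
  refine (((h₀.const_mul ((2 : ℂ)⁻¹ ^ M.n / 4 - 1 / 16)).sub
    (h₁.const_mul (12 * ((2 : ℂ)⁻¹ ^ M.n) ^ 2 * ε))).add
    (h₃.const_mul (3 / 16 * ((2 : ℂ)⁻¹ ^ M.n) ^ 2 * ε))).congr' ?_ |>.trans_eq ?_
  · refine Eventually.of_forall fun i => ?_
    simp only [secondHarmonicField_isolate_minus hr₀]
    ring
  · congr 1; ring

/-- A coefficient `M_n` of exact order `1 / d` forces a lower bound of this order, if the mode `2`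
and the mode `n + 2` are of smaller order; nothing is required of the mode `n - 2`. -/
theorem exists_le_norm_secondHarmonicField_of_mid (hr₀ : 0 < M.r₀) (hε : 0 < ε)
    (hd : ∀ᶠ i in l, d i ≠ 0)
    (h₀ : Tendsto (fun i => d i * M.outerCoeff (e i) (f i)) l (𝓝 0))
    (h₃ : Tendsto (fun i => d i * M.outerPlus (e i) (f i)) l (𝓝 0)) {L : ℂ}
    (h₂ : Tendsto (fun i => d i * M.outerMid (e i) (f i)) l (𝓝 L)) (hL : L ≠ 0) :
    ∃ c : ℝ, 0 < c ∧ ∀ᶠ i in l, ∃ z ∈ {z : ℂ | M.r₀ < ‖z‖},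
      c * ‖d i‖⁻¹ ≤ ‖M.secondHarmonicField (e i) (f i) ε z‖ := by
  have hε' : (ε : ℂ) ≠ 0 := Complex.ofReal_ne_zero.2 hε.ne'
  refine exists_le_norm_of_tendsto (two_pow_mul_mem hr₀ one_ne_zero)
    (two_pow_mul_mem hr₀ two_ne_zero) (a := 4 * (2 : ℂ)⁻¹ ^ M.n)
    (L := 3 * ((2 : ℂ)⁻¹ ^ M.n) ^ 2 * ε * L) hd ?_ (by simp [hε', hL])
  refine (((h₀.const_mul ((2 : ℂ)⁻¹ ^ M.n - 1 / 16)).add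
    (h₂.const_mul (3 * ((2 : ℂ)⁻¹ ^ M.n) ^ 2 * ε))).add
    (h₃.const_mul (15 / 16 * ((2 : ℂ)⁻¹ ^ M.n) ^ 2 * ε))).congr' ?_ |>.trans_eq ?_
  · refine Eventually.of_forall fun i => ?_
    simp only [secondHarmonicField_isolate_mid hr₀]
    ring
  · congr 1; ring

/-- If all coefficients are `o(1 / d)`, then so is the field outside the particle. -/
theorem not_exists_le_norm_secondHarmonicField [l.NeBot] (hr₀ : 0 < M.r₀) (hn : 3 ≤ M.n)
    (hε : 0 < ε) (hd : ∀ᶠ i in l, d i ≠ 0)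
    (h₀ : Tendsto (fun i => d i * M.outerCoeff (e i) (f i)) l (𝓝 0))
    (h₁ : Tendsto (fun i => d i * M.outerMinus (e i) (f i)) l (𝓝 0))
    (h₂ : Tendsto (fun i => d i * M.outerMid (e i) (f i)) l (𝓝 0))
    (h₃ : Tendsto (fun i => d i * M.outerPlus (e i) (f i)) l (𝓝 0)) :
    ¬ ∃ c : ℝ, 0 < c ∧ ∀ᶠ i in l, ∃ z ∈ {z : ℂ | M.r₀ < ‖z‖},
      c * ‖d i‖⁻¹ ≤ ‖M.secondHarmonicField (e i) (f i) ε z‖ := by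
  rintro ⟨c, hc, h⟩
  have hlim := h₀.norm.add (((h₁.norm.add h₂.norm).add h₃.norm).const_mul ε)
  simp only [norm_zero, add_zero, mul_zero] at hlim
  obtain ⟨i, ⟨z, hz, k⟩, hi, klim⟩ := (h.and (hd.and (hlim.eventually_lt_const hc))).exists
  have hdi : 0 < ‖d i‖ := norm_pos_iff.2 hi
  have k' := k.trans (norm_secondHarmonicField_le_of_le hr₀ hn hε (le_of_lt hz))
  rw [← div_eq_mul_inv, div_le_iff₀ hdi] at k'
  simp only [norm_mul] at klim
  linarith

/-- The order `1 / d` is attained as soon as one of the modes `n - 2` and `n` has a coefficient of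
this order. -/
theorem isResonanceOrder_secondHarmonicField_iff [l.NeBot] (hr₀ : 0 < M.r₀) (hn : 3 ≤ M.n)
    (hε : 0 < ε) (hd : ∀ᶠ i in l, d i ≠ 0)
    (hb : IsResonanceBound l (fun i => ‖d i‖⁻¹) (fun i => M.secondHarmonicField (e i) (f i) ε)
      Set.univ)
    (h₀ : Tendsto (fun i => d i * M.outerCoeff (e i) (f i)) l (𝓝 0))
    (h₃ : Tendsto (fun i => d i * M.outerPlus (e i) (f i)) l (𝓝 0)) {L₁ L₂ : ℂ}
    (h₁ : Tendsto (fun i => d i * M.outerMinus (e i) (f i)) l (𝓝 L₁))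
    (h₂ : Tendsto (fun i => d i * M.outerMid (e i) (f i)) l (𝓝 L₂)) :
    IsResonanceOrder l (fun i => ‖d i‖⁻¹) (fun i => M.secondHarmonicField (e i) (f i) ε)
      {z | M.r₀ < ‖z‖} ↔ L₁ ≠ 0 ∨ L₂ ≠ 0 := by
  constructor
  · rintro ⟨-, h⟩
    by_contra! hL
    rw [hL.1] at h₁
    rw [hL.2] at h₂
    exact not_exists_le_norm_secondHarmonicField hr₀ hn hε hd h₀ h₁ h₂ h₃ h
  · rintro (hL | hL)
    · exact ⟨hb.mono (Set.subset_univ _),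
        exists_le_norm_secondHarmonicField_of_minus hr₀ hε hd h₀ h₃ h₁ hL⟩
    · exact ⟨hb.mono (Set.subset_univ _),
        exists_le_norm_secondHarmonicField_of_mid hr₀ hε hd h₀ h₃ h₂ hL⟩

end Order

end NanowireModel

/-! ### Resonance at one frequency -/

namespace NanowireModel

variable {M : NanowireModel}

theorem eight_pi_mul_sq_ne_zero (hE : 0 < M.E) : 8 * (Real.pi : ℂ) * (M.E : ℂ) ^ 2 ≠ 0 := by
  have h1 : (Real.pi : ℂ) ≠ 0 := Complex.ofReal_ne_zero.2 Real.pi_ne_zero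
  have h2 : (M.E : ℂ) ≠ 0 := Complex.ofReal_ne_zero.2 hE.ne'
  simp [h1, h2]

theorem natCast_sub_one_ne_zero (hn : 3 ≤ M.n) : (M.n : ℂ) - 1 ≠ 0 := by
  rw [sub_ne_zero]
  exact_mod_cast (by omega : M.n ≠ 1)

theorem tendsto_one_add_nhds_zero {ι : Type*} {l : Filter ι} {e : ι → ℂ}
    (he : Tendsto e l (𝓝 (-1))) : Tendsto (fun i => 1 + e i) l (𝓝 0) := by
  simpa using he.const_add 1

theorem isResonanceBound_fundamental (hr₀ : 0 < M.r₀) (hn : 3 ≤ M.n) {ε : ℝ} (hε : 0 < ε) {f : ℂ}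
    (hf : f ≠ -1) :
    IsResonanceBound (𝓝[≠] (-1 : ℂ)) (fun e => (‖1 + e‖ ^ 3)⁻¹)
      (fun e => M.secondHarmonicField e f ε) Set.univ := by
  have he : Tendsto (fun e : ℂ => e) (𝓝[≠] (-1)) (𝓝 (-1)) := nhdsWithin_le_nhds
  have hb : 0 < ‖1 + f‖ := norm_pos_iff.2 (one_add_ne_zero hf)
  refine isResonanceBound_of_resonanceWeight_le hr₀ hn hε he tendsto_const_nhds
    (eventually_nhdsWithin_of_forall fun e he => ⟨he, hf⟩)
    (K := (‖1 + f‖ + 1 + ‖1 + f‖) / ‖1 + f‖ ^ 2) ?_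
  filter_upwards [self_mem_nhdsWithin,
    (tendsto_one_add_nhds_zero he).norm.eventually_lt_const (by simp : ‖(0 : ℂ)‖ < 1)] with e he k
  have ha : 0 < ‖1 + e‖ := norm_pos_iff.2 (one_add_ne_zero he)
  rw [resonanceWeight, ← div_eq_mul_inv, div_div, mul_comm (‖1 + f‖ ^ 2)]
  gcongr
  exact mul_le_of_le_one_left hb.le k.le

theorem isResonanceBound_double (hr₀ : 0 < M.r₀) (hn : 3 ≤ M.n) {ε : ℝ} (hε : 0 < ε) {e : ℂ}
    (he : e ≠ -1) :
    IsResonanceBound (𝓝[≠] (-1 : ℂ)) (fun f => (‖1 + f‖ ^ 2)⁻¹)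
      (fun f => M.secondHarmonicField e f ε) Set.univ := by
  have hf : Tendsto (fun f : ℂ => f) (𝓝[≠] (-1)) (𝓝 (-1)) := nhdsWithin_le_nhds
  have ha : 0 < ‖1 + e‖ := norm_pos_iff.2 (one_add_ne_zero he)
  refine isResonanceBound_of_resonanceWeight_le hr₀ hn hε tendsto_const_nhds hf
    (eventually_nhdsWithin_of_forall fun f hf => ⟨he, hf⟩)
    (K := (‖1 + e‖ + ‖1 + e‖ + 1) / ‖1 + e‖ ^ 3) ?_
  filter_upwards [self_mem_nhdsWithin,
    (tendsto_one_add_nhds_zero hf).norm.eventually_lt_const (by simp : ‖(0 : ℂ)‖ < 1)] with f hf k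
  have hb : 0 < ‖1 + f‖ := norm_pos_iff.2 (one_add_ne_zero hf)
  rw [resonanceWeight, ← div_eq_mul_inv, div_div]
  gcongr
  exact mul_le_of_le_one_right ha.le k.le

/-- At the fundamental resonance the limits of `(1 + e)³ M_{n-2}` and `(1 + e)³ M_n` are nonzero
multiples of `χ_⊥ f` and `χ_⊥ f - 2 χ_∥`. -/
theorem isResonanceOrder_fundamental_iff (hr₀ : 0 < M.r₀) (hE : 0 < M.E) (hn : 3 ≤ M.n) {ε : ℝ}
    (hε : 0 < ε) {f : ℂ} (hf : f ≠ -1) :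
    IsResonanceOrder (𝓝[≠] (-1 : ℂ)) (fun e => (‖1 + e‖ ^ 3)⁻¹)
      (fun e => M.secondHarmonicField e f ε) {z | M.r₀ < ‖z‖} ↔ M.χperp * f ≠ 0 ∨ M.χpar ≠ 0 := by
  have hb := one_add_ne_zero hf
  have hg := eight_pi_mul_sq_ne_zero hE
  have hn1 := natCast_sub_one_ne_zero hn
  have hbound := isResonanceBound_fundamental hr₀ hn hε hf
  simp only [← norm_pow] at hbound ⊢
  set g := 8 * (Real.pi : ℂ) * (M.E : ℂ) ^ 2 with hgdef
  -- multiplied by `(1 + e)³`, the coefficients extend continuously to `e = -1`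
  have h₀ : Tendsto (fun e => (1 + e) ^ 3 * M.outerCoeff e f) (𝓝[≠] (-1)) _ :=
    tendsto_nhdsNE_of_eq
      (F := fun e => (1 + e) * (g / (1 + f) * (M.χperp * e ^ 2 * f + 2 * M.χpar * e)))
      (by fun_prop) fun e he => by
        have ha := one_add_ne_zero he
        simp only [outerCoeff, prefactor, ← hgdef]
        field_simp
  have h₁ : Tendsto (fun e => (1 + e) ^ 3 * M.outerMinus e f) (𝓝[≠] (-1)) _ :=
    tendsto_nhdsNE_of_eq
      (F := fun e => g / (1 + f) * ((1 + e) * (M.doubleResidue e f / (1 + f))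
        + M.fundamentalResidue e f))
      (by unfold doubleResidue fundamentalResidue; fun_prop) fun e he => by
        have ha := one_add_ne_zero he
        simp only [outerMinus, prefactor, ← hgdef]
        field_simp
  have h₂ : Tendsto (fun e => (1 + e) ^ 3 * M.outerMid e f) (𝓝[≠] (-1)) _ :=
    tendsto_nhdsNE_of_eq
      (F := fun e => 2 * (g / (1 + f)) * ((e - 1) * ((M.n : ℂ) - 1)
        * (M.χperp * e ^ 2 * f + 2 * M.χpar * e)))
      (by fun_prop) fun e he => by
        have ha := one_add_ne_zero he
        simp only [outerMid, prefactor, ← hgdef]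
        field_simp
  have h₃ : Tendsto (fun e => (1 + e) ^ 3 * M.outerPlus e f) (𝓝[≠] (-1)) _ :=
    tendsto_nhdsNE_of_eq
      (F := fun e => (1 + e) * (g / (1 + f) * ((M.n : ℂ) + 1)
        * (M.χperp * e ^ 2 * f + 2 * M.χpar * e)))
      (by fun_prop) fun e he => by
        have ha := one_add_ne_zero he
        simp only [outerPlus, prefactor, ← hgdef]
        field_simp
  simp only [add_neg_cancel, zero_mul, zero_add] at h₀ h₁ h₃
  have hd : ∀ᶠ e in 𝓝[≠] (-1 : ℂ), (1 + e) ^ 3 ≠ 0 :=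
    eventually_nhdsWithin_of_forall fun e he => pow_ne_zero _ (one_add_ne_zero he)
  rw [isResonanceOrder_secondHarmonicField_iff hr₀ hn hε hd hbound h₀ h₃ h₁ h₂]
  have e1 : g / (1 + f) * M.fundamentalResidue (-1) f
      = -4 * (g / (1 + f)) * ((M.n : ℂ) - 1) * (M.χperp * f) := by
    rw [fundamentalResidue]; ring
  have e2 : 2 * (g / (1 + f)) * ((-1 - 1) * ((M.n : ℂ) - 1)
      * (M.χperp * (-1) ^ 2 * f + 2 * M.χpar * -1))
      = -4 * (g / (1 + f)) * ((M.n : ℂ) - 1) * (M.χperp * f - 2 * M.χpar) := by ring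
  have hc : -4 * (g / (1 + f)) * ((M.n : ℂ) - 1) ≠ 0 :=
    mul_ne_zero (mul_ne_zero (by norm_num) (div_ne_zero hg hb)) hn1
  rw [e1, e2, mul_ne_zero_iff_left hc, mul_ne_zero_iff_left hc]
  by_cases h : M.χperp * f = 0 <;> simp [h]

/-- At the double-frequency resonance only `M_{n-2}` has a double pole, with leading coefficient a
nonzero multiple of `e (χ_⊥ e - 2 χ_∥)`. -/
theorem isResonanceOrder_double_iff (hr₀ : 0 < M.r₀) (hE : 0 < M.E) (hn : 3 ≤ M.n) {ε : ℝ}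
    (hε : 0 < ε) {e : ℂ} (he : e ≠ -1) :
    IsResonanceOrder (𝓝[≠] (-1 : ℂ)) (fun f => (‖1 + f‖ ^ 2)⁻¹)
      (fun f => M.secondHarmonicField e f ε) {z | M.r₀ < ‖z‖} ↔
        e ≠ 0 ∧ M.χperp * e ≠ 2 * M.χpar := by
  have ha := one_add_ne_zero he
  have hg := eight_pi_mul_sq_ne_zero hE
  have hbound := isResonanceBound_double hr₀ hn hε he
  simp only [← norm_pow] at hbound ⊢
  set g := 8 * (Real.pi : ℂ) * (M.E : ℂ) ^ 2 with hgdef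
  -- multiplied by `(1 + f)²`, the coefficients extend continuously to `f = -1`
  have h₀ : Tendsto (fun f => (1 + f) ^ 2 * M.outerCoeff e f) (𝓝[≠] (-1)) _ :=
    tendsto_nhdsNE_of_eq
      (F := fun f => (1 + f) * (g / (1 + e) ^ 2 * (M.χperp * e ^ 2 * f + 2 * M.χpar * e)))
      (by fun_prop) fun f hf => by
        have hb := one_add_ne_zero hf
        simp only [outerCoeff, prefactor, ← hgdef]
        field_simp
  have h₁ : Tendsto (fun f => (1 + f) ^ 2 * M.outerMinus e f) (𝓝[≠] (-1)) _ :=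
    tendsto_nhdsNE_of_eq
      (F := fun f => g / (1 + e) ^ 2 * (M.doubleResidue e f
        + (1 + f) * (M.fundamentalResidue e f / (1 + e))))
      (by unfold doubleResidue fundamentalResidue; fun_prop) fun f hf => by
        have hb := one_add_ne_zero hf
        simp only [outerMinus, prefactor, ← hgdef]
        field_simp
  have h₂ : Tendsto (fun f => (1 + f) ^ 2 * M.outerMid e f) (𝓝[≠] (-1)) _ :=
    tendsto_nhdsNE_of_eq
      (F := fun f => (1 + f) * (2 * (g / (1 + e) ^ 2) * ((e - 1) / (1 + e) * ((M.n : ℂ) - 1)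
        * (M.χperp * e ^ 2 * f + 2 * M.χpar * e))))
      (by fun_prop) fun f hf => by
        have hb := one_add_ne_zero hf
        simp only [outerMid, prefactor, ← hgdef]
        field_simp
  have h₃ : Tendsto (fun f => (1 + f) ^ 2 * M.outerPlus e f) (𝓝[≠] (-1)) _ :=
    tendsto_nhdsNE_of_eq
      (F := fun f => (1 + f) * (g / (1 + e) ^ 2 * ((M.n : ℂ) + 1)
        * (M.χperp * e ^ 2 * f + 2 * M.χpar * e)))
      (by fun_prop) fun f hf => by
        have hb := one_add_ne_zero hf
        simp only [outerPlus, prefactor, ← hgdef]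
        field_simp
  simp only [add_neg_cancel, zero_mul, add_zero] at h₀ h₁ h₂ h₃
  have hd : ∀ᶠ f in 𝓝[≠] (-1 : ℂ), (1 + f) ^ 2 ≠ 0 :=
    eventually_nhdsWithin_of_forall fun f hf => pow_ne_zero _ (one_add_ne_zero hf)
  rw [isResonanceOrder_secondHarmonicField_iff hr₀ hn hε hd hbound h₀ h₃ h₁ h₂]
  have e1 : g / (1 + e) ^ 2 * M.doubleResidue e (-1)
      = 4 * (g / (1 + e) ^ 2) * (e * (M.χperp * e - 2 * M.χpar)) := by
    rw [doubleResidue]; ring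
  have hc : 4 * (g / (1 + e) ^ 2) ≠ 0 :=
    mul_ne_zero (by norm_num) (div_ne_zero hg (pow_ne_zero _ ha))
  rw [e1, mul_ne_zero_iff_left hc, mul_ne_zero_iff, sub_ne_zero]
  simp

/-! ### Simultaneous resonance -/

section Simultaneous

variable {ι : Type*} {l : Filter ι} {e f : ι → ℂ} {ε : ℝ}

theorem isResonanceBound_simultaneous (hr₀ : 0 < M.r₀) (hn : 3 ≤ M.n) (hε : 0 < ε)
    (he : Tendsto e l (𝓝[≠] (-1))) (hf : Tendsto f l (𝓝[≠] (-1))) :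
    IsResonanceBound l
      (fun i => (‖1 + e i‖ ^ 2 * ‖1 + f i‖ ^ 2)⁻¹ + (‖1 + e i‖ ^ 3 * ‖1 + f i‖)⁻¹)
      (fun i => M.secondHarmonicField (e i) (f i) ε) Set.univ := by
  obtain ⟨he, hne⟩ := tendsto_nhdsWithin_iff.1 he
  obtain ⟨hf, hnf⟩ := tendsto_nhdsWithin_iff.1 hf
  refine isResonanceBound_of_resonanceWeight_le hr₀ hn hε he hf (hne.and hnf) (K := 2) ?_
  filter_upwards [hne, hnf,
    (tendsto_one_add_nhds_zero hf).norm.eventually_lt_const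
      (by simp : ‖(0 : ℂ)‖ < 1)] with i he hf k
  have ha : 0 < ‖1 + e i‖ := norm_pos_iff.2 (one_add_ne_zero he)
  have hb : 0 < ‖1 + f i‖ := norm_pos_iff.2 (one_add_ne_zero hf)
  set a := ‖1 + e i‖
  set b := ‖1 + f i‖
  have h : 2 * ((a ^ 2 * b ^ 2)⁻¹ + (a ^ 3 * b)⁻¹) = 2 * (a + b) / (a ^ 3 * b ^ 2) := by
    field_simp
  rw [resonanceWeight, h]
  gcongr
  nlinarith

/-- When `1 + f = o(1 + e)`, the double-frequency resonance dominates, and only the mode `n - 2`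
reaches the leading order. -/
theorem isResonanceOrder_of_isLittleO_iff [l.NeBot] (hr₀ : 0 < M.r₀) (hE : 0 < M.E) (hn : 3 ≤ M.n)
    (hε : 0 < ε) (he : Tendsto e l (𝓝[≠] (-1))) (hf : Tendsto f l (𝓝[≠] (-1)))
    (hfe : (fun i => 1 + f i) =o[l] fun i => 1 + e i) :
    IsResonanceOrder l (fun i => (‖1 + e i‖ ^ 2 * ‖1 + f i‖ ^ 2)⁻¹)
      (fun i => M.secondHarmonicField (e i) (f i) ε) {z | M.r₀ < ‖z‖} ↔
        M.χperp + 2 * M.χpar ≠ 0 := by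
  have hg := eight_pi_mul_sq_ne_zero hE
  have hb := isResonanceBound_simultaneous (ε := ε) hr₀ hn hε he hf
  obtain ⟨he, hne⟩ := tendsto_nhdsWithin_iff.1 he
  obtain ⟨hf, hnf⟩ := tendsto_nhdsWithin_iff.1 hf
  have hbound : IsResonanceBound l (fun i => (‖1 + e i‖ ^ 2 * ‖1 + f i‖ ^ 2)⁻¹)
      (fun i => M.secondHarmonicField (e i) (f i) ε) Set.univ := by
    refine hb.of_eventually_le (K := 2) (fun i => by positivity) ?_
    filter_upwards [hne, hnf, hfe.bound one_pos] with i hi hi' k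
    have ha : 0 < ‖1 + e i‖ := norm_pos_iff.2 (one_add_ne_zero hi)
    have hb : 0 < ‖1 + f i‖ := norm_pos_iff.2 (one_add_ne_zero hi')
    rw [one_mul] at k
    rw [two_mul]
    refine add_le_add le_rfl (inv_anti₀ (by positivity) ?_)
    calc ‖1 + e i‖ ^ 2 * ‖1 + f i‖ ^ 2 = ‖1 + e i‖ ^ 2 * ‖1 + f i‖ * ‖1 + f i‖ := by ring
      _ ≤ ‖1 + e i‖ ^ 2 * ‖1 + f i‖ * ‖1 + e i‖ := by gcongr
      _ = ‖1 + e i‖ ^ 3 * ‖1 + f i‖ := by ring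
  simp only [← norm_pow, ← norm_mul] at hbound ⊢
  set g := 8 * (Real.pi : ℂ) * (M.E : ℂ) ^ 2 with hgdef
  have hef : Tendsto (fun i => (e i, f i)) l (𝓝 (-1, -1)) := he.prodMk_nhds hf
  have hlim {F : ℂ × ℂ → ℂ} (hF : Continuous F) :
      Tendsto (fun i => F (e i, f i)) l (𝓝 (F (-1, -1))) := (hF.tendsto _).comp hef
  have hr : Tendsto (fun i => (1 + f i) / (1 + e i)) l (𝓝 0) := hfe.tendsto_div_nhds_zero
  have h₀ : Tendsto (fun i => ((1 + e i) ^ 2 * (1 + f i) ^ 2) * M.outerCoeff (e i) (f i)) l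
      (𝓝 0) := by
    have k := hlim (F := fun p => (1 + p.2) * (g * (M.χperp * p.1 ^ 2 * p.2 + 2 * M.χpar * p.1)))
      (by fun_prop)
    simp only [add_neg_cancel, zero_mul] at k
    refine k.congr' ?_
    filter_upwards [hne, hnf] with i hi hi'
    have ha := one_add_ne_zero hi
    have hb := one_add_ne_zero hi'
    simp only [outerCoeff, prefactor, ← hgdef]
    field_simp
  have h₃ : Tendsto (fun i => ((1 + e i) ^ 2 * (1 + f i) ^ 2) * M.outerPlus (e i) (f i)) l
      (𝓝 0) := by
    have k := hlim (F := fun p => (1 + p.2) * (g * ((M.n : ℂ) + 1)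
      * (M.χperp * p.1 ^ 2 * p.2 + 2 * M.χpar * p.1))) (by fun_prop)
    simp only [add_neg_cancel, zero_mul] at k
    refine k.congr' ?_
    filter_upwards [hne, hnf] with i hi hi'
    have ha := one_add_ne_zero hi
    have hb := one_add_ne_zero hi'
    simp only [outerPlus, prefactor, ← hgdef]
    field_simp
  have h₂ : Tendsto (fun i => ((1 + e i) ^ 2 * (1 + f i) ^ 2) * M.outerMid (e i) (f i)) l
      (𝓝 0) := by
    have k := hr.mul (hlim (F := fun p => 2 * g * ((p.1 - 1) * ((M.n : ℂ) - 1)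
      * (M.χperp * p.1 ^ 2 * p.2 + 2 * M.χpar * p.1))) (by fun_prop))
    rw [zero_mul] at k
    refine k.congr' ?_
    filter_upwards [hne, hnf] with i hi hi'
    have ha := one_add_ne_zero hi
    have hb := one_add_ne_zero hi'
    simp only [outerMid, prefactor, ← hgdef]
    field_simp
  have h₁ : Tendsto (fun i => ((1 + e i) ^ 2 * (1 + f i) ^ 2) * M.outerMinus (e i) (f i)) l
      (𝓝 (4 * g * (M.χperp + 2 * M.χpar))) := by
    have k := (hlim (F := fun p => g * M.doubleResidue p.1 p.2)
      (by unfold doubleResidue; fun_prop)).add (hr.mul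
        (hlim (F := fun p => g * M.fundamentalResidue p.1 p.2)
          (by unfold fundamentalResidue; fun_prop)))
    rw [zero_mul, add_zero] at k
    refine (k.congr' ?_).trans_eq ?_
    · filter_upwards [hne, hnf] with i hi hi'
      have ha := one_add_ne_zero hi
      have hb := one_add_ne_zero hi'
      simp only [outerMinus, prefactor, ← hgdef]
      field_simp
    · rw [doubleResidue]
      congr 1
      ring
  rw [isResonanceOrder_secondHarmonicField_iff hr₀ hn hε ((hne.and hnf).mono fun i hi =>
    mul_ne_zero (pow_ne_zero _ (one_add_ne_zero hi.1)) (pow_ne_zero _ (one_add_ne_zero hi.2)))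
    hbound h₀ h₃ h₁ h₂, mul_ne_zero_iff_left (mul_ne_zero (by norm_num) hg)]
  simp

/-- If `χ_⊥ = -2 χ_∥`, the double-frequency residue of `M_{n-2}` vanishes when both permittivities
are `-1`. -/
theorem doubleResidue_of_add_eq_zero (h : M.χperp + 2 * M.χpar = 0) (e f : ℂ) :
    M.doubleResidue e f
      = 2 * M.χpar * e * ((1 + f) * (f + M.n - 1) - (1 + e) * (f * (f - 3))) := by
  rw [doubleResidue, eq_neg_of_add_eq_zero_left h]
  ring

/-- When `1 + e = O(1 + f)`, the mode `n` reaches the leading order unless `χ_⊥ + 2 χ_∥ = 0`, and in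
this exceptional case the mode `n - 2` does so unless both susceptibilities vanish. -/
theorem isResonanceOrder_of_isBigO_iff [l.NeBot] (hr₀ : 0 < M.r₀) (hE : 0 < M.E) (hn : 3 ≤ M.n)
    (hε : 0 < ε) (he : Tendsto e l (𝓝[≠] (-1))) (hf : Tendsto f l (𝓝[≠] (-1)))
    (hef : (fun i => 1 + e i) =O[l] fun i => 1 + f i) :
    IsResonanceOrder l (fun i => (‖1 + e i‖ ^ 3 * ‖1 + f i‖)⁻¹)
      (fun i => M.secondHarmonicField (e i) (f i) ε) {z | M.r₀ < ‖z‖} ↔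
        M.χperp ≠ 0 ∨ M.χpar ≠ 0 := by
  have hg := eight_pi_mul_sq_ne_zero hE
  have hn1 := natCast_sub_one_ne_zero hn
  have hb := isResonanceBound_simultaneous (ε := ε) hr₀ hn hε he hf
  obtain ⟨he, hne⟩ := tendsto_nhdsWithin_iff.1 he
  obtain ⟨hf, hnf⟩ := tendsto_nhdsWithin_iff.1 hf
  have hbound : IsResonanceBound l (fun i => (‖1 + e i‖ ^ 3 * ‖1 + f i‖)⁻¹)
      (fun i => M.secondHarmonicField (e i) (f i) ε) Set.univ := by
    obtain ⟨C, hC⟩ := hef.bound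
    refine hb.of_eventually_le (K := C + 1) (fun i => by positivity) ?_
    filter_upwards [hne, hnf, hC] with i hi hi' k
    have ha : 0 < ‖1 + e i‖ := norm_pos_iff.2 (one_add_ne_zero hi)
    have hb : 0 < ‖1 + f i‖ := norm_pos_iff.2 (one_add_ne_zero hi')
    rw [add_mul, one_mul, ← div_eq_mul_inv]
    gcongr
    rw [inv_eq_one_div, div_le_div_iff₀ (by positivity) (by positivity)]
    calc 1 * (‖1 + e i‖ ^ 3 * ‖1 + f i‖) = ‖1 + e i‖ ^ 2 * ‖1 + f i‖ * ‖1 + e i‖ := by ring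
      _ ≤ ‖1 + e i‖ ^ 2 * ‖1 + f i‖ * (C * ‖1 + f i‖) := by gcongr
      _ = C * (‖1 + e i‖ ^ 2 * ‖1 + f i‖ ^ 2) := by ring
  simp only [← norm_pow, ← norm_mul] at hbound ⊢
  set g := 8 * (Real.pi : ℂ) * (M.E : ℂ) ^ 2 with hgdef
  have hlim {F : ℂ × ℂ → ℂ} (hF : Continuous F) :
      Tendsto (fun i => F (e i, f i)) l (𝓝 (F (-1, -1))) :=
    (hF.tendsto _).comp (he.prodMk_nhds hf)
  have hd : ∀ᶠ i in l, (1 + e i) ^ 3 * (1 + f i) ≠ 0 := (hne.and hnf).mono fun i hi =>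
    mul_ne_zero (pow_ne_zero _ (one_add_ne_zero hi.1)) (one_add_ne_zero hi.2)
  have h₀ : Tendsto (fun i => ((1 + e i) ^ 3 * (1 + f i)) * M.outerCoeff (e i) (f i)) l
      (𝓝 0) := by
    have k := hlim (F := fun p => (1 + p.1) * (g * (M.χperp * p.1 ^ 2 * p.2 + 2 * M.χpar * p.1)))
      (by fun_prop)
    simp only [add_neg_cancel, zero_mul] at k
    refine k.congr' ?_
    filter_upwards [hne, hnf] with i hi hi'
    have ha := one_add_ne_zero hi
    have hb := one_add_ne_zero hi'
    simp only [outerCoeff, prefactor, ← hgdef]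
    field_simp
  have h₃ : Tendsto (fun i => ((1 + e i) ^ 3 * (1 + f i)) * M.outerPlus (e i) (f i)) l
      (𝓝 0) := by
    have k := hlim (F := fun p => (1 + p.1) * (g * ((M.n : ℂ) + 1)
      * (M.χperp * p.1 ^ 2 * p.2 + 2 * M.χpar * p.1))) (by fun_prop)
    simp only [add_neg_cancel, zero_mul] at k
    refine k.congr' ?_
    filter_upwards [hne, hnf] with i hi hi'
    have ha := one_add_ne_zero hi
    have hb := one_add_ne_zero hi'
    simp only [outerPlus, prefactor, ← hgdef]
    field_simp
  have h₂ : Tendsto (fun i => ((1 + e i) ^ 3 * (1 + f i)) * M.outerMid (e i) (f i)) l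
      (𝓝 (4 * g * ((M.n : ℂ) - 1) * (M.χperp + 2 * M.χpar))) := by
    have k := hlim (F := fun p => 2 * g * ((p.1 - 1) * ((M.n : ℂ) - 1)
      * (M.χperp * p.1 ^ 2 * p.2 + 2 * M.χpar * p.1))) (by fun_prop)
    refine (k.congr' ?_).trans_eq ?_
    · filter_upwards [hne, hnf] with i hi hi'
      have ha := one_add_ne_zero hi
      have hb := one_add_ne_zero hi'
      simp only [outerMid, prefactor, ← hgdef]
      field_simp
    · congr 1
      ring
  -- The contribution `(1 + e) / (1 + f)` times `doubleResidue` to `(1 + e)³ (1 + f) M_{n-2}` need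
  -- not converge. Either `M_n` alone gives the order, or `doubleResidue` vanishes in the limit.
  by_cases hχ : M.χperp + 2 * M.χpar = 0
  · have hr : Tendsto (fun i => (1 + e i) * ((1 + e i) / (1 + f i))) l (𝓝 0) := by
      have k : (fun i => (1 + e i) / (1 + f i)) =O[l] fun _ => (1 : ℂ) := by
        refine (hef.mul (isBigO_refl (fun i => (1 + f i)⁻¹) l)).congr' ?_ ?_
        · exact Eventually.of_forall fun i => (div_eq_mul_inv _ _).symm
        · exact hnf.mono fun i hi => mul_inv_cancel₀ (one_add_ne_zero hi)
      have k' := ((isLittleO_one_iff ℂ).2 (tendsto_one_add_nhds_zero he)).mul_isBigO k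
      simpa using k'
    have h₁ : Tendsto (fun i => ((1 + e i) ^ 3 * (1 + f i)) * M.outerMinus (e i) (f i)) l
        (𝓝 (4 * g * ((M.n : ℂ) - 1) * M.χperp)) := by
      have k := ((hlim (F := fun p => (1 + p.1) * (g * (2 * M.χpar * p.1 * (p.2 + M.n - 1)))
        + g * M.fundamentalResidue p.1 p.2) (by unfold fundamentalResidue; fun_prop)).sub
        (hr.mul (hlim (F := fun p => g * (2 * M.χpar * p.1 * (p.2 * (p.2 - 3)))) (by fun_prop))))
      refine (k.congr' ?_).trans_eq ?_
      · filter_upwards [hne, hnf] with i hi hi'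
        have ha := one_add_ne_zero hi
        have hb := one_add_ne_zero hi'
        simp only [outerMinus, prefactor, ← hgdef, doubleResidue_of_add_eq_zero hχ]
        field_simp
        ring
      · rw [fundamentalResidue]
        congr 1
        ring
    rw [isResonanceOrder_secondHarmonicField_iff hr₀ hn hε hd hbound h₀ h₃ h₁ h₂,
      mul_ne_zero_iff_left (mul_ne_zero (mul_ne_zero (by norm_num) hg) hn1), hχ, mul_zero]
    rcases eq_or_ne M.χpar 0 with h | h
    · simp [h]
    · have : M.χperp ≠ 0 := by
        rw [eq_neg_of_add_eq_zero_left hχ]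
        simpa using h
      simp [h, this]
  · refine iff_of_true ⟨hbound.mono (Set.subset_univ _),
      exists_le_norm_secondHarmonicField_of_mid hr₀ hε hd h₀ h₃ h₂
        (mul_ne_zero (mul_ne_zero (mul_ne_zero (by norm_num) hg) hn1) hχ)⟩ ?_
    by_contra! h
    exact hχ (by rw [h.1, h.2]; simp)

end Simultaneous

end NanowireModel

theorem mainTheorem3 (M : NanowireModel) (hr₀ : 0 < M.r₀) (hE : 0 < M.E) (hn : 3 ≤ M.n) :
    -- for nonresonant permittivities the field expansion exists
    (∀ eω e2ω : ℂ, eω ≠ -1 → e2ω ≠ -1 →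
      ∃ U₀ U₁ : TwoSidedField, M.IsSecondHarmonic eω e2ω U₀ U₁) ∧
    -- and the second-harmonic field has the explicit coefficients
    (∀ eω e2ω : ℂ, eω ≠ -1 → e2ω ≠ -1 →
      ∀ U₀ U₁ : TwoSidedField, M.IsSecondHarmonic eω e2ω U₀ U₁ →
        (∀ z : ℂ, ‖z‖ < M.r₀ →
          U₀.inner z =
            -(M.χperp * eω ^ 2 * (8 * (Real.pi : ℂ) * (M.E : ℂ) ^ 2 / (1 + eω) ^ 2))
              - (M.χperp * eω ^ 2 - 2 * M.χpar * eω) * M.prefactor eω e2ω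
                * ((‖z‖ : ℂ) ^ 2 / (M.r₀ : ℂ) ^ 2) * cosMode 2 z) ∧
        (∀ z : ℂ, M.r₀ < ‖z‖ →
          U₀.outer z =
            (M.χperp * eω ^ 2 * e2ω + 2 * M.χpar * eω) * M.prefactor eω e2ω
              * ((M.r₀ : ℂ) ^ 2 / (‖z‖ : ℂ) ^ 2) * cosMode 2 z) ∧
        (∀ z : ℂ, M.r₀ < ‖z‖ →
          U₁.outer z =
            M.coeffMinus eω e2ω / (‖z‖ : ℂ) ^ (M.n - 2) * cosMode (M.n - 2) z
              + M.coeffMid eω e2ω / (‖z‖ : ℂ) ^ M.n * cosMode M.n z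
              + M.coeffPlus eω e2ω / (‖z‖ : ℂ) ^ (M.n + 2) * cosMode (M.n + 2) z)) ∧
    -- resonances of the second-harmonic field `U₀ + ε U₁`
    (∀ U₀ U₁ : ℂ → ℂ → TwoSidedField,
      (∀ eω e2ω : ℂ, eω ≠ -1 → e2ω ≠ -1 →
        M.IsSecondHarmonic eω e2ω (U₀ eω e2ω) (U₁ eω e2ω)) →
      ∀ ε : ℝ, 0 < ε →
      -- resonance at the fundamental frequency only
      (∀ e2ω : ℂ, e2ω ≠ -1 →
        IsResonanceBound (𝓝[≠] (-1 : ℂ)) (fun eω => (‖1 + eω‖ ^ 3)⁻¹)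
          (fun eω => ((U₀ eω e2ω).expand (U₁ eω e2ω) ε).onPlane M.r₀) Set.univ ∧
        (IsResonanceOrder (𝓝[≠] (-1 : ℂ)) (fun eω => (‖1 + eω‖ ^ 3)⁻¹)
          (fun eω => ((U₀ eω e2ω).expand (U₁ eω e2ω) ε).onPlane M.r₀) {z | M.r₀ < ‖z‖} ↔
            (M.χperp * e2ω ≠ 0 ∨ M.χpar ≠ 0))) ∧
      -- resonance at the double frequency only
      (∀ eω : ℂ, eω ≠ -1 →
        IsResonanceBound (𝓝[≠] (-1 : ℂ)) (fun e2ω => (‖1 + e2ω‖ ^ 2)⁻¹)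
          (fun e2ω => ((U₀ eω e2ω).expand (U₁ eω e2ω) ε).onPlane M.r₀) Set.univ ∧
        (IsResonanceOrder (𝓝[≠] (-1 : ℂ)) (fun e2ω => (‖1 + e2ω‖ ^ 2)⁻¹)
          (fun e2ω => ((U₀ eω e2ω).expand (U₁ eω e2ω) ε).onPlane M.r₀) {z | M.r₀ < ‖z‖} ↔
            (eω ≠ 0 ∧ M.χperp * eω ≠ 2 * M.χpar))) ∧
      -- simultaneous resonance at both frequencies
      (∀ {ι : Type} (l : Filter ι) [l.NeBot] (eω e2ω : ι → ℂ),
        Tendsto eω l (𝓝[≠] (-1 : ℂ)) → Tendsto e2ω l (𝓝[≠] (-1 : ℂ)) →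
        IsResonanceBound l
          (fun i => (‖1 + eω i‖ ^ 2 * ‖1 + e2ω i‖ ^ 2)⁻¹ + (‖1 + eω i‖ ^ 3 * ‖1 + e2ω i‖)⁻¹)
          (fun i => ((U₀ (eω i) (e2ω i)).expand (U₁ (eω i) (e2ω i)) ε).onPlane M.r₀)
          Set.univ ∧
        ((fun i => 1 + e2ω i) =o[l] (fun i => 1 + eω i) →
          (IsResonanceOrder l (fun i => (‖1 + eω i‖ ^ 2 * ‖1 + e2ω i‖ ^ 2)⁻¹)
            (fun i => ((U₀ (eω i) (e2ω i)).expand (U₁ (eω i) (e2ω i)) ε).onPlane M.r₀)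
            {z | M.r₀ < ‖z‖} ↔ M.χperp + 2 * M.χpar ≠ 0)) ∧
        ((fun i => 1 + eω i) =O[l] (fun i => 1 + e2ω i) →
          (IsResonanceOrder l (fun i => (‖1 + eω i‖ ^ 3 * ‖1 + e2ω i‖)⁻¹)
            (fun i => ((U₀ (eω i) (e2ω i)).expand (U₁ (eω i) (e2ω i)) ε).onPlane M.r₀)
            {z | M.r₀ < ‖z‖} ↔ (M.χperp ≠ 0 ∨ M.χpar ≠ 0))))) := by
  refine ⟨fun e f he hf => ⟨_, _, _, _, NanowireModel.isFieldExpansion_secondHarmonic hr₀ hn he hf⟩,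
    fun e f he hf U₀ U₁ ⟨_, _, hU⟩ => ?_, fun U₀ U₁ hU ε hε => ?_⟩
  · obtain ⟨⟨h1, h2⟩, -, h4⟩ := hU.secondHarmonic_unique hr₀ he hf
      (NanowireModel.isFieldExpansion_secondHarmonic hr₀ hn he hf)
    exact ⟨fun z hz => (h1 z hz.le).trans (M.secondHarmonic₀_inner_eq e f z),
      fun z hz => (h2 z hz.le).trans (M.secondHarmonic₀_outer_eq e f z),
      fun z hz => (h4 z hz.le).trans (M.secondHarmonic₁_outer_eq hn e f z)⟩
  have key {e f : ℂ} (he : e ≠ -1) (hf : f ≠ -1) :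
      M.secondHarmonicField e f ε = ((U₀ e f).expand (U₁ e f) ε).onPlane M.r₀ :=
    ((hU e f he hf).onPlane_expand hr₀ hn he hf ε).symm
  refine ⟨fun f hf => ?_, fun e he => ?_, fun l _ e f he hf => ?_⟩
  · have h : ∀ᶠ e in 𝓝[≠] (-1 : ℂ),
        M.secondHarmonicField e f ε = ((U₀ e f).expand (U₁ e f) ε).onPlane M.r₀ :=
      eventually_nhdsWithin_of_forall fun e he => key he hf
    exact ⟨(NanowireModel.isResonanceBound_fundamental hr₀ hn hε hf).congr h,
      (isResonanceOrder_congr h).symm.trans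
        (NanowireModel.isResonanceOrder_fundamental_iff hr₀ hE hn hε hf)⟩
  · have h : ∀ᶠ f in 𝓝[≠] (-1 : ℂ),
        M.secondHarmonicField e f ε = ((U₀ e f).expand (U₁ e f) ε).onPlane M.r₀ :=
      eventually_nhdsWithin_of_forall fun f hf => key he hf
    exact ⟨(NanowireModel.isResonanceBound_double hr₀ hn hε he).congr h,
      (isResonanceOrder_congr h).symm.trans
        (NanowireModel.isResonanceOrder_double_iff hr₀ hE hn hε he)⟩
  · have h : ∀ᶠ i in l, M.secondHarmonicField (e i) (f i) ε
        = ((U₀ (e i) (f i)).expand (U₁ (e i) (f i)) ε).onPlane M.r₀ :=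
      ((tendsto_nhdsWithin_iff.1 he).2.and (tendsto_nhdsWithin_iff.1 hf).2).mono
        fun i hi => key hi.1 hi.2
    exact ⟨(NanowireModel.isResonanceBound_simultaneous hr₀ hn hε he hf).congr h,
      fun hfe => (isResonanceOrder_congr h).symm.trans
        (NanowireModel.isResonanceOrder_of_isLittleO_iff hr₀ hE hn hε he hf hfe),
      fun hef => (isResonanceOrder_congr h).symm.trans
        (NanowireModel.isResonanceOrder_of_isBigO_iff hr₀ hE hn hε he hf hef)⟩
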